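/- Identify the plane with $\mathbb R^2$. A *regular shrinking network* is a complete, embedded, locally finite (for instance finite) family of curves in the plane, each parametrized by arclength, such that: * each curve is a compact arc (whose two ends may coincide), a half-infinite curve with one end, a doubly infinite curve without ends, or a closed curve without ends; each curve is of class $C^2$ up to its ends, is simple except possibly for coinciding ends, and distinct curves meet only at their ends; * at every end point exactly three curve ends meet (a triple junction), and any two of the three form there an angle of $120$ degrees; * every curve $\gamma$ satisfies the shrinker equation $\overline{k}+\gamma^\perp=0$, where $\overline{k}$ is the curvature vector and $\gamma^\perp$ is the component of the position vector $\gamma$ normal to the curve. A *region* of the network is a connected component of the complement of the union of its curves. A *two-curve region* is a bounded region whose topological boundary is the union of exactly two (distinct) curves of the network. **Proposition.** In any regular shrinking network, every two-curve region contains the origin in its interior. Consequently, a regular shrinking network has at most one two-curve region. -/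

import Mathlib

open scoped ContDiff

/-- The four kinds of curves of a complete planar network, parametrized by arclength: a compact
arc of length `ℓ` (its two ends may sit at the same point, which gives a loop based at a
junction), a half-infinite curve starting at a junction, a doubly infinite curve, and a closed
curve of length `ℓ` which carries no junction. -/
inductive CurveKind where
  | arc (ℓ : ℝ)
  | ray
  | line
  | closed (ℓ : ℝ)

namespace CurveKind

/-- The parameter interval; a closed curve is parametrized periodically by the whole line. -/
def domain : CurveKind → Set ℝ
  | arc ℓ => Set.Icc 0 ℓ
  | ray => Set.Ici 0
  | line => Set.univ
  | closed _ => Set.univ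

/-- The end parameters of the curve. -/
def ends : CurveKind → Set ℝ
  | arc ℓ => {0, ℓ}
  | ray => {0}
  | line => ∅
  | closed _ => ∅

/-- Lengths are positive. -/
def Admissible : CurveKind → Prop
  | arc ℓ => 0 < ℓ
  | ray => True
  | line => True
  | closed ℓ => 0 < ℓ

/-- Two parameters are identified: modulo the length for a closed curve, equality otherwise. -/
def SameParam : CurveKind → ℝ → ℝ → Prop
  | arc _, s, t => s = t
  | ray, s, t => s = t
  | line, s, t => s = t
  | closed ℓ, s, t => ∃ n : ℤ, t = s + n * ℓ

end CurveKind

/-- A family of parametrized curves in the plane `ℂ = ℝ²`. -/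
structure PlaneNetwork (ι : Type*) where
  kind : ι → CurveKind
  curve : ι → ℝ → ℂ

namespace PlaneNetwork

variable {ι : Type*} (N : PlaneNetwork ι)

/-- The parameter interval of the `i`-th curve. -/
def domain (i : ι) : Set ℝ := (N.kind i).domain

/-- The set of points of the `i`-th curve, ends included. -/
def trace (i : ι) : Set ℂ := N.curve i '' N.domain i

/-- The set of points of the network. -/
def support : Set ℂ := ⋃ i, N.trace i

/-- The velocity of the `i`-th curve (one-sided at the ends). -/
noncomputable def tangent (i : ι) (s : ℝ) : ℂ := derivWithin (N.curve i) (N.domain i) s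

/-- The second derivative of the `i`-th curve (one-sided at the ends); this is the curvature
vector, since the parameter is arclength. -/
noncomputable def curvatureVector (i : ι) (s : ℝ) : ℂ :=
  derivWithin (N.tangent i) (N.domain i) s

/-- The component of the position vector normal to the `i`-th curve. -/
noncomputable def normalPosition (i : ι) (s : ℝ) : ℂ :=
  N.curve i s - (inner ℝ (N.curve i s) (N.tangent i s) : ℝ) • N.tangent i s

/-- The curve ends of the network: pairs of a curve and one of its end parameters. -/
def curveEnds : Set (ι × ℝ) := {e | e.2 ∈ (N.kind e.1).ends}

/-- The point of the plane at which a curve end sits. -/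
def endPoint (e : ι × ℝ) : ℂ := N.curve e.1 e.2

/-- The unit tangent vector at a curve end, pointing from the end into the curve. -/
noncomputable def endTangent (e : ι × ℝ) : ℂ :=
  if e.2 = 0 then N.tangent e.1 e.2 else -N.tangent e.1 e.2

/-- A complete, embedded, regular network: a locally finite family of `C²` curves parametrized
by arclength, which are simple and meet each other only at their ends, such that exactly three
curve ends sit at each end point and any two of the three form there an angle of 120 degrees. -/
structure IsRegular : Prop where
  admissible : ∀ i, (N.kind i).Admissible
  locallyFinite : LocallyFinite N.trace
  contDiffOn : ∀ i, ContDiffOn ℝ 2 (N.curve i) (N.domain i)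
  arclength : ∀ i, ∀ s ∈ N.domain i, ‖N.tangent i s‖ = 1
  periodic : ∀ i ℓ, N.kind i = CurveKind.closed ℓ → Function.Periodic (N.curve i) ℓ
  embedded : ∀ i j s t, s ∈ N.domain i → s ∉ (N.kind i).ends → t ∈ N.domain j →
    N.curve i s = N.curve j t → i = j ∧ (N.kind i).SameParam s t
  triple : ∀ e ∈ N.curveEnds, {e' ∈ N.curveEnds | N.endPoint e' = N.endPoint e}.ncard = 3
  angles : ∀ e ∈ N.curveEnds, ∀ e' ∈ N.curveEnds, e ≠ e' → N.endPoint e = N.endPoint e' →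
    InnerProductGeometry.angle (N.endTangent e) (N.endTangent e') = 2 * Real.pi / 3

/-- The shrinker equation: curvature vector plus normal component of the position vanish. -/
def IsShrinking : Prop :=
  ∀ i, ∀ s ∈ N.domain i, N.curvatureVector i s + N.normalPosition i s = 0

/-- The regions of the network are the connected components of its complement. -/
def IsRegion (U : Set ℂ) : Prop :=
  ∃ z ∈ N.supportᶜ, U = connectedComponentIn N.supportᶜ z

/-- A bounded region whose boundary consists of exactly two curves of the network. -/
def IsTwoCurveRegion (U : Set ℂ) : Prop :=
  N.IsRegion U ∧ Bornology.IsBounded U ∧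
    ∃ i j, i ≠ j ∧ frontier U = N.trace i ∪ N.trace j

end PlaneNetwork

open scoped Topology

/-! An arc of a shrinker either lies on a line through the origin or is a polar graph `exp (u t + i
t)`. With `tan ψ = u'` the equation becomes `ψ' = 1 - e^{2u}`, and the momentum `r e^{-r²/2} cos ψ`,
`r = e^u`, is conserved. The radius thus oscillates about the unit circle. Over five half turns such
a graph meets itself (`exists_self_meeting`), so infinite curves are straight and every bounded
curve is a polar graph or a radial segment.

Let `U` be a two-curve region without the origin. Every ray through `U` leaves it both outwards and
inwards, so `U` lies below one of its boundary arcs and above another. At each junction on its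
boundary `U` fills exactly one sector of 120 degrees between two arms. A count of the curve ends
leaves a few configurations. Two radial segments cannot bound an open set. Two graphs run in
opposite senses would have `U` on the same side of both. For two loops, the change of `ψ` around a
loop is `2π` minus twice the enclosed area; it is nonnegative for the outer loop and nonpositive for
the inner one, although the outer area is larger (`loops_false`). Two graphs with common ends form a
lens, and a graph with a radial segment forms a half lens; extra turns are excluded by embeddedness
(`no_spiral`, `shift_sign`).

The analytic core is `no_lens` and `no_half_lens`. The tangent of a polar graph turns by the change
of `t - ψ`. The outer arc of a lens turns by at least `4π/3`, the arc of a half lens by exactly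
`4π/3`. If the radius has a single maximum, the turning on either side of it is less than `2π/3`
(`descent_turning_lt`), a contradiction. If there are more extrema, the passage from the end to the
first minimum is longer than a quarter turn (`half_pi_lt_of_crest`): two such passages do not fit
into a half lens, and in a lens the inner arc would stay inside the unit circle for too long
(`no_lens_core`).

These durations are measured by the phase `arcsin (sin ψ / sin m)`, where `m` is the slope angle on
the unit circle: its speed depends on the radius alone and is estimated through `wellDepth`. -/

/-! ### Elementary inequalities for the speed of the phase, and numerical bounds -/

theorem mul_exp_one_sub_lt_one {x : ℝ} (hx : x ≠ 1) : x * Real.exp (1 - x) < 1 := by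
  have h := Real.add_one_lt_exp (sub_ne_zero.mpr hx)
  have h2 : Real.exp (x - 1) * Real.exp (1 - x) = 1 := by
    rw [← Real.exp_add]; simp
  nlinarith [Real.exp_pos (1 - x), Real.exp_pos (x - 1)]

theorem exp_quartic_le {p : ℝ} (hp : 0 ≤ p) :
    1 + p + p ^ 2 / 2 + p ^ 3 / 6 + p ^ 4 / 24 ≤ Real.exp p := by
  have h := Real.sum_le_exp_of_nonneg hp 5
  simp [Finset.sum_range_succ, Nat.factorial] at h
  linarith

/-- The potential `1 - x e^{1-x}`, with `x` the squared distance to the origin. -/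
noncomputable def wellDepth (x : ℝ) : ℝ := 1 - x * Real.exp (1 - x)

theorem wellDepth_pos {x : ℝ} (hx : x ≠ 1) : 0 < wellDepth x := by
  unfold wellDepth; linarith [mul_exp_one_sub_lt_one hx]

/-- Integrated along a curve inside the unit circle, with `x = r²`, this bounds the elapsed angle by
the change of `arcsin (sin ψ / sin m) / √2 + ψ / 3`. Both weights come from the expansion at `x =
1`: with `p = 1 - x`, `√(2 wellDepth) = p + p²/3 + ...`. -/
theorem one_le_inner_upper {x : ℝ} (h0 : 0 < x) (h1 : x < 1) :
    1 ≤ (1 - x) * ((1 / √2) / √(wellDepth x) + 1 / 3) := by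
  have hS := wellDepth_pos h1.ne
  have hs : 0 < √(wellDepth x) := Real.sqrt_pos.mpr hS
  obtain ⟨p, hp⟩ : ∃ p, p = 1 - x := ⟨_, rfl⟩
  have hp0 : 0 < p := by linarith
  have hp1 : p < 1 := by linarith
  have h2 : (0 : ℝ) < √2 := by positivity
  have hsq2 : √2 ^ 2 = 2 := Real.sq_sqrt (by norm_num)
  -- The claim is equivalent to this bound, whose two sides agree to second order in `p`.
  have key : √2 * √(wellDepth x) ≤ 3 * p / (3 - p) := by
    rw [← Real.sqrt_mul (by norm_num)]
    apply Real.sqrt_le_iff.mpr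
    refine ⟨div_nonneg (by linarith) (by linarith), ?_⟩
    rw [div_pow, le_div_iff₀ (by nlinarith)]
    unfold wellDepth
    rw [← hp]
    have hx : x = 1 - p := by linarith
    rw [hx]
    have he := exp_quartic_le hp0.le
    have : (1 - p) * (1 + p + p ^ 2 / 2 + p ^ 3 / 6) ≤ (1 - p) * Real.exp p := by
      apply mul_le_mul_of_nonneg_left _ (by linarith)
      nlinarith [pow_pos hp0 4]
    have h3 : 2 * (1 - (1 - p) * Real.exp p) ≤ p ^ 2 + 2 * p ^ 3 / 3 + p ^ 4 / 3 := by
      nlinarith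
    calc 2 * (1 - (1 - p) * Real.exp p) * (3 - p) ^ 2
        ≤ (p ^ 2 + 2 * p ^ 3 / 3 + p ^ 4 / 3) * (3 - p) ^ 2 := by
          apply mul_le_mul_of_nonneg_right h3 (by positivity)
      _ ≤ (3 * p) ^ 2 := by
          have : (3 * p) ^ 2 - (p ^ 2 + 2 * p ^ 3 / 3 + p ^ 4 / 3) * (3 - p) ^ 2
            = p ^ 5 * (4 / 3 - p / 3) + 0 * p := by ring
          nlinarith [mul_nonneg (pow_pos hp0 5).le (by linarith : (0 : ℝ) ≤ 4 / 3 - p / 3)]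
  rw [← hp]
  have e : p * ((1 / √2) / √(wellDepth x) + 1 / 3) = p / (√2 * √(wellDepth x)) + p / 3 := by
    field_simp
  rw [e]
  have : (3 - p) / 3 ≤ p / (√2 * √(wellDepth x)) := by
    rw [le_div_iff₀ (by positivity)]
    have h3p : 0 < 3 - p := by linarith
    rw [le_div_iff₀ h3p] at key
    linarith
  linarith

/-- Squared, this is `1 + p ≤ exp p` with `p = 1 - x`. Inside the unit circle the phase therefore
advances at least as fast as the polar angle. -/
theorem one_le_inner_sturm {x : ℝ} (h0 : 0 < x) (h1 : x < 1) :
    1 ≤ (1 - x) / √(wellDepth x) := by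
  have hS := wellDepth_pos h1.ne
  rw [le_div_iff₀ (Real.sqrt_pos.mpr hS), one_mul]
  apply Real.sqrt_le_iff.mpr
  refine ⟨by linarith, ?_⟩
  unfold wellDepth
  have h := Real.add_one_le_exp (1 - x)
  nlinarith

/-- The reverse comparison, for lower bounds of durations. The weight `2/3` gives equality in the
limit `x → 0`. -/
theorem inner_lower_le_one {x : ℝ} (h0 : 0 < x) (h1 : x < 1) :
    (1 - x) * ((2 / 3) / √(wellDepth x) + 1 / 3) ≤ 1 := by
  have hS := wellDepth_pos h1.ne
  have hs : 0 < √(wellDepth x) := Real.sqrt_pos.mpr hS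
  obtain ⟨p, hp⟩ : ∃ p, p = 1 - x := ⟨_, rfl⟩
  have hp0 : 0 < p := by linarith
  have hp1 : p < 1 := by linarith
  -- This is what the square of `key` requires, since `1 - 4p²/(3-p)² = 3(1-p)(3+p)/(3-p)²`.
  have hexp : Real.exp p ≤ 3 * (3 + p) / (3 - p) ^ 2 := by
    have := Real.exp_bound' hp0.le hp1.le (n := 4) (by norm_num)
    simp [Finset.sum_range_succ, Nat.factorial] at this
    refine this.trans ?_
    rw [le_div_iff₀ (by nlinarith)]
    nlinarith [mul_pos hp0 hp0, pow_pos hp0 3, pow_pos hp0 4, pow_pos hp0 5,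
      mul_nonneg (pow_pos hp0 2).le (by linarith : (0:ℝ) ≤ 1 - p),
      mul_nonneg (pow_pos hp0 3).le (by linarith : (0:ℝ) ≤ 1 - p),
      mul_nonneg (pow_pos hp0 4).le (by linarith : (0:ℝ) ≤ 1 - p),
      mul_nonneg (pow_pos hp0 5).le (by linarith : (0:ℝ) ≤ 1 - p)]
  have key : 2 * p / (3 - p) ≤ √(wellDepth x) := by
    apply Real.le_sqrt_of_sq_le
    rw [div_pow, div_le_iff₀ (by nlinarith)]
    unfold wellDepth
    rw [← hp]
    have hx : x = 1 - p := by linarith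
    rw [hx]
    rw [le_div_iff₀ (by nlinarith)] at hexp
    nlinarith [mul_le_mul_of_nonneg_left hexp (by linarith : (0:ℝ) ≤ 1 - p)]
  rw [← hp]
  have h3p : 0 < 3 - p := by linarith
  rw [div_le_iff₀ h3p] at key
  have : p * (2 / 3 / √(wellDepth x)) ≤ (3 - p) / 3 := by
    rw [← mul_div_assoc, div_le_iff₀ hs]
    linarith
  linarith

/-- The Taylor polynomial times `exp y` has derivative `-(y³/6) exp y`, hence its maximum at `0`.
Both signs of `y` are needed, for the expansion about `2` in `outer_profile`. -/
theorem cubic_le_exp_neg (y : ℝ) : 1 - y + y ^ 2 / 2 - y ^ 3 / 6 ≤ Real.exp (-y) := by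
  obtain ⟨g, hg⟩ : ∃ g : ℝ → ℝ, g = fun y => (1 - y + y ^ 2 / 2 - y ^ 3 / 6) * Real.exp y :=
    ⟨_, rfl⟩
  have hd : ∀ y, HasDerivAt g (-(y ^ 3 / 6) * Real.exp y) y := by
    intro y
    have h := ((((hasDerivAt_const y (1 : ℝ)).sub (hasDerivAt_id y)).add
      (((hasDerivAt_id y).pow 2).div_const 2)).sub
      (((hasDerivAt_id y).pow 3).div_const 6)).mul (Real.hasDerivAt_exp y)
    rw [hg]
    refine h.congr_deriv ?_
    simp only [id, Pi.add_apply, Pi.sub_apply, Pi.pow_apply]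
    norm_num
    ring
  have hc : Continuous g := continuous_iff_continuousAt.2 fun y => (hd y).continuousAt
  have h1 : g y ≤ g 0 := by
    rcases le_total 0 y with h | h
    · refine antitoneOn_of_deriv_nonpos (convex_Ici 0) hc.continuousOn
        (fun z _ => (hd z).differentiableAt.differentiableWithinAt) (fun z hz => ?_)
        (Set.self_mem_Ici) h h
      rw [interior_Ici, Set.mem_Ioi] at hz
      rw [(hd z).deriv]
      have := mul_pos (pow_pos hz 3) (Real.exp_pos z)
      linarith
    · refine monotoneOn_of_deriv_nonneg (convex_Iic 0) hc.continuousOn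
        (fun z _ => (hd z).differentiableAt.differentiableWithinAt) (fun z hz => ?_)
        h (Set.self_mem_Iic) h
      rw [interior_Iic, Set.mem_Iio] at hz
      rw [(hd z).deriv]
      have := mul_pos (pow_pos (neg_pos.2 hz) 3) (Real.exp_pos z)
      nlinarith
  have h2 : g y = (1 - y + y ^ 2 / 2 - y ^ 3 / 6) * Real.exp y := by rw [hg]
  have h3 : g 0 = 1 := by rw [hg]; simp
  rw [Real.exp_neg, ← one_div, le_div_iff₀ (Real.exp_pos y)]
  linarith

theorem septic_le_exp_neg {y : ℝ} (hy : 0 ≤ y) :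
    1 - y + y ^ 2 / 2 - y ^ 3 / 6 + y ^ 4 / 24 - y ^ 5 / 120 + y ^ 6 / 720 - y ^ 7 / 5040
      ≤ Real.exp (-y) := by
  obtain ⟨g, hg⟩ : ∃ g : ℝ → ℝ, g = fun y => (1 - y + y ^ 2 / 2 - y ^ 3 / 6 + y ^ 4 / 24
      - y ^ 5 / 120 + y ^ 6 / 720 - y ^ 7 / 5040) * Real.exp y :=
    ⟨_, rfl⟩
  have hd : ∀ y, HasDerivAt g (-(y ^ 7 / 5040) * Real.exp y) y := by
    intro y
    have h := ((((((((hasDerivAt_const y (1 : ℝ)).sub (hasDerivAt_id y)).add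
      (((hasDerivAt_id y).pow 2).div_const 2)).sub
      (((hasDerivAt_id y).pow 3).div_const 6)).add
      (((hasDerivAt_id y).pow 4).div_const 24)).sub
      (((hasDerivAt_id y).pow 5).div_const 120)).add
      (((hasDerivAt_id y).pow 6).div_const 720)).sub
      (((hasDerivAt_id y).pow 7).div_const 5040)).mul (Real.hasDerivAt_exp y)
    rw [hg]
    refine h.congr_deriv ?_
    simp only [id, Pi.add_apply, Pi.sub_apply, Pi.pow_apply]
    norm_num
    ring
  have hc : Continuous g := continuous_iff_continuousAt.2 fun y => (hd y).continuousAt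
  have h1 : g y ≤ g 0 := by
    refine antitoneOn_of_deriv_nonpos (convex_Ici 0) hc.continuousOn
      (fun z _ => (hd z).differentiableAt.differentiableWithinAt) (fun z hz => ?_)
      (Set.self_mem_Ici) hy hy
    rw [interior_Ici, Set.mem_Ioi] at hz
    rw [(hd z).deriv]
    have := mul_pos (pow_pos hz 7) (Real.exp_pos z)
    linarith
  have h2 : g y = (1 - y + y ^ 2 / 2 - y ^ 3 / 6 + y ^ 4 / 24
      - y ^ 5 / 120 + y ^ 6 / 720 - y ^ 7 / 5040) * Real.exp y := by rw [hg]
  have h3 : g 0 = 1 := by rw [hg]; simp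
  rw [Real.exp_neg, ← one_div, le_div_iff₀ (Real.exp_pos y)]
  linarith

theorem outer_profile_small {q : ℝ} (hq : 0 ≤ q) (h : q ≤ 9 / 5) :
    (1 + q / 2) ^ 2 - (39 / 50) ^ 2 * q ^ 2 ≤ (1 + q / 2) ^ 2 * ((1 + q) *
      (1 - q + q ^ 2 / 2 - q ^ 3 / 6 + q ^ 4 / 24 - q ^ 5 / 120 + q ^ 6 / 720
        - q ^ 7 / 5040)) := by
  have hz : 0 ≤ 9 / 5 - q := by linarith
  have key : 0 ≤ 271 / 2500 + q * (-1 / 6) + q ^ 2 * (1 / 12) + q ^ 3 * (-1 / 120)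
      + q ^ 4 * (-7 / 1440) + q ^ 5 * (13 / 5040) + q ^ 6 * (-1 / 1344) + q ^ 7 * (1 / 10080)
      + q ^ 8 * (-1 / 20160) := by
    -- The products of total degree `8` are, up to factors, the Bernstein polynomials of `[0, 9/5]`;
    -- the required inequality is a nonnegative combination of them.
    have b : ∀ i j : ℕ, 0 ≤ q ^ i * (9 / 5 - q) ^ j := fun i j =>
      mul_nonneg (pow_nonneg hq i) (pow_nonneg hz j)
    linarith [b 0 8, b 1 7, b 2 6, b 3 5, b 4 4, b 5 3, b 6 2, b 7 1, b 8 0]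
  nlinarith [mul_nonneg (sq_nonneg q) key]

theorem outer_profile_large {q : ℝ} (h : 9 / 5 ≤ q) (h' : q ≤ 18 / 5) :
    (1 + q / 2) ^ 2 - (39 / 50) ^ 2 * q ^ 2 ≤ (1 + q / 2) ^ 2 * ((1 + q) * (0.1353 *
      (1 - (q - 2) + (q - 2) ^ 2 / 2 - (q - 2) ^ 3 / 6))) := by
  have hz : 0 ≤ q - 9 / 5 := by linarith
  have hw : 0 ≤ 18 / 5 - q := by linarith
  have b : ∀ i j : ℕ, 0 ≤ (q - 9 / 5) ^ i * (18 / 5 - q) ^ j := fun i j =>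
    mul_nonneg (pow_nonneg hz i) (pow_nonneg hw j)
  linarith [b 0 6, b 1 5, b 2 4, b 3 3, b 4 2, b 5 1, b 6 0, b 0 7,
    b 1 6, b 2 5, b 3 4, b 4 3, b 5 2, b 6 1, b 7 0, b 0 8, b 1 7, b 2 6, b 3 5, b 4 4, b 5 3, b 6 2, b 7 1, b 8 0]

/-- Three ranges of `q`: Taylor expansion at `0`, Taylor expansion at `2`, and beyond `18/5` the
left side of `h` is already nonpositive. -/
theorem outer_profile {q : ℝ} (hq : 0 < q) :
    1 - (1 + q) * Real.exp (-q) ≤ (39 / 50) ^ 2 * q ^ 2 / (1 + q / 2) ^ 2 := by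
  rw [le_div_iff₀ (by positivity)]
  suffices h : (1 + q / 2) ^ 2 - (39 / 50) ^ 2 * q ^ 2
      ≤ (1 + q / 2) ^ 2 * ((1 + q) * Real.exp (-q)) by linarith
  have hk : 0 ≤ (1 + q / 2) ^ 2 * (1 + q) := by positivity
  rcases le_total q (9 / 5) with h | h
  · refine (outer_profile_small hq.le h).trans ?_
    have := mul_le_mul_of_nonneg_left (septic_le_exp_neg hq.le) hk
    linarith
  · rcases le_total q (18 / 5) with h' | h'
    · refine (outer_profile_large h h').trans ?_
      have h1 := cubic_le_exp_neg (q - 2)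
      have h2 : (0.1353 : ℝ) ≤ Real.exp (-2) := by
        have := Real.exp_neg_one_gt_d9
        have e : Real.exp (-2) = Real.exp (-1) * Real.exp (-1) := by
          rw [← Real.exp_add]; norm_num
        rw [e]
        nlinarith
      have h3 : Real.exp (-q) = Real.exp (-2) * Real.exp (-(q - 2)) := by
        rw [← Real.exp_add]; congr 1; ring
      have h4 : 0.1353 * (1 - (q - 2) + (q - 2) ^ 2 / 2 - (q - 2) ^ 3 / 6) ≤ Real.exp (-q) := by
        rw [h3]
        calc _ ≤ 0.1353 * Real.exp (-(q - 2)) := by linarith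
          _ ≤ _ := mul_le_mul_of_nonneg_right h2 (Real.exp_pos _).le
      have := mul_le_mul_of_nonneg_left h4 hk
      linarith
    · have : 0 ≤ (1 + q / 2) ^ 2 * ((1 + q) * Real.exp (-q)) := by positivity
      nlinarith

/-- With `q = x - 1` this is `outer_profile`. The weight `39/50` exceeds the value `1/√2` dictated
by `x = 1`. Over a quarter oscillation it contributes `39π/100`, and `39/100 + 83/300 = 2/3` is what
`descent_turning_lt` needs. -/
theorem one_le_outer_upper {x : ℝ} (h1 : 1 < x) :
    1 ≤ (x - 1) * ((39 / 50) / √(wellDepth x) - 1 / 2) := by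
  have hS := wellDepth_pos h1.ne'
  have hs : 0 < √(wellDepth x) := Real.sqrt_pos.mpr hS
  obtain ⟨q, hq⟩ : ∃ q, q = x - 1 := ⟨_, rfl⟩
  have hq0 : 0 < q := by linarith
  have key : √(wellDepth x) ≤ (39 / 50) * q / (1 + q / 2) := by
    apply Real.sqrt_le_iff.mpr
    refine ⟨by positivity, ?_⟩
    have := outer_profile hq0
    unfold wellDepth
    rw [div_pow, mul_pow]
    rw [show x = 1 + q by linarith, show 1 - (1 + q) = -q by ring]
    exact this
  rw [← hq]
  rw [le_div_iff₀ (by positivity)] at key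
  have : 1 + q / 2 ≤ q * (39 / 50 / √(wellDepth x)) := by
    rw [← mul_div_assoc, le_div_iff₀ hs]
    linarith
  linarith

theorem cos_le_quartic {y : ℝ} (hy0 : 0 ≤ y) (hy : y ≤ 2) :
    Real.cos y ≤ 1 - y ^ 2 / 2 + y ^ 4 / 24 := by
  obtain ⟨z, hz⟩ : ∃ z, y = 2 * z := ⟨y / 2, by ring⟩
  rw [hz, Real.cos_two_mul, Real.cos_sq']
  have h9 := Real.sin_ge_sub_cube (x := z) (by linarith)
  have hz0 : 0 ≤ z := by linarith
  have hz1 : z ^ 2 ≤ 1 := by nlinarith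
  have h10 : 0 ≤ z - z ^ 3 / 6 := by
    have : z - z ^ 3 / 6 = z * (1 - z ^ 2 / 6) := by ring
    rw [this]
    exact mul_nonneg hz0 (by linarith)
  have h11 := pow_le_pow_left₀ h10 h9 2
  have h12 : (z - z ^ 3 / 6) ^ 2 = z ^ 2 - z ^ 4 / 3 + (z ^ 3) ^ 2 / 36 := by ring
  have h13 := sq_nonneg (z ^ 3)
  have h14 : (2 * z) ^ 2 / 2 = 2 * z ^ 2 := by ring
  have h15 : (2 * z) ^ 4 / 24 = 2 * z ^ 4 / 3 := by ring
  rw [h14, h15]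
  linarith

theorem sextic_margin {y : ℝ} (hy0 : 0 < y) (hy : y ≤ 1.6) :
    (0.8987 + 0.4083 * y) * (1 - y ^ 2 / 2 + y ^ 4 / 24) < 1 := by
  have hz : 0 ≤ 1.6 - y := by linarith
  have h9 : 0 ≤ y ^ 3 * (1.6 - y) := by positivity
  have h10 : 0 ≤ y ^ 4 * (1.6 - y) := by positivity
  have h11 := sq_nonneg (y - 0.4543)
  have h12 := pow_pos hy0 3
  linarith

/-- The derivative of `arcsin (sin x / M)` is `cos x / √(M² - sin² x)`, at least `1` because `M ≤
1`. -/
theorem arcsin_div_sub_monotone {M : ℝ} (hM : 0 < M) (hM1 : M < 1) {a b : ℝ}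
    (ha : 0 ≤ a) (hab : a ≤ b) (hb : b ≤ Real.pi / 2) (hbM : Real.sin b ≤ M) :
    Real.arcsin (Real.sin a / M) - a ≤ Real.arcsin (Real.sin b / M) - b := by
  have hpi := Real.pi_pos
  refine monotoneOn_of_deriv_nonneg (f := fun x => Real.arcsin (Real.sin x / M) - x)
    (convex_Icc a b) ?_ ?_ ?_ (Set.left_mem_Icc.2 hab) (Set.right_mem_Icc.2 hab) hab
  · exact ((Real.continuous_arcsin.comp (Real.continuous_sin.div_const M)).sub
      continuous_id).continuousOn
  all_goals
    intro x hx
    rw [interior_Icc] at hx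
    have hsx : Real.sin x < M := lt_of_lt_of_le
      (Real.sin_lt_sin_of_lt_of_le_pi_div_two (by linarith [hx.1]) hb hx.2) hbM
    have hs0 : 0 ≤ Real.sin x :=
      Real.sin_nonneg_of_nonneg_of_le_pi (by linarith [hx.1]) (by linarith [hx.2])
    have h1 : Real.sin x / M < 1 := (div_lt_one hM).2 hsx
    have h0 : 0 ≤ Real.sin x / M := div_nonneg hs0 hM.le
    have hd : HasDerivAt (fun x => Real.arcsin (Real.sin x / M) - x)
        (1 / √(1 - (Real.sin x / M) ^ 2) * (Real.cos x / M) - 1) x :=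
      (HasDerivAt.comp x (h₂ := Real.arcsin) (Real.hasDerivAt_arcsin (by linarith) h1.ne)
        ((Real.hasDerivAt_sin x).div_const M)).sub (hasDerivAt_id' x)
  · exact hd.differentiableAt.differentiableWithinAt
  · rw [hd.deriv, sub_nonneg]
    have hc : 0 < Real.cos x := Real.cos_pos_of_mem_Ioo ⟨by linarith [hx.1], by linarith [hx.2]⟩
    have hpos : 0 < 1 - (Real.sin x / M) ^ 2 := by nlinarith
    rw [one_div, ← div_eq_inv_mul, le_div_iff₀ (Real.sqrt_pos.2 hpos), one_mul]
    apply Real.sqrt_le_iff.2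
    refine ⟨by positivity, ?_⟩
    rw [div_pow, div_pow, ← sub_nonneg]
    have : Real.cos x ^ 2 / M ^ 2 - (1 - Real.sin x ^ 2 / M ^ 2) = (1 - M ^ 2) / M ^ 2 := by
      rw [Real.cos_sq']; field_simp; ring
    rw [this]
    exact div_nonneg (by nlinarith) (by positivity)

/-- The extreme case `χ = π/6` of `half_turn_bound`, where `cos v = sin (π/6) / sin m`. Negating the
claim bounds `v` below by an affine function `w` of `y = π/2 - m`, which makes `2 cos w cos y` less
than `1`. -/
theorem arccos_half_bound {m v : ℝ} (hm0 : 0 ≤ m) (hm : m < Real.pi / 2)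
    (hv : v ≤ Real.pi) (h : 2 * Real.cos v * Real.sin m = 1) :
    v / √2 - m / 6 < 149 * Real.pi / 900 := by
  by_contra! hcon
  have hpi := Real.pi_gt_d6
  have hpi' := Real.pi_lt_d6
  obtain ⟨y, hy⟩ : ∃ y, y = Real.pi / 2 - m := ⟨_, rfl⟩
  have hs2 : √2 ^ 2 = 2 := Real.sq_sqrt (by norm_num)
  have hs3 : √3 ^ 2 = 3 := Real.sq_sqrt (by norm_num)
  have hs2l : (1.41421 : ℝ) < √2 := Real.lt_sqrt_of_sq_lt (by norm_num)
  have hs2u : √2 < (1.41422 : ℝ) := (Real.sqrt_lt' (by norm_num)).2 (by norm_num)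
  have hs3l : (1.73205 : ℝ) < √3 := Real.lt_sqrt_of_sq_lt (by norm_num)
  have hs3u : √3 < (1.73206 : ℝ) := (Real.sqrt_lt' (by norm_num)).2 (by norm_num)
  have hy0 : 0 < y := by linarith
  have hy1 : y ≤ Real.pi / 2 := by linarith
  have hcy : Real.sin m = Real.cos y := by
    rw [hy, Real.cos_pi_div_two_sub]
  have hcy0 : 0 ≤ Real.cos y := Real.cos_nonneg_of_mem_Icc ⟨by linarith, hy1⟩
  have hcy1 : Real.cos y < 1 := by
    rw [← Real.cos_zero]
    exact Real.cos_lt_cos_of_nonneg_of_le_pi le_rfl (by linarith) hy0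
  -- Here `56π/225 = 149π/900 + π/12`, the second term being `m/6` at `m = π/2`.
  obtain ⟨w, hw⟩ : ∃ w, w = √2 * (56 * Real.pi / 225 - y / 6) := ⟨_, rfl⟩
  have hwv : w ≤ v := by
    have h1 : 56 * Real.pi / 225 - y / 6 ≤ v / √2 := by
      have e : m = Real.pi / 2 - y := by linarith
      rw [e] at hcon
      linarith
    rw [hw]
    calc √2 * (56 * Real.pi / 225 - y / 6) ≤ √2 * (v / √2) :=
          mul_le_mul_of_nonneg_left h1 (by positivity)
      _ = v := by field_simp
  have hw0 : 0 ≤ w := by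
    rw [hw]; apply mul_nonneg (by positivity); linarith
  have hcw : Real.cos v ≤ Real.cos w := Real.cos_le_cos_of_nonneg_of_le_pi hw0 hv hwv
  rw [hcy] at h
  have h1 : 1 ≤ 2 * Real.cos w * Real.cos y := by
    nlinarith
  -- Expansion about `π/3`, the value of `v` at `m = π/2`.
  obtain ⟨x, hx⟩ : ∃ x, x = Real.pi / 3 - w := ⟨_, rfl⟩
  rcases le_or_gt x 0 with hx0 | hx0
  · have : Real.cos w ≤ Real.cos (Real.pi / 3) :=
      Real.cos_le_cos_of_nonneg_of_le_pi (by linarith) (by linarith) (by linarith)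
    rw [Real.cos_pi_div_three] at this
    nlinarith
  · have e : 2 * Real.cos w = Real.cos x + √3 * Real.sin x := by
      rw [show w = Real.pi / 3 - x by linarith, Real.cos_sub, Real.cos_pi_div_three,
        Real.sin_pi_div_three]
      ring
    have h2 : 2 * Real.cos w ≤ 1 + √3 * x := by
      rw [e]
      have := Real.sin_le hx0.le
      have := Real.cos_le_one x
      nlinarith
    have h3 : √3 * x ≤ 0.4083 * y - 0.1013 := by
      have e2 : √3 * x = √3 * (Real.pi / 3 - √2 * (56 * Real.pi / 225)) + √3 * √2 / 6 * y := by
        rw [hx, hw]; ring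
      rw [e2]
      have h4 : √3 * √2 / 6 ≤ 0.4083 := by
        have := mul_le_mul hs3u.le hs2u.le (by positivity) (by norm_num)
        linarith
      have h5 : Real.pi / 3 - √2 * (56 * Real.pi / 225) ≤ -0.0585 := by
        have h51 : 1 / 3 - √2 * (56 / 225) ≤ -0.01864 := by linarith
        have := mul_le_mul_of_nonneg_left h51 (by linarith : 0 ≤ Real.pi)
        linarith
      have h51 := mul_le_mul_of_nonneg_left h5 (by positivity : 0 ≤ √3)
      have h41 := mul_le_mul_of_nonneg_right h4 hy0.le
      linarith
    have h6 : Real.cos y ≤ 1 - y ^ 2 / 2 + y ^ 4 / 24 :=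
      cos_le_quartic hy0.le (by linarith)
    have h7 : 0 ≤ 1 - y ^ 2 / 2 + y ^ 4 / 24 := hcy0.trans h6
    have h8 : 1 ≤ (0.8987 + 0.4083 * y) * (1 - y ^ 2 / 2 + y ^ 4 / 24) := by
      calc 1 ≤ 2 * Real.cos w * Real.cos y := h1
        _ ≤ (0.8987 + 0.4083 * y) * Real.cos y :=
          mul_le_mul_of_nonneg_right (by linarith) hcy0
        _ ≤ _ := mul_le_mul_of_nonneg_left h6 (by positivity)
    linarith [sextic_margin hy0 (by linarith : y ≤ 1.6)]

/-- As `χ` grows, the arcsine grows at least as fast, and `1/√2 > 2/3`; so the left side is largest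
at `χ = π/6`. There `arccos_half_bound` applies and `149/900 + 1/9 = 83/300`. -/
theorem half_turn_bound {m χ M : ℝ} (hm : m < Real.pi / 2) (hM : M = Real.sin m)
    (hχ : Real.pi / 6 ≤ χ) (hχm : χ ≤ m) :
    (Real.pi / 2 - Real.arcsin (Real.sin χ / M)) / √2 + 2 * χ / 3 - m / 6
      < 83 * Real.pi / 300 := by
  have hpi := Real.pi_pos
  have hs2u : √2 < (1.5 : ℝ) := (Real.sqrt_lt' (by norm_num)).2 (by norm_num)
  have hs20 : 0 < √2 := by positivity
  have hM0 : 1 / 2 ≤ M := by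
    rw [hM, ← Real.sin_pi_div_six]
    exact Real.sin_le_sin_of_le_of_le_pi_div_two (by linarith) hm.le (by linarith)
  have hM1 : M < 1 := by
    rw [hM, ← Real.sin_pi_div_two]
    exact Real.sin_lt_sin_of_lt_of_le_pi_div_two (by linarith) le_rfl hm
  have h1 := arcsin_div_sub_monotone (by linarith) hM1 (by positivity : 0 ≤ Real.pi / 6) hχ
    (by linarith : χ ≤ Real.pi / 2) (by
      rw [hM]; exact Real.sin_le_sin_of_le_of_le_pi_div_two (by linarith) hm.le hχm)
  rw [Real.sin_pi_div_six] at h1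
  obtain ⟨v, hv⟩ : ∃ v, v = Real.pi / 2 - Real.arcsin (1 / 2 / M) := ⟨_, rfl⟩
  have h2 := arccos_half_bound (m := m) (v := v) (by linarith) hm
    (by linarith [Real.neg_pi_div_two_le_arcsin (1 / 2 / M)]) (by
      rw [hv, Real.cos_pi_div_two_sub, Real.sin_arcsin, ← hM]
      · field_simp
      · have : 0 ≤ 1 / 2 / M := by positivity
        linarith
      · rw [div_le_one (by linarith)]; exact hM0)
  have h3 : (Real.pi / 2 - Real.arcsin (Real.sin χ / M)) ≤ v + Real.pi / 6 - χ := by linarith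
  have h4 : (Real.pi / 2 - Real.arcsin (Real.sin χ / M)) / √2 ≤ (v + Real.pi / 6 - χ) / √2 :=
    div_le_div_of_nonneg_right h3 hs20.le
  have h5 : (χ - Real.pi / 6) * (2 / 3) ≤ (χ - Real.pi / 6) / √2 := by
    rw [le_div_iff₀ hs20]
    nlinarith
  have h6 : (v + Real.pi / 6 - χ) / √2 = v / √2 - (χ - Real.pi / 6) / √2 := by ring
  linarith

/-- Here `q = r² - 1` at the largest radius: a far maximum makes the slope angle on the unit circle
nearly right. Jordan's inequality gives `π/2 - m ≤ (π/2) cos m`, and `q cos m < 2`. -/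
theorem inner_deficit_bound {q m : ℝ} (hq : 0 < q) (hm0 : 0 ≤ m) (hm : m ≤ Real.pi / 2)
    (h : Real.cos m ^ 2 = (1 + q) * Real.exp (-q)) : Real.pi / 2 - m < Real.pi / q := by
  have hpi := Real.pi_pos
  have h1 := Real.mul_le_sin (x := Real.pi / 2 - m) (by linarith) (by linarith)
  rw [Real.sin_pi_div_two_sub] at h1
  have h2 : Real.pi / 2 - m ≤ Real.pi / 2 * Real.cos m := by
    calc Real.pi / 2 - m = Real.pi / 2 * (2 / Real.pi * (Real.pi / 2 - m)) := by field_simp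
      _ ≤ _ := mul_le_mul_of_nonneg_left h1 (by positivity)
  have h3 : q * Real.cos m < 2 := by
    apply lt_of_pow_lt_pow_left₀ 2 (by norm_num)
    rw [mul_pow, h]
    have h4 : Real.exp q * Real.exp (-q) = 1 := by rw [← Real.exp_add]; simp
    have h5 := exp_quartic_le hq.le
    have h6 : q ^ 2 * (1 + q) < 2 ^ 2 * Real.exp q := by
      nlinarith [sq_nonneg (q ^ 2 - q), sq_nonneg q, pow_pos hq 3]
    calc q ^ 2 * ((1 + q) * Real.exp (-q)) = q ^ 2 * (1 + q) * Real.exp (-q) := by ring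
      _ < 2 ^ 2 * Real.exp q * Real.exp (-q) := mul_lt_mul_of_pos_right h6 (Real.exp_pos _)
      _ = 2 ^ 2 := by rw [mul_assoc, h4, mul_one]
  refine h2.trans_lt ?_
  rw [lt_div_iff₀ hq]
  nlinarith

/-! ### The shrinker equation for polar graphs, its first integral and the phase -/

/-- A solution, on the interval `[A, B]` of polar angles, of the shrinker equation for a curve
`t ↦ exp (u t + i t)`; the angle `ψ` is the slope angle of the graph `u`. -/
structure IsPolarShrinker (u ψ : ℝ → ℝ) (A B : ℝ) : Prop where
  contU : ContinuousOn u (Set.Icc A B)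
  contψ : ContinuousOn ψ (Set.Icc A B)
  derivU : ∀ t ∈ Set.Ioo A B, HasDerivAt u (Real.tan (ψ t)) t
  derivψ : ∀ t ∈ Set.Ioo A B, HasDerivAt ψ (1 - Real.exp (2 * u t)) t
  memψ : ∀ t ∈ Set.Icc A B, ψ t ∈ Set.Ioo (-(Real.pi / 2)) (Real.pi / 2)

theorem sub_le_of_hasDerivAt_ge {f f' : ℝ → ℝ} {a b C : ℝ} (hab : a ≤ b)
    (hc : ContinuousOn f (Set.Icc a b)) (hd : ∀ t ∈ Set.Ioo a b, HasDerivAt f (f' t) t)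
    (h : ∀ t ∈ Set.Ioo a b, C ≤ f' t) : C * (b - a) ≤ f b - f a := by
  rcases hab.eq_or_lt with rfl | hab
  · simp
  obtain ⟨t, ht, e⟩ := exists_hasDerivAt_eq_slope f f' hab hc hd
  have := h t ht
  rw [e, le_div_iff₀ (by linarith)] at this
  exact this

theorem sub_le_of_hasDerivAt_le {f f' : ℝ → ℝ} {a b C : ℝ} (hab : a ≤ b)
    (hc : ContinuousOn f (Set.Icc a b)) (hd : ∀ t ∈ Set.Ioo a b, HasDerivAt f (f' t) t)
    (h : ∀ t ∈ Set.Ioo a b, f' t ≤ C) : f b - f a ≤ C * (b - a) := by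
  have := sub_le_of_hasDerivAt_ge (f := fun t => -f t) (f' := fun t => -f' t) (C := -C) hab hc.neg
    (fun t ht => (hd t ht).neg) (fun t ht => neg_le_neg (h t ht))
  linarith

theorem lt_of_hasDerivAt_pos {f f' : ℝ → ℝ} {a b : ℝ} (hab : a < b)
    (hc : ContinuousOn f (Set.Icc a b)) (hd : ∀ t ∈ Set.Ioo a b, HasDerivAt f (f' t) t)
    (h : ∀ t ∈ Set.Ioo a b, 0 < f' t) : f a < f b := by
  obtain ⟨t, ht, e⟩ := exists_hasDerivAt_eq_slope f f' hab hc hd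
  have := h t ht
  rw [e, lt_div_iff₀ (by linarith)] at this
  linarith

theorem lt_of_hasDerivAt_neg {f f' : ℝ → ℝ} {a b : ℝ} (hab : a < b)
    (hc : ContinuousOn f (Set.Icc a b)) (hd : ∀ t ∈ Set.Ioo a b, HasDerivAt f (f' t) t)
    (h : ∀ t ∈ Set.Ioo a b, f' t < 0) : f b < f a := by
  have := lt_of_hasDerivAt_pos (f := fun t => -f t) (f' := fun t => -f' t) hab hc.neg
    (fun t ht => (hd t ht).neg) (fun t ht => neg_pos.2 (h t ht))
  linarith

/-- The radial part `r e^{-r²/2}` of the first integral, with `r = e^u`. -/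
noncomputable def radialPart (u : ℝ) : ℝ := Real.exp (u - Real.exp (2 * u) / 2)

theorem radialPart_pos (u : ℝ) : 0 < radialPart u := Real.exp_pos _

theorem hasDerivAt_radialExponent (u : ℝ) :
    HasDerivAt (fun u => u - Real.exp (2 * u) / 2) (1 - Real.exp (2 * u)) u := by
  have h := (hasDerivAt_id' u).sub
    ((((hasDerivAt_id' u).const_mul 2).exp).div_const 2)
  refine h.congr_deriv ?_
  ring

theorem radialPart_strictMonoOn : StrictMonoOn radialPart (Set.Iic 0) := by
  intro a ha b hb hab
  apply Real.exp_lt_exp.2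
  refine lt_of_hasDerivAt_pos (f := fun u => u - Real.exp (2 * u) / 2) hab
    (fun t _ => (hasDerivAt_radialExponent t).continuousAt.continuousWithinAt)
    (fun t _ => hasDerivAt_radialExponent t) (fun t ht => ?_)
  have : Real.exp (2 * t) < 1 := by
    rw [Real.exp_lt_one_iff]; linarith [ht.2, Set.mem_Iic.1 hb]
  linarith

theorem radialPart_strictAntiOn : StrictAntiOn radialPart (Set.Ici 0) := by
  intro a ha b hb hab
  apply Real.exp_lt_exp.2
  refine lt_of_hasDerivAt_neg (f := fun u => u - Real.exp (2 * u) / 2) hab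
    (fun t _ => (hasDerivAt_radialExponent t).continuousAt.continuousWithinAt)
    (fun t _ => hasDerivAt_radialExponent t) (fun t ht => ?_)
  have : 1 < Real.exp (2 * t) := by
    rw [Real.one_lt_exp_iff]; linarith [ht.1, Set.mem_Ici.1 ha]
  linarith

theorem radialPart_le (u : ℝ) : radialPart u ≤ radialPart 0 := by
  rcases le_total u 0 with h | h
  · exact radialPart_strictMonoOn.monotoneOn h Set.self_mem_Iic h
  · exact radialPart_strictAntiOn.antitoneOn Set.self_mem_Ici h h

theorem radialPart_sq (u : ℝ) :
    radialPart u ^ 2 = radialPart 0 ^ 2 * (1 - wellDepth (Real.exp (2 * u))) := by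
  have : wellDepth (Real.exp (2 * u)) = 1 - Real.exp (2 * u) * Real.exp (1 - Real.exp (2 * u)) := rfl
  rw [this, radialPart, radialPart, ← Real.exp_nat_mul, ← Real.exp_nat_mul, sub_sub_cancel,
    ← Real.exp_add, ← Real.exp_add]
  congr 1
  simp
  ring

namespace IsPolarShrinker

variable {u ψ : ℝ → ℝ} {A B : ℝ}

theorem cos_pos (h : IsPolarShrinker u ψ A B) {t : ℝ} (ht : t ∈ Set.Icc A B) :
    0 < Real.cos (ψ t) := Real.cos_pos_of_mem_Ioo (h.memψ t ht)

theorem restrict (h : IsPolarShrinker u ψ A B) {a b : ℝ} (ha : A ≤ a) (hb : b ≤ B) :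
    IsPolarShrinker u ψ a b where
  contU := h.contU.mono (Set.Icc_subset_Icc ha hb)
  contψ := h.contψ.mono (Set.Icc_subset_Icc ha hb)
  derivU t ht := h.derivU t (Set.Ioo_subset_Ioo ha hb ht)
  derivψ t ht := h.derivψ t (Set.Ioo_subset_Ioo ha hb ht)
  memψ t ht := h.memψ t (Set.Icc_subset_Icc ha hb ht)

theorem translate (h : IsPolarShrinker u ψ A B) (d : ℝ) :
    IsPolarShrinker (fun t => u (t + d)) (fun t => ψ (t + d)) (A - d) (B - d) where
  contU := h.contU.comp (by fun_prop) (fun t ht => ⟨by linarith [ht.1], by linarith [ht.2]⟩)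
  contψ := h.contψ.comp (by fun_prop) (fun t ht => ⟨by linarith [ht.1], by linarith [ht.2]⟩)
  derivU t ht := (h.derivU (t + d) ⟨by linarith [ht.1], by linarith [ht.2]⟩).comp_add_const t d
  derivψ t ht := (h.derivψ (t + d) ⟨by linarith [ht.1], by linarith [ht.2]⟩).comp_add_const t d
  memψ t ht := h.memψ (t + d) ⟨by linarith [ht.1], by linarith [ht.2]⟩

theorem reflect (h : IsPolarShrinker u ψ A B) :
    IsPolarShrinker (fun t => u (-t)) (fun t => -ψ (-t)) (-B) (-A) where
  contU := h.contU.comp (by fun_prop) (fun t ht => ⟨by linarith [ht.2], by linarith [ht.1]⟩)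
  contψ := (h.contψ.comp (by fun_prop)
    (fun t ht => ⟨by linarith [ht.2], by linarith [ht.1]⟩)).neg
  derivU t ht := by
    have := (h.derivU (-t) ⟨by linarith [ht.2], by linarith [ht.1]⟩).comp t (hasDerivAt_neg t)
    refine this.congr_deriv ?_
    simp [Real.tan_neg]
  derivψ t ht := by
    have := ((h.derivψ (-t) ⟨by linarith [ht.2], by linarith [ht.1]⟩).comp t
      (hasDerivAt_neg t)).neg
    refine this.congr_deriv ?_
    simp
  memψ t ht := by
    have := h.memψ (-t) ⟨by linarith [ht.2], by linarith [ht.1]⟩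
    exact ⟨by linarith [this.2], by linarith [this.1]⟩

/-- The first integral of the equation. -/
theorem momentum_eq (h : IsPolarShrinker u ψ A B) {s t : ℝ} (hs : s ∈ Set.Icc A B)
    (ht : t ∈ Set.Icc A B) :
    radialPart (u s) * Real.cos (ψ s) = radialPart (u t) * Real.cos (ψ t) := by
  wlog hst : s ≤ t generalizing s t
  · exact (this ht hs (le_of_not_ge hst)).symm
  have h' := h.restrict hs.1 ht.2
  have hc : ContinuousOn (fun t => radialPart (u t) * Real.cos (ψ t)) (Set.Icc s t) := by
    unfold radialPart
    exact (Real.continuous_exp.comp_continuousOn (h'.contU.sub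
      ((Real.continuous_exp.comp_continuousOn (continuousOn_const.mul h'.contU)).div_const 2))).mul
      (Real.continuous_cos.comp_continuousOn h'.contψ)
  have hd : ∀ x ∈ Set.Ioo s t, HasDerivAt (fun t => radialPart (u t) * Real.cos (ψ t)) 0 x := by
    intro x hx
    have hcx := h'.cos_pos (Set.Ioo_subset_Icc_self hx)
    have h1 : HasDerivAt (fun t => radialPart (u t))
        (radialPart (u x) * ((1 - Real.exp (2 * u x)) * Real.tan (ψ x))) x :=
      (HasDerivAt.comp x (h₂ := fun u => u - Real.exp (2 * u) / 2)
        (hasDerivAt_radialExponent (u x)) (h'.derivU x hx)).exp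
    refine (h1.mul (h'.derivψ x hx).cos).congr_deriv ?_
    rw [Real.tan_eq_sin_div_cos]
    field_simp
    ring
  have h1 := sub_le_of_hasDerivAt_ge (C := 0) hst hc hd (fun _ _ => le_rfl)
  have h2 := sub_le_of_hasDerivAt_le (C := 0) hst hc hd (fun _ _ => le_rfl)
  linarith

end IsPolarShrinker

/-- The slope angle reached by a polar shrinker on the unit circle. -/
noncomputable def crestAngle (u ψ : ℝ → ℝ) (t : ℝ) : ℝ :=
  Real.arccos (radialPart (u t) * Real.cos (ψ t) / radialPart 0)

namespace IsPolarShrinker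

variable {u ψ : ℝ → ℝ} {A B : ℝ}

theorem crestAngle_eq (h : IsPolarShrinker u ψ A B) {s t : ℝ} (hs : s ∈ Set.Icc A B)
    (ht : t ∈ Set.Icc A B) : crestAngle u ψ s = crestAngle u ψ t := by
  unfold crestAngle; rw [h.momentum_eq hs ht]

theorem cos_crestAngle (h : IsPolarShrinker u ψ A B) {t : ℝ} (ht : t ∈ Set.Icc A B) :
    Real.cos (crestAngle u ψ t) = radialPart (u t) * Real.cos (ψ t) / radialPart 0 := by
  have h0 := radialPart_pos 0
  have h1 := radialPart_pos (u t)
  have hc := h.cos_pos ht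
  apply Real.cos_arccos
  · have : 0 ≤ radialPart (u t) * Real.cos (ψ t) / radialPart 0 := by positivity
    linarith
  · rw [div_le_one h0]
    have := radialPart_le (u t)
    have := Real.cos_le_one (ψ t)
    nlinarith

theorem crestAngle_mem (h : IsPolarShrinker u ψ A B) {t : ℝ} (ht : t ∈ Set.Icc A B) :
    0 ≤ crestAngle u ψ t ∧ crestAngle u ψ t < Real.pi / 2 := by
  refine ⟨Real.arccos_nonneg _, ?_⟩
  rw [crestAngle, Real.arccos_lt_pi_div_two]
  have h0 := radialPart_pos 0
  have h1 := radialPart_pos (u t)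
  have hc := h.cos_pos ht
  positivity

/-- The first integral in energy form; it turns the square root in the derivative of the phase into
a function of the radius times `cos ψ`. -/
theorem sin_crestAngle_sq_sub (h : IsPolarShrinker u ψ A B) {t : ℝ} (ht : t ∈ Set.Icc A B) :
    Real.sin (crestAngle u ψ t) ^ 2 - Real.sin (ψ t) ^ 2
      = Real.cos (ψ t) ^ 2 * wellDepth (Real.exp (2 * u t)) := by
  have h0 := radialPart_pos 0
  rw [Real.sin_sq, Real.sin_sq, h.cos_crestAngle ht, div_pow, mul_pow, radialPart_sq]
  field_simp
  ring

theorem abs_le_crestAngle (h : IsPolarShrinker u ψ A B) {t : ℝ} (ht : t ∈ Set.Icc A B) :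
    |ψ t| ≤ crestAngle u ψ t := by
  by_contra! hlt
  have hm := h.memψ t ht
  have h1 : Real.cos |ψ t| < Real.cos (crestAngle u ψ t) :=
    Real.cos_lt_cos_of_nonneg_of_le_pi (h.crestAngle_mem ht).1
      ((abs_le.2 ⟨hm.1.le, hm.2.le⟩).trans (by linarith [Real.pi_pos])) hlt
  rw [Real.cos_abs, h.cos_crestAngle ht, lt_div_iff₀ (radialPart_pos 0)] at h1
  have := radialPart_le (u t)
  nlinarith [h.cos_pos ht]

theorem abs_eq_crestAngle (h : IsPolarShrinker u ψ A B) {t : ℝ} (ht : t ∈ Set.Icc A B)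
    (hu : u t = 0) : |ψ t| = crestAngle u ψ t := by
  have hm := h.memψ t ht
  apply Real.injOn_cos ⟨abs_nonneg _, (abs_le.2 ⟨hm.1.le, hm.2.le⟩).trans (by linarith [Real.pi_pos])⟩
    ⟨(h.crestAngle_mem ht).1, (h.crestAngle_mem ht).2.le.trans (by linarith [Real.pi_pos])⟩
  rw [Real.cos_abs, h.cos_crestAngle ht, hu, mul_div_cancel_left₀ _ (radialPart_pos 0).ne']

/-- The function is a phase of the oscillation: `±π/2` on the unit circle, `0` at an extremum of the
radius, with speed depending only on the radius. -/
theorem hasDerivAt_arcsin (h : IsPolarShrinker u ψ A B) {M t : ℝ} (ht : t ∈ Set.Ioo A B)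
    (hM0 : 0 < M) (hM : M = Real.sin (crestAngle u ψ t)) (hu : u t ≠ 0) :
    HasDerivAt (fun t => Real.arcsin (Real.sin (ψ t) / M))
      ((1 - Real.exp (2 * u t)) / √(wellDepth (Real.exp (2 * u t)))) t := by
  have hI := Set.Ioo_subset_Icc_self ht
  have hc := h.cos_pos hI
  have hW : 0 < wellDepth (Real.exp (2 * u t)) := wellDepth_pos (by simpa using hu)
  have key := h.sin_crestAngle_sq_sub hI
  rw [← hM] at key
  have hsq : 1 - (Real.sin (ψ t) / M) ^ 2
      = (Real.cos (ψ t) / M) ^ 2 * wellDepth (Real.exp (2 * u t)) := by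
    field_simp
    linarith
  have hlt : (Real.sin (ψ t) / M) ^ 2 < 1 := by
    have : 0 < (Real.cos (ψ t) / M) ^ 2 * wellDepth (Real.exp (2 * u t)) := by positivity
    linarith
  have habs := (sq_lt_one_iff_abs_lt_one _).1 hlt
  rw [abs_lt] at habs
  have h1 := HasDerivAt.comp t (h₂ := Real.arcsin)
    (Real.hasDerivAt_arcsin habs.1.ne' habs.2.ne) ((h.derivψ t ht).sin.div_const M)
  refine h1.congr_deriv ?_
  rw [hsq, Real.sqrt_mul (by positivity), Real.sqrt_sq (by positivity)]
  have : 0 < √(wellDepth (Real.exp (2 * u t))) := Real.sqrt_pos.2 hW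
  field_simp

theorem continuousOn_arcsin (h : IsPolarShrinker u ψ A B) (M : ℝ) :
    ContinuousOn (fun t => Real.arcsin (Real.sin (ψ t) / M)) (Set.Icc A B) :=
  Real.continuous_arcsin.comp_continuousOn
    ((Real.continuous_sin.comp_continuousOn h.contψ).div_const M)

end IsPolarShrinker

/-! ### Extrema of the radius and durations of monotone arcs -/

theorem exists_first_zero {f : ℝ → ℝ} {a b : ℝ} (hab : a ≤ b) (hf : ContinuousOn f (Set.Icc a b))
    (ha : 0 < f a) (hb : f b ≤ 0) :
    ∃ s ∈ Set.Ioc a b, f s = 0 ∧ ∀ t ∈ Set.Ico a s, 0 < f t := by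
  have hcl : IsClosed (Set.Icc a b ∩ f ⁻¹' Set.Iic 0) :=
    hf.preimage_isClosed_of_isClosed isClosed_Icc isClosed_Iic
  have hcomp : IsCompact (Set.Icc a b ∩ f ⁻¹' Set.Iic 0) :=
    isCompact_Icc.of_isClosed_subset hcl Set.inter_subset_left
  obtain ⟨s, ⟨hs, hs0⟩, hmin⟩ := hcomp.exists_isLeast ⟨b, Set.right_mem_Icc.2 hab, hb⟩
  have hpos : ∀ t ∈ Set.Ico a s, 0 < f t := by
    intro t ht
    by_contra! hle
    exact absurd (hmin ⟨⟨ht.1, ht.2.le.trans hs.2⟩, hle⟩) (not_le.2 ht.2)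
  have has : a < s := by
    rcases hs.1.eq_or_lt with h | h
    · rw [← h] at hs0; exact absurd hs0 (not_le.2 ha)
    · exact h
  refine ⟨s, ⟨has, hs.2⟩, le_antisymm hs0 ?_, hpos⟩
  have hlim : Filter.Tendsto f (𝓝[<] s) (𝓝 (f s)) :=
    ((hf s hs).mono_of_mem_nhdsWithin (Filter.mem_of_superset (Ioo_mem_nhdsLT has)
      (fun t ht => ⟨ht.1.le, ht.2.le.trans hs.2⟩)))
  exact ge_of_tendsto hlim (Filter.mem_of_superset (Ioo_mem_nhdsLT has)
    (fun t ht => (hpos t ⟨ht.1.le, ht.2⟩).le))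

theorem exists_last_zero {f : ℝ → ℝ} {a b : ℝ} (hab : a ≤ b) (hf : ContinuousOn f (Set.Icc a b))
    (ha : f a ≤ 0) (hb : 0 < f b) :
    ∃ s ∈ Set.Ico a b, f s = 0 ∧ ∀ t ∈ Set.Ioc s b, 0 < f t := by
  obtain ⟨s, hs, h0, h⟩ := exists_first_zero (f := fun t => f (-t)) (neg_le_neg hab)
    (hf.comp (by fun_prop) (fun t ht => ⟨by linarith [ht.2], by linarith [ht.1]⟩))
    (by simpa using hb) (by simpa using ha)
  refine ⟨-s, ⟨by linarith [hs.2], by linarith [hs.1]⟩, h0, fun t ht => ?_⟩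
  simpa using h (-t) ⟨by linarith [ht.2], by linarith [ht.1]⟩

theorem exists_Ioc_pos_of_hasDerivAt_pos {f : ℝ → ℝ} {f' x b : ℝ} (hb : x < b)
    (h : HasDerivAt f f' x) (h0 : f x = 0) (hf' : 0 < f') :
    ∃ y ∈ Set.Ioo x b, ∀ t ∈ Set.Ioc x y, 0 < f t := by
  have h1 : ∀ᶠ t in 𝓝[>] x, 0 < slope f x t :=
    ((hasDerivAt_iff_tendsto_slope.1 h).mono_left
      (nhdsWithin_mono _ (fun t ht => (ne_of_gt ht)))).eventually (lt_mem_nhds hf')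
  obtain ⟨y, hy, hsub⟩ := mem_nhdsGT_iff_exists_Ioc_subset.1
    (Filter.inter_mem h1 (Ioo_mem_nhdsGT hb))
  refine ⟨y, ⟨hy, (hsub ⟨hy, le_rfl⟩).2.2⟩, fun t ht => ?_⟩
  have h2 : 0 < slope f x t := (hsub ht).1
  rw [slope_def_field, h0, sub_zero] at h2
  have h3 : 0 < t - x := sub_pos.2 ht.1
  exact (div_pos_iff_of_pos_right h3).1 h2

theorem exists_Ico_neg_of_hasDerivAt_pos {f : ℝ → ℝ} {f' x b : ℝ} (hb : b < x)
    (h : HasDerivAt f f' x) (h0 : f x = 0) (hf' : 0 < f') :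
    ∃ y ∈ Set.Ioo b x, ∀ t ∈ Set.Ico y x, f t < 0 := by
  have h1 : HasDerivAt (fun t => -f (-t)) f' (-x) := by
    have := (HasDerivAt.comp (-x) (h₂ := f) (by simpa using h) (hasDerivAt_neg (-x))).neg
    exact this.congr_deriv (by simp)
  obtain ⟨y, hy, hp⟩ := exists_Ioc_pos_of_hasDerivAt_pos (neg_lt_neg hb) h1 (by simpa using h0) hf'
  refine ⟨-y, ⟨by linarith [hy.2], by linarith [hy.1]⟩, fun t ht => ?_⟩
  have := hp (-t) ⟨by linarith [ht.2], by linarith [ht.1]⟩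
  simpa using this

namespace IsPolarShrinker

variable {u ψ : ℝ → ℝ} {A B : ℝ}

theorem exp_two_mul_lt_one {x : ℝ} (h : x < 0) : Real.exp (2 * x) < 1 := by
  rw [Real.exp_lt_one_iff]; linarith

theorem one_lt_exp_two_mul {x : ℝ} (h : 0 < x) : 1 < Real.exp (2 * x) := by
  rw [Real.one_lt_exp_iff]; linarith

/-- At the critical point the momentum equals `radialPart (u s)`, elsewhere it is at most
`radialPart (u t)`, and `radialPart` decreases outside the unit circle. So a critical point there is
a global maximum. -/
theorem le_of_psi_eq_zero (h : IsPolarShrinker u ψ A B) {s t : ℝ} (hs : s ∈ Set.Icc A B)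
    (ht : t ∈ Set.Icc A B) (h0 : ψ s = 0) (hu : 0 ≤ u s) : u t ≤ u s := by
  by_contra! hlt
  have h1 := h.momentum_eq hs ht
  rw [h0, Real.cos_zero, mul_one] at h1
  have h2 := radialPart_strictAntiOn hu (hu.trans hlt.le) hlt
  have h3 := Real.cos_le_one (ψ t)
  nlinarith [radialPart_pos (u t)]

theorem ge_of_psi_eq_zero (h : IsPolarShrinker u ψ A B) {s t : ℝ} (hs : s ∈ Set.Icc A B)
    (ht : t ∈ Set.Icc A B) (h0 : ψ s = 0) (hu : u s ≤ 0) : u s ≤ u t := by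
  by_contra! hlt
  have h1 := h.momentum_eq hs ht
  rw [h0, Real.cos_zero, mul_one] at h1
  have h2 := radialPart_strictMonoOn (hlt.le.trans hu : u t ≤ 0) hu hlt
  have h3 := Real.cos_le_one (ψ t)
  nlinarith [radialPart_pos (u t)]

/-- The unit circle is the equilibrium. The conserved momentum takes the place of uniqueness for the
differential equation. -/
theorem eq_zero_of_center (h : IsPolarShrinker u ψ A B) {s t : ℝ} (hs : s ∈ Set.Icc A B)
    (ht : t ∈ Set.Icc A B) (h0 : ψ s = 0) (hu : u s = 0) : u t = 0 ∧ ψ t = 0 := by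
  have h1 := le_antisymm (h.le_of_psi_eq_zero hs ht h0 hu.ge) (h.ge_of_psi_eq_zero hs ht h0 hu.le)
  have h2 := h.momentum_eq hs ht
  rw [h1, h0, Real.cos_zero, hu] at h2
  have h3 : Real.cos (ψ t) = 1 := by
    have := radialPart_pos 0
    field_simp at h2
    linarith
  refine ⟨h1.trans hu, ?_⟩
  have hm := h.memψ t ht
  rwa [Real.cos_eq_one_iff_of_lt_of_lt (by linarith [hm.1, Real.pi_pos])
    (by linarith [hm.2, Real.pi_pos])] at h3

/-- Where `ψ < 0` the radius decreases. -/
theorem u_lt_of_neg (h : IsPolarShrinker u ψ A B) {s t : ℝ} (hs : A ≤ s) (ht : t ≤ B)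
    (hst : s < t) (hneg : ∀ x ∈ Set.Ioo s t, ψ x < 0) : u t < u s := by
  have h' := h.restrict hs ht
  refine lt_of_hasDerivAt_neg hst h'.contU h'.derivU (fun x hx => ?_)
  exact Real.tan_neg_of_neg_of_pi_div_two_lt (hneg x hx)
    (h'.memψ x (Set.Ioo_subset_Icc_self hx)).1

theorem psi_eq_neg_crestAngle (h : IsPolarShrinker u ψ A B) {t : ℝ} (ht : t ∈ Set.Icc A B)
    (hu : u t = 0) (hψ : ψ t ≤ 0) : ψ t = -crestAngle u ψ t := by
  rw [← h.abs_eq_crestAngle ht hu, abs_of_nonpos hψ, neg_neg]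

theorem sin_crestAngle_pos (h : IsPolarShrinker u ψ A B) {t : ℝ} (ht : t ∈ Set.Icc A B)
    (hψ : ψ t ≠ 0) : 0 < Real.sin (crestAngle u ψ t) := by
  have h1 := h.abs_le_crestAngle ht
  have h2 := h.crestAngle_mem ht
  have h3 := abs_pos.2 hψ
  exact Real.sin_pos_of_pos_of_lt_pi (by linarith) (by linarith [Real.pi_pos])

theorem arcsin_le_zero (hM : 0 ≤ M) {x : ℝ} (hx0 : x ≤ 0) (hx : -Real.pi ≤ x) :
    Real.arcsin (Real.sin x / M) ≤ 0 := by
  apply Real.arcsin_nonpos.2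
  exact div_nonpos_of_nonpos_of_nonneg (Real.sin_nonpos_of_nonpos_of_neg_pi_le hx0 hx) hM

/-- Duration of the part of a descent outside the unit circle. -/
theorem outer_duration_le (h : IsPolarShrinker u ψ A B) {a b : ℝ} (ha : A ≤ a) (hb : b ≤ B)
    (hab : a < b) (h0 : ψ a = 0) (hneg : ∀ x ∈ Set.Ioc a b, ψ x < 0) (hub : 0 ≤ u b) :
    b - a ≤ 39 * Real.pi / 100 + ψ b / 2 := by
  have h' := h.restrict ha hb
  have hbI : b ∈ Set.Icc a b := Set.right_mem_Icc.2 hab.le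
  have hM0 := h'.sin_crestAngle_pos hbI (hneg b ⟨hab, le_rfl⟩).ne
  set M := Real.sin (crestAngle u ψ b) with hM
  have hpos : ∀ t ∈ Set.Ioo a b, 0 < u t := fun t ht => hub.trans_lt
    (h.u_lt_of_neg (ha.trans ht.1.le) hb ht.2 (fun x hx => hneg x ⟨ht.1.trans hx.1, hx.2.le⟩))
  -- The phase starts at `0` and stays above `-π/2`, whence `(39/50)(π/2) = 39π/100`.
  have key := sub_le_of_hasDerivAt_ge (C := 1)
    (f := fun t => -(39 / 50) * Real.arcsin (Real.sin (ψ t) / M) + ψ t * (1 / 2))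
    (f' := fun t => -(39 / 50) * ((1 - Real.exp (2 * u t)) / √(wellDepth (Real.exp (2 * u t))))
      + (1 - Real.exp (2 * u t)) * (1 / 2)) hab.le
    ((continuousOn_const.mul (h'.continuousOn_arcsin M)).add
      (h'.contψ.mul continuousOn_const)) (fun t ht => ?_) (fun t ht => ?_)
  · rw [h0, Real.sin_zero, zero_div, Real.arcsin_zero] at key
    have := Real.neg_pi_div_two_le_arcsin (Real.sin (ψ b) / M)
    linarith
  · have hI := Set.Ioo_subset_Icc_self ht
    exact ((h'.hasDerivAt_arcsin ht hM0 (by rw [hM, h'.crestAngle_eq hbI hI])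
      (hpos t ht).ne').const_mul _).add ((h'.derivψ t ht).mul_const _)
  · have := one_le_outer_upper (one_lt_exp_two_mul (hpos t ht))
    refine this.trans (le_of_eq ?_)
    ring

/-- Turning of a descent from the largest distance to the origin is less than `2π/3`. -/
theorem descent_turning_lt (h : IsPolarShrinker u ψ A B) {a : ℝ} (ha : A ≤ a) (hab : a < B)
    (h0 : ψ a = 0) (hneg : ∀ x ∈ Set.Ioc a B, ψ x < 0)
    (hB : ψ B ≤ -(Real.pi / 6)) : B - a - ψ B < 2 * Real.pi / 3 := by
  have hpi := Real.pi_pos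
  have hBI : B ∈ Set.Icc A B := ⟨by linarith, le_rfl⟩
  -- A descent ending outside the unit circle is covered by the outer bound alone, as `39/100 + 1/4
  -- < 2/3`.
  rcases le_or_gt 0 (u B) with hu | hu
  · have h1 := h.outer_duration_le ha le_rfl hab h0 hneg hu
    have h2 := (h.memψ B hBI).1
    linarith
  have hua : 0 ≤ u a := by
    by_contra! hlt
    have h1 := h.ge_of_psi_eq_zero ⟨ha, hab.le⟩ hBI h0 hlt.le
    have h2 := h.u_lt_of_neg ha le_rfl hab (fun x hx => hneg x ⟨hx.1, hx.2.le⟩)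
    linarith
  have hua' : u a ≠ 0 := by
    intro h1
    have := (h.eq_zero_of_center ⟨ha, hab.le⟩ hBI h0 h1).1
    linarith
  -- Otherwise the descent is cut where it crosses the unit circle, with slope angle `-m`.
  obtain ⟨t, ht, hut⟩ : ∃ t ∈ Set.Ioo a B, u t = 0 :=
    intermediate_value_Ioo' hab.le (h.restrict ha le_rfl).contU ⟨hu, lt_of_le_of_ne hua hua'.symm⟩
  have htI : t ∈ Set.Icc A B := ⟨ha.trans ht.1.le, ht.2.le⟩
  have h1 := h.outer_duration_le ha ht.2.le ht.1 h0 (fun x hx => hneg x ⟨hx.1, hx.2.trans ht.2.le⟩)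
    hut.ge
  have hψt := h.psi_eq_neg_crestAngle htI hut (hneg t ⟨ht.1, ht.2.le⟩).le
  set m := crestAngle u ψ t with hm
  have h' := h.restrict htI.1 le_rfl
  have htI' : t ∈ Set.Icc t B := Set.left_mem_Icc.2 ht.2.le
  have hBI' : B ∈ Set.Icc t B := Set.right_mem_Icc.2 ht.2.le
  have hM0 := h'.sin_crestAngle_pos htI' (hneg t ⟨ht.1, ht.2.le⟩).ne
  rw [← hm] at hM0
  have hmm := h.crestAngle_mem htI
  have hχm := h.abs_le_crestAngle hBI
  rw [h.crestAngle_eq hBI htI, abs_of_neg (hneg B ⟨hab, le_rfl⟩)] at hχm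
  have hlt0 : ∀ x ∈ Set.Ioo t B, u x < 0 := fun x hx => by
    rw [← hut]
    exact h.u_lt_of_neg htI.1 hx.2.le hx.1
      (fun y hy => hneg y ⟨ht.1.trans hy.1, hy.2.le.trans hx.2.le⟩)
  have key := sub_le_of_hasDerivAt_ge (C := 1)
    (f := fun t => (1 / √2) * Real.arcsin (Real.sin (ψ t) / Real.sin m) + ψ t * (1 / 3))
    (f' := fun t => (1 / √2) * ((1 - Real.exp (2 * u t)) / √(wellDepth (Real.exp (2 * u t))))
      + (1 - Real.exp (2 * u t)) * (1 / 3)) ht.2.le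
    ((continuousOn_const.mul (h'.continuousOn_arcsin _)).add
      (h'.contψ.mul continuousOn_const)) (fun x hx => ?_) (fun x hx => ?_)
  · rw [hψt, Real.sin_neg, neg_div, div_self hM0.ne', Real.arcsin_neg, Real.arcsin_one] at key
    -- The outer part lasts at most `39π/100 - m/2`. In the inner part `ψ / 3` contributes `m/3 -
    -- χ/3`, which with the summand `χ = -ψ B` of the turning leaves exactly the expression of
    -- `half_turn_bound`.
    have h2 := half_turn_bound hmm.2 (M := Real.sin m) rfl (χ := -ψ B) (by linarith) hχm
    rw [Real.sin_neg, neg_div, Real.arcsin_neg] at h2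
    have e : (Real.pi / 2 - -Real.arcsin (Real.sin (ψ B) / Real.sin m)) / √2
      = 1 / √2 * Real.arcsin (Real.sin (ψ B) / Real.sin m) - 1 / √2 * -(Real.pi / 2) := by ring
    rw [e] at h2
    linarith
  · have hI := Set.Ioo_subset_Icc_self hx
    exact ((h'.hasDerivAt_arcsin hx hM0 (by rw [hm, h'.crestAngle_eq htI' hI])
      (hlt0 x hx).ne).const_mul _).add ((h'.derivψ x hx).mul_const _)
  · have := one_le_inner_upper (Real.exp_pos _) (exp_two_mul_lt_one (hlt0 x hx))
    refine this.trans (le_of_eq ?_)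
    ring

/-- Duration of the part of a descent inside the unit circle: lower bound. -/
theorem le_inner_duration (h : IsPolarShrinker u ψ A B) {a b : ℝ} (ha : A ≤ a) (hb : b ≤ B)
    (hab : a < b) (hua : u a = 0) (hneg : ∀ x ∈ Set.Ico a b, ψ x < 0) (h0 : ψ b = 0) :
    Real.pi / 3 + crestAngle u ψ a / 3 ≤ b - a := by
  have h' := h.restrict ha hb
  have haI : a ∈ Set.Icc a b := Set.left_mem_Icc.2 hab.le
  have hψa := h'.psi_eq_neg_crestAngle haI hua (hneg a ⟨le_rfl, hab⟩).le
  have hM0 := h'.sin_crestAngle_pos haI (hneg a ⟨le_rfl, hab⟩).ne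
  set m := crestAngle u ψ a with hm
  have hlt0 : ∀ x ∈ Set.Ioo a b, u x < 0 := fun x hx => by
    rw [← hua]
    exact h'.u_lt_of_neg le_rfl hx.2.le hx.1 (fun y hy => hneg y ⟨hy.1.le, hy.2.trans hx.2⟩)
  -- The phase runs from `-π/2` to `0` and contributes `π/3`; `ψ` runs from `-m` to `0` and
  -- contributes `m/3`.
  have key := sub_le_of_hasDerivAt_le (C := 1)
    (f := fun t => (2 / 3) * Real.arcsin (Real.sin (ψ t) / Real.sin m) + ψ t * (1 / 3))
    (f' := fun t => (2 / 3) * ((1 - Real.exp (2 * u t)) / √(wellDepth (Real.exp (2 * u t))))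
      + (1 - Real.exp (2 * u t)) * (1 / 3)) hab.le
    ((continuousOn_const.mul (h'.continuousOn_arcsin _)).add
      (h'.contψ.mul continuousOn_const)) (fun x hx => ?_) (fun x hx => ?_)
  · rw [h0, hψa, Real.sin_neg, neg_div, div_self hM0.ne', Real.arcsin_neg, Real.arcsin_one,
      Real.sin_zero, zero_div, Real.arcsin_zero] at key
    linarith
  · have hI := Set.Ioo_subset_Icc_self hx
    exact ((h'.hasDerivAt_arcsin hx hM0 (by rw [hm, h'.crestAngle_eq haI hI])
      (hlt0 x hx).ne).const_mul _).add ((h'.derivψ x hx).mul_const _)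
  · have := inner_lower_le_one (Real.exp_pos _) (exp_two_mul_lt_one (hlt0 x hx))
    refine (le_of_eq ?_).trans this
    ring

/-- Duration of the part of a descent inside the unit circle: upper bound. -/
theorem inner_duration_le (h : IsPolarShrinker u ψ A B) {a b : ℝ} (ha : A ≤ a) (hb : b ≤ B)
    (hab : a < b) (hua : u a ≤ 0) (hneg : ∀ x ∈ Set.Ico a b, ψ x < 0) (h0 : ψ b ≤ 0) :
    b - a ≤ Real.pi / 2 := by
  have h' := h.restrict ha hb
  have haI : a ∈ Set.Icc a b := Set.left_mem_Icc.2 hab.le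
  have hM0 := h'.sin_crestAngle_pos haI (hneg a ⟨le_rfl, hab⟩).ne
  set m := crestAngle u ψ a with hm
  have hlt0 : ∀ x ∈ Set.Ioo a b, u x < 0 := fun x hx =>
    (h'.u_lt_of_neg le_rfl hx.2.le hx.1
      (fun y hy => hneg y ⟨hy.1.le, hy.2.trans hx.2⟩)).trans_le hua
  -- The phase stays within `[-π/2, 0]` and has speed at least `1`.
  have key := sub_le_of_hasDerivAt_ge (C := 1)
    (f := fun t => Real.arcsin (Real.sin (ψ t) / Real.sin m))
    (f' := fun t => (1 - Real.exp (2 * u t)) / √(wellDepth (Real.exp (2 * u t)))) hab.le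
    (h'.continuousOn_arcsin _) (fun x hx => ?_) (fun x hx => ?_)
  · have h1 := Real.neg_pi_div_two_le_arcsin (Real.sin (ψ a) / Real.sin m)
    have h2 := arcsin_le_zero hM0.le h0
      (by linarith [(h'.memψ b (Set.right_mem_Icc.2 hab.le)).1, Real.pi_pos])
    linarith
  · have hI := Set.Ioo_subset_Icc_self hx
    exact h'.hasDerivAt_arcsin hx hM0 (by rw [hm, h'.crestAngle_eq haI hI]) (hlt0 x hx).ne
  · exact one_le_inner_sturm (Real.exp_pos _) (exp_two_mul_lt_one (hlt0 x hx))

/-- The slope angle cannot change faster than at the largest distance. -/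
theorem psi_sub_le (h : IsPolarShrinker u ψ A B) {s a b : ℝ} (hs : s ∈ Set.Icc A B)
    (h0 : ψ s = 0) (hu : 0 ≤ u s) (ha : A ≤ a) (hb : b ≤ B) (hab : a ≤ b) :
    ψ a - ψ b ≤ (Real.exp (2 * u s) - 1) * (b - a) := by
  have h' := h.restrict ha hb
  have := sub_le_of_hasDerivAt_ge (C := -(Real.exp (2 * u s) - 1)) hab h'.contψ h'.derivψ
    (fun t ht => ?_)
  · linarith
  · have := h.le_of_psi_eq_zero hs ⟨ha.trans ht.1.le, ht.2.le.trans hb⟩ h0 hu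
    have := Real.exp_le_exp.2 (by linarith : 2 * u t ≤ 2 * u s)
    linarith

/-- A high maximum lets the slope change quickly near it; this bound shows that the passage inside
the unit circle is then correspondingly longer. -/
theorem deficit_lt (h : IsPolarShrinker u ψ A B) {s : ℝ} (hs : s ∈ Set.Icc A B)
    (h0 : ψ s = 0) (hu : 0 < u s) :
    Real.pi / 2 - crestAngle u ψ s < Real.pi / (Real.exp (2 * u s) - 1) := by
  have hm := h.crestAngle_mem hs
  refine inner_deficit_bound (by linarith [one_lt_exp_two_mul hu]) hm.1 hm.2.le ?_
  rw [h.cos_crestAngle hs, h0, Real.cos_zero, mul_one, div_pow, radialPart_sq, wellDepth,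
    mul_div_cancel_left₀ _ (pow_ne_zero 2 (radialPart_pos 0).ne')]
  ring_nf

end IsPolarShrinker

/-! ### Nonexistence of half lenses and lenses -/

namespace IsPolarShrinker

variable {u ψ u₁ ψ₁ u₂ ψ₂ : ℝ → ℝ} {A B : ℝ}

theorem exists_neg_after (h : IsPolarShrinker u ψ A B) {s b : ℝ} (hs : s ∈ Set.Ioo A B)
    (hb : s < b) (h0 : ψ s = 0) (hu : 0 < u s) : ∃ y ∈ Set.Ioo s b, ∀ t ∈ Set.Ioc s y, ψ t < 0 := by
  have h1 := one_lt_exp_two_mul hu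
  obtain ⟨y, hy, hp⟩ := exists_Ioc_pos_of_hasDerivAt_pos hb (h.derivψ s hs).neg
    (by simpa using h0) (by linarith)
  exact ⟨y, hy, fun t ht => by simpa using hp t ht⟩

theorem exists_neg_before (h : IsPolarShrinker u ψ A B) {s b : ℝ} (hs : s ∈ Set.Ioo A B)
    (hb : b < s) (h0 : ψ s = 0) (hu : u s < 0) : ∃ y ∈ Set.Ioo b s, ∀ t ∈ Set.Ico y s, ψ t < 0 := by
  have h1 := exp_two_mul_lt_one hu
  exact exists_Ico_neg_of_hasDerivAt_pos hb (h.derivψ s hs) h0 (by linarith)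

theorem exists_pos_before (h : IsPolarShrinker u ψ A B) {s b : ℝ} (hs : s ∈ Set.Ioo A B)
    (hb : b < s) (h0 : ψ s = 0) (hu : 0 < u s) : ∃ y ∈ Set.Ioo b s, ∀ t ∈ Set.Ico y s, 0 < ψ t := by
  obtain ⟨y, hy, hp⟩ := h.reflect.exists_neg_after (s := -s) (b := -b)
    ⟨by linarith [hs.2], by linarith [hs.1]⟩ (by linarith) (by simpa using h0) (by simpa using hu)
  refine ⟨-y, ⟨by linarith [hy.2], by linarith [hy.1]⟩, fun t ht => ?_⟩
  simpa using hp (-t) ⟨by linarith [ht.2], by linarith [ht.1]⟩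

theorem exists_pos_after (h : IsPolarShrinker u ψ A B) {s b : ℝ} (hs : s ∈ Set.Ioo A B)
    (hb : s < b) (h0 : ψ s = 0) (hu : u s < 0) : ∃ y ∈ Set.Ioo s b, ∀ t ∈ Set.Ioc s y, 0 < ψ t := by
  obtain ⟨y, hy, hp⟩ := h.reflect.exists_neg_before (s := -s) (b := -b)
    ⟨by linarith [hs.2], by linarith [hs.1]⟩ (by linarith) (by simpa using h0) (by simpa using hu)
  refine ⟨-y, ⟨by linarith [hy.2], by linarith [hy.1]⟩, fun t ht => ?_⟩
  simpa using hp (-t) ⟨by linarith [ht.2], by linarith [ht.1]⟩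

/-- A zero reached from positive values cannot have `ψ' > 0`, so `u s ≥ 0`; and `u s = 0` would be
the equilibrium, where `ψ` vanishes identically. -/
theorem u_pos_of_pos_before (h : IsPolarShrinker u ψ A B) {s a : ℝ} (hs : s ∈ Set.Ioo A B)
    (ha : A ≤ a) (has : a < s) (h0 : ψ s = 0) (hpos : ∀ t ∈ Set.Ico a s, 0 < ψ t) : 0 < u s := by
  by_contra! hle
  rcases hle.lt_or_eq with hlt | heq
  · obtain ⟨y, hy, hn⟩ := h.exists_neg_before hs has h0 hlt
    exact absurd (hn y ⟨le_rfl, hy.2⟩) (hpos y ⟨hy.1.le, hy.2⟩).not_gt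
  · have := (h.eq_zero_of_center (Set.Ioo_subset_Icc_self hs) (t := a)
      ⟨ha, has.le.trans hs.2.le⟩ h0 heq).2
    exact (hpos a ⟨le_rfl, has⟩).ne' this

theorem u_neg_of_neg_before (h : IsPolarShrinker u ψ A B) {s a : ℝ} (hs : s ∈ Set.Ioo A B)
    (ha : A ≤ a) (has : a < s) (h0 : ψ s = 0) (hneg : ∀ t ∈ Set.Ico a s, ψ t < 0) : u s < 0 := by
  by_contra! hle
  rcases hle.lt_or_eq with hlt | heq
  · obtain ⟨y, hy, hn⟩ := h.exists_pos_before hs has h0 hlt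
    exact absurd (hn y ⟨le_rfl, hy.2⟩) (hneg y ⟨hy.1.le, hy.2⟩).not_gt
  · have := (h.eq_zero_of_center (Set.Ioo_subset_Icc_self hs) (t := a)
      ⟨ha, has.le.trans hs.2.le⟩ h0 heq.symm).2
    exact (hneg a ⟨le_rfl, has⟩).ne this

/-- A polar graph which first increases and finally decreases either has a single extremum, or
has a first maximum followed by a minimum, and a last maximum preceded by a minimum. -/
theorem zero_structure (h : IsPolarShrinker u ψ A B) (hAB : A < B) (hA : 0 < ψ A) (hB : ψ B < 0) :
    (∃ s ∈ Set.Ioo A B, ψ s = 0 ∧ (∀ t ∈ Set.Ico A s, 0 < ψ t) ∧ ∀ t ∈ Set.Ioc s B, ψ t < 0) ∨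
    ∃ s z z' s', A < s ∧ s < z ∧ z ≤ z' ∧ z' < s' ∧ s' < B ∧
      (ψ s = 0 ∧ 0 < u s ∧ (∀ t ∈ Set.Ioo s z, ψ t < 0) ∧ ψ z = 0 ∧ u z < 0) ∧
      (ψ s' = 0 ∧ 0 < u s' ∧ (∀ t ∈ Set.Ioo z' s', 0 < ψ t) ∧ ψ z' = 0 ∧ u z' < 0) := by
  obtain ⟨s, hs, hs0, hspos⟩ := exists_first_zero hAB.le h.contψ hA hB.le
  obtain ⟨s', hs', hs0', hspos'⟩ := exists_last_zero (f := fun t => -ψ t) hAB.le h.contψ.neg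
    (by linarith) (by linarith)
  simp only [neg_eq_zero, Left.neg_pos_iff] at hs0' hspos'
  have hsB : s < B := lt_of_le_of_ne hs.2 (by rintro rfl; linarith)
  have hsA' : A < s' := lt_of_le_of_ne hs'.1 (by rintro rfl; linarith)
  have hss : s ≤ s' := by
    by_contra! hlt
    exact (hspos' s ⟨hlt, hs.2⟩).ne hs0
  have hsI : s ∈ Set.Ioo A B := ⟨hs.1, hsB⟩
  have hsI' : s' ∈ Set.Ioo A B := ⟨hsA', hs'.2⟩
  have hus := h.u_pos_of_pos_before hsI le_rfl hs.1 hs0 hspos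
  have hus' : 0 < u s' := by
    have := h.reflect.u_pos_of_pos_before (s := -s') (a := -B) ⟨by linarith [hsI'.2],
      by linarith [hsI'.1]⟩ le_rfl (by linarith [hsI'.2]) (by simpa using hs0')
      (fun t ht => by simpa using hspos' (-t) ⟨by linarith [ht.2], by linarith [ht.1]⟩)
    simpa using this
  rcases hss.eq_or_lt with rfl | hlt
  · exact Or.inl ⟨s, hsI, hs0, hspos, hspos'⟩
  right
  obtain ⟨y, hy, hyn⟩ := h.exists_neg_after hsI hlt hs0 hus
  obtain ⟨z, hz, hz0, hzn⟩ := exists_first_zero (f := fun t => -ψ t) hy.2.le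
    (h.contψ.mono (Set.Icc_subset_Icc (by linarith [hs.1, hy.1]) hs'.2.le)).neg
    (by simpa using hyn y ⟨hy.1, le_rfl⟩) (by simp [hs0'])
  simp only [neg_eq_zero, Left.neg_pos_iff] at hz0 hzn
  have hzI : z ∈ Set.Ioo A B := ⟨by linarith [hs.1, hy.1, hz.1], by linarith [hs'.2, hz.2]⟩
  have huz := h.u_neg_of_neg_before hzI (by linarith [hs.1, hy.1]) hz.1 hz0 hzn
  have hzs' : z < s' := lt_of_le_of_ne hz.2 (by rintro rfl; linarith)
  obtain ⟨y', hy', hyp'⟩ := h.exists_pos_before hsI' hzs' hs0' hus'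
  obtain ⟨z', hz', hz0', hzp'⟩ := exists_last_zero (f := ψ) hy'.1.le
    (h.contψ.mono (Set.Icc_subset_Icc hzI.1.le (by linarith [hs'.2, hy'.2])))
    hz0.le (hyp' y' ⟨le_rfl, hy'.2⟩)
  have hzI' : z' ∈ Set.Ioo A B := ⟨by linarith [hzI.1, hz'.1], by linarith [hs'.2, hz'.2, hy'.2]⟩
  have huz' : u z' < 0 := by
    have := h.reflect.u_neg_of_neg_before (s := -z') (a := -y') ⟨by linarith [hzI'.2],
      by linarith [hzI'.1]⟩ (by linarith [hy'.2, hs'.2]) (by linarith [hz'.2])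
      (by simpa using hz0')
      (fun t ht => by simpa using hzp' (-t) ⟨by linarith [ht.2], by linarith [ht.1]⟩)
    simpa using this
  refine ⟨s, z, z', s', hs.1, hy.1.trans hz.1, hz'.1, hz'.2.trans hy'.2, hs'.2,
    ⟨hs0, hus, fun t ht => ?_, hz0, huz⟩, hs0', hus', fun t ht => ?_, hz0', huz'⟩
  · rcases le_total t y with hty | hty
    · exact hyn t ⟨ht.1, hty⟩
    · exact hzn t ⟨hty, ht.2⟩
  · rcases le_total t y' with hty | hty
    · exact hzp' t ⟨ht.1, hty⟩
    · exact hyp' t ⟨hty, ht.2⟩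

/-- The time from the first maximum to the following minimum, together with the time needed for
two changes of the slope angle by `π/6`, exceeds a quarter turn. -/
theorem exists_crossing_long (h : IsPolarShrinker u ψ A B) {s z : ℝ} (hs : A ≤ s) (hsz : s < z)
    (hz : z ≤ B) (h0 : ψ s = 0) (hu : 0 < u s) (hneg : ∀ t ∈ Set.Ioo s z, ψ t < 0)
    (hz0 : ψ z = 0) (huz : u z < 0) {a : ℝ} (ha : a ∈ Set.Icc A B) (hψa : Real.pi / 6 ≤ |ψ a|) :
    ∃ t₁ ∈ Set.Ioo s z, u t₁ = 0 ∧ Real.pi / 6 ≤ (Real.exp (2 * u s) - 1) * (t₁ - s) ∧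
      Real.pi / 2 < 2 * (Real.pi / 6 / (Real.exp (2 * u s) - 1)) + (z - t₁) := by
  have hq : 0 < Real.exp (2 * u s) - 1 := by linarith [one_lt_exp_two_mul hu]
  obtain ⟨t, ht, hut⟩ : ∃ t ∈ Set.Ioo s z, u t = 0 :=
    intermediate_value_Ioo' hsz.le (h.restrict hs hz).contU ⟨huz, hu⟩
  have hsI : s ∈ Set.Icc A B := ⟨hs, hsz.le.trans hz⟩
  have htI : t ∈ Set.Icc A B := ⟨hs.trans ht.1.le, ht.2.le.trans hz⟩
  have hm : Real.pi / 6 ≤ crestAngle u ψ t := by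
    rw [h.crestAngle_eq htI ha]
    exact hψa.trans (h.abs_le_crestAngle ha)
  have h1 := h.le_inner_duration htI.1 hz ht.2 hut
    (fun x hx => hneg x ⟨ht.1.trans_le hx.1, hx.2⟩) hz0
  have h2 := h.psi_sub_le hsI h0 hu.le hs htI.2 ht.1.le
  rw [h0, h.psi_eq_neg_crestAngle htI hut (hneg t ht).le] at h2
  -- With `q = e^{2 u s} - 1` this gives `m > π/2 - π/q`. Hence `π/3 + m/3 > π/2 - π/(3q)`, and the
  -- deficit `π/(3q)` is twice `(π/6)/q`.
  have h3 := h.deficit_lt hsI h0 hu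
  rw [h.crestAngle_eq hsI htI] at h3
  refine ⟨t, ht, hut, by linarith, ?_⟩
  have e : Real.pi / 6 / (Real.exp (2 * u s) - 1) = Real.pi / (Real.exp (2 * u s) - 1) / 6 := by
    ring
  rw [e]
  linarith

/-- The two slope changes by `π/6` allowed for in `exists_crossing_long` occur from `A` up to the
maximum and from the maximum down to the unit circle; `ψ` decreases at rate at most `e^{2 u s} - 1`.
-/
theorem half_pi_lt_of_crest (h : IsPolarShrinker u ψ A B) {s z : ℝ} (hs : A < s) (hsz : s < z)
    (hz : z ≤ B) (h0 : ψ s = 0) (hu : 0 < u s) (hneg : ∀ t ∈ Set.Ioo s z, ψ t < 0)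
    (hz0 : ψ z = 0) (huz : u z < 0) (hA : Real.pi / 6 ≤ ψ A) : Real.pi / 2 < z - A := by
  have hpi := Real.pi_pos
  have hq : 0 < Real.exp (2 * u s) - 1 := by linarith [one_lt_exp_two_mul hu]
  have hAI : A ∈ Set.Icc A B := ⟨le_rfl, by linarith⟩
  obtain ⟨t, ht, -, h1, h2⟩ := h.exists_crossing_long hs.le hsz hz h0 hu hneg hz0 huz
    hAI (hA.trans (le_abs_self _))
  have h3 := h.psi_sub_le ⟨hs.le, by linarith⟩ h0 hu.le le_rfl (by linarith : s ≤ B) hs.le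
  have h4 : Real.pi / 6 / (Real.exp (2 * u s) - 1) ≤ t - s := by
    rw [div_le_iff₀ hq]; linarith
  have h5 : Real.pi / 6 / (Real.exp (2 * u s) - 1) ≤ s - A := by
    rw [div_le_iff₀ hq]; linarith
  linarith

/-- There is no half lens: a polar graph over a half turn which meets the two opposite rays with
angles of `120` degrees. -/
theorem no_half_lens (h : IsPolarShrinker u ψ A B) (hA : ψ A = Real.pi / 6)
    (hB : ψ B = -(Real.pi / 6)) (hAB : B - A = Real.pi) : False := by
  have hpi := Real.pi_pos
  have hlt : A < B := by linarith
  rcases h.zero_structure hlt (by linarith) (by linarith) with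
    ⟨s, hs, h0, hpos, hneg⟩ | ⟨s, z, z', s', hs, hsz, hzz, hzs, hsB, ⟨h0, hu, hn, hz0, hz⟩,
      ⟨h0', hu', hp', hz0', hz'⟩⟩
  · have h1 := h.descent_turning_lt hs.1.le hs.2 h0 hneg hB.le
    have h2 := h.reflect.descent_turning_lt (a := -s) (by linarith [hs.2]) (by linarith [hs.1])
      (by simpa using h0)
      (fun t ht => by simpa using hpos (-t) ⟨by linarith [ht.2], by linarith [ht.1]⟩)
      (by simp [hA])
    simp only [neg_neg] at h2
    linarith
  · have h1 := h.half_pi_lt_of_crest hs hsz (by linarith) h0 hu hn hz0 hz hA.ge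
    have h2 := h.reflect.half_pi_lt_of_crest (s := -s') (z := -z') (by linarith) (by linarith)
      (by linarith) (by simpa using h0') (by simpa using hu')
      (fun t ht => by simpa using hp' (-t) ⟨by linarith [ht.2], by linarith [ht.1]⟩)
      (by simpa using hz0') (by simpa using hz') (by simp [hB])
    linarith

theorem hasDerivWithinAt_Ici (h : IsPolarShrinker u ψ A B) {x : ℝ} (hx : x ∈ Set.Ico A B) :
    HasDerivWithinAt u (Real.tan (ψ x)) (Set.Ici x) x := by
  have hab : x < B := hx.2
  have h' := h.restrict hx.1 le_rfl
  have hnhds : Set.Ioo x B ∈ 𝓝[>] x := Ioo_mem_nhdsGT hab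
  have hxI : x ∈ Set.Icc x B := Set.left_mem_Icc.2 hab.le
  refine hasDerivWithinAt_Ici_of_tendsto_deriv (s := Set.Ioo x B)
    (fun t ht => (h'.derivU t ht).differentiableAt.differentiableWithinAt) ?_ hnhds ?_
  · exact (h'.contU x hxI).mono Set.Ioo_subset_Icc_self
  · have h1 : Filter.Tendsto (fun t => Real.tan (ψ t)) (𝓝[>] x) (𝓝 (Real.tan (ψ x))) := by
      refine (Real.continuousAt_tan.2 (h'.cos_pos hxI).ne').tendsto.comp ?_
      exact (h'.contψ x hxI).mono_of_mem_nhdsWithin (Filter.mem_of_superset hnhds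
        Set.Ioo_subset_Icc_self)
    refine h1.congr' (Filter.mem_of_superset hnhds fun t ht => ?_)
    exact (h'.derivU t ht).deriv.symm

/-- A solution with smaller momentum decreases faster. -/
theorem le_of_momentum_lt (h₁ : IsPolarShrinker u₁ ψ₁ A B) (h₂ : IsPolarShrinker u₂ ψ₂ A B)
    (hA : u₂ A = u₁ A)
    (hneg₂ : ∀ t ∈ Set.Ico A B, ψ₂ t ≤ 0)
    (hc : ∀ t ∈ Set.Ico A B, radialPart (u₂ t) * Real.cos (ψ₂ t) <
      radialPart (u₁ t) * Real.cos (ψ₁ t)) : ∀ t ∈ Set.Icc A B, u₂ t ≤ u₁ t := by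
  intro t ht
  -- At a common point the radial parts agree, so smaller momentum means smaller cosine; as `ψ₂ ≤
  -- 0`, the second graph falls more steeply there.
  refine image_le_of_deriv_right_lt_deriv_boundary' h₂.contU (fun x hx => h₂.hasDerivWithinAt_Ici hx)
    hA.le h₁.contU (fun x hx => h₁.hasDerivWithinAt_Ici hx) (fun x hx heq => ?_) ht
  have hxI := Set.Ico_subset_Icc_self hx
  have h1 := hc x hx
  rw [heq] at h1
  have h2 : Real.cos (ψ₂ x) < Real.cos (ψ₁ x) := lt_of_mul_lt_mul_left h1 (radialPart_pos _).le
  have m1 := h₁.memψ x hxI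
  have m2 := h₂.memψ x hxI
  apply Real.tan_lt_tan_of_lt_of_lt_pi_div_two m2.1 m1.2
  by_contra! hle
  have := Real.cos_le_cos_of_nonneg_of_le_pi (x := -ψ₂ x) (y := -ψ₁ x)
    (by linarith [hneg₂ x hx]) (by linarith [m1.1, Real.pi_pos]) (by linarith)
  rw [Real.cos_neg, Real.cos_neg] at this
  linarith

/-- The outer graph needs long to reach its minimum at `z`. The inner graph lies below, has smaller
momentum and decreases all the way to `z`; it therefore spends more than `π/2` inside the unit
circle, against `inner_duration_le`. -/
theorem no_lens_core {z s : ℝ} (h₁ : IsPolarShrinker u₁ ψ₁ A z) (h₂ : IsPolarShrinker u₂ ψ₂ A z)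
    (hA : u₁ A = u₂ A) (hlt : ∀ t ∈ Set.Ioc A z, u₂ t < u₁ t)
    (hψA : ψ₁ A = ψ₂ A + 2 * Real.pi / 3) (hs : s ∈ Set.Ioo A z) (h0 : ψ₁ s = 0) (hu : 0 < u₁ s)
    (hneg : ∀ t ∈ Set.Ioo s z, ψ₁ t < 0) (hz0 : ψ₁ z = 0) (huz : u₁ z < 0)
    (hz₂ : ψ₂ z ≤ 0)
    (hd : HasDerivAt ψ₂ (1 - Real.exp (2 * u₂ z)) z) : False := by
  have hpi := Real.pi_pos
  have hAz : A < z := hs.1.trans hs.2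
  have hAI : A ∈ Set.Icc A z := ⟨le_rfl, hAz.le⟩
  have hzI : z ∈ Set.Icc A z := ⟨hAz.le, le_rfl⟩
  have hsI : s ∈ Set.Icc A z := ⟨hs.1.le, hs.2.le⟩
  have hmA := h₂.memψ A hAI
  have hmA₁ := h₁.memψ A hAI
  have hA6 : Real.pi / 6 ≤ ψ₁ A := by linarith [hmA.1]
  have huz₂ : u₂ z < 0 := (hlt z ⟨hAz, le_rfl⟩).trans huz
  -- At `z` the outer graph has its minimum, so its momentum is `radialPart (u₁ z)`, which exceeds
  -- that of the inner graph.
  have hc : radialPart (u₂ z) * Real.cos (ψ₂ z) < radialPart (u₁ z) * Real.cos (ψ₁ z) := by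
    rw [hz0, Real.cos_zero, mul_one]
    have h1 := radialPart_strictMonoOn huz₂.le huz.le (hlt z ⟨hAz, le_rfl⟩)
    nlinarith [radialPart_pos (u₂ z), Real.cos_le_one (ψ₂ z)]
  -- If not, the last zero `w` of `ψ₂` before a negative value is a maximum outside the unit circle,
  -- no higher than the maximum of `u₁`. Since `radialPart` decreases there, the inner momentum
  -- would be at least the outer one.
  have hneg₂ : ∀ x ∈ Set.Ico A z, ψ₂ x < 0 := by
    intro x hx
    by_contra! hle
    obtain ⟨y, hy, hyn⟩ : ∃ y ∈ Set.Ioc x z, ψ₂ y < 0 := by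
      rcases hz₂.lt_or_eq with hl | he
      · exact ⟨z, ⟨hx.2, le_rfl⟩, hl⟩
      · obtain ⟨y, hy, hn⟩ := exists_Ico_neg_of_hasDerivAt_pos hx.2 hd he
          (by linarith [exp_two_mul_lt_one huz₂])
        exact ⟨y, ⟨hy.1, hy.2.le⟩, hn y ⟨le_rfl, hy.2⟩⟩
    obtain ⟨w, hw, hw0, hwn⟩ := exists_last_zero (f := fun t => -ψ₂ t) hy.1.le
      (h₂.contψ.mono (Set.Icc_subset_Icc hx.1 hy.2)).neg (by simpa using hle) (by simpa using hyn)
    simp only [neg_eq_zero, Left.neg_pos_iff] at hw0 hwn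
    have hwA : A < w := by
      rcases (hx.1.trans hw.1).eq_or_lt with rfl | h
      · linarith [hmA₁.2]
      · exact h
    have hwI : w ∈ Set.Ioo A z := ⟨hwA, hw.2.trans_le hy.2⟩
    have huw : 0 ≤ u₂ w := by
      by_contra! hl
      obtain ⟨v, hv, hvp⟩ := h₂.exists_pos_after hwI hw.2 hw0 hl
      exact absurd (hvp v ⟨hv.1, le_rfl⟩) (hwn v ⟨hv.1, hv.2.le⟩).not_gt
    have hle2 : u₂ w ≤ u₁ s := (hlt w ⟨hwI.1, hwI.2.le⟩).le.trans
      (h₁.le_of_psi_eq_zero hsI (Set.Ioo_subset_Icc_self hwI) h0 hu.le)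
    have h3 := radialPart_strictAntiOn.antitoneOn huw (huw.trans hle2) hle2
    have h4 := h₁.momentum_eq hsI hzI
    have h5 := h₂.momentum_eq (Set.Ioo_subset_Icc_self hwI) hzI
    rw [h0, Real.cos_zero, mul_one] at h4
    rw [hw0, Real.cos_zero, mul_one] at h5
    linarith
  -- If the lens starts inside the unit circle, the inner graph stays inside over all of `[A, z]`.
  rcases lt_or_ge (u₁ A) 0 with huA | huA
  · have h1 := h₁.half_pi_lt_of_crest hs.1 hs.2 le_rfl h0 hu hneg hz0 huz hA6
    have h2 := h₂.inner_duration_le le_rfl le_rfl hAz (by linarith) hneg₂ hz₂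
    linarith
  have hq : 0 < Real.exp (2 * u₁ s) - 1 := by linarith [one_lt_exp_two_mul hu]
  obtain ⟨t₁, ht₁, hut₁, h1, h2⟩ := h₁.exists_crossing_long hs.1.le hs.2 le_rfl h0 hu hneg hz0 huz
    hAI (hA6.trans (le_abs_self _))
  obtain ⟨τ, hτ, huτ⟩ : ∃ τ ∈ Set.Icc s t₁, u₁ τ = u₁ A :=
    intermediate_value_Icc' ht₁.1.le (h₁.restrict hs.1.le ht₁.2.le).contU
      ⟨by linarith, h₁.le_of_psi_eq_zero hsI hAI h0 hu.le⟩
  have hτI : τ ∈ Set.Icc A z := ⟨hs.1.le.trans hτ.1, hτ.2.trans ht₁.2.le⟩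
  have hnegI : ∀ t ∈ Set.Icc s t₁, ψ₁ t ≤ 0 := by
    intro t ht
    rcases ht.1.eq_or_lt with rfl | h
    · exact h0.le
    · exact (hneg t ⟨h, ht.2.trans_lt ht₁.2⟩).le
  have hψτ : ψ₁ τ = -ψ₁ A := by
    have h3 := h₁.momentum_eq hτI hAI
    rw [huτ] at h3
    have h4 := mul_left_cancel₀ (radialPart_pos (u₁ A)).ne' h3
    have h5 := hnegI τ hτ
    have h6 := h₁.memψ τ hτI
    rw [← Real.cos_neg (ψ₁ τ)] at h4
    have := Real.injOn_cos ⟨by linarith, by linarith [h6.1]⟩ ⟨by linarith, by linarith [hmA₁.2]⟩ h4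
    linarith
  -- The descent from `τ`, moved back to start at `A`, begins at the same point as the inner graph.
  -- By comparison the inner graph is inside the unit circle from `b` on.
  have hr := (h₁.restrict hτI.1 ht₁.2.le).translate (τ - A)
  have e1 : τ - (τ - A) = A := by ring
  rw [e1] at hr
  set b := t₁ - (τ - A) with hb
  have hAb : A ≤ b := by linarith [hτ.2]
  have hbz : b < z := by linarith [ht₁.2, hτI.1]
  have h3 := hr.le_of_momentum_lt (h₂.restrict le_rfl hbz.le)
    (by rw [add_sub_cancel, huτ, hA])
    (fun t ht => (hneg₂ t ⟨ht.1, ht.2.trans hbz⟩).le)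
    (fun t ht => by
      have e2 := h₁.momentum_eq (s := t + (τ - A)) (t := z)
        ⟨by linarith [ht.1, hτI.1], by linarith [ht.2, ht₁.2]⟩ hzI
      have e3 := h₂.momentum_eq (s := t) (t := z) ⟨ht.1, ht.2.le.trans hbz.le⟩ hzI
      rw [e2, e3]
      exact hc) b ⟨hAb, le_rfl⟩
  rw [hb, sub_add_cancel, hut₁, ← hb] at h3
  have h4 := h₂.inner_duration_le hAb le_rfl hbz h3 (fun x hx => hneg₂ x ⟨hAb.trans hx.1, hx.2⟩) hz₂
  have h5 := h₁.psi_sub_le hsI h0 hu.le le_rfl hsI.2 hs.1.le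
  have h6 := h₁.psi_sub_le hsI h0 hu.le hsI.1 hτI.2 hτ.1
  rw [h0] at h5 h6
  rw [hψτ] at h6
  -- The time `τ - A` contains two slope changes by at least `π/6`, hence `z - b = (z - t₁) + (τ -
  -- A) > π/2`.
  have h7 : Real.pi / 6 / (Real.exp (2 * u₁ s) - 1) ≤ s - A := by
    rw [div_le_iff₀ hq]; linarith
  have h8 : Real.pi / 6 / (Real.exp (2 * u₁ s) - 1) ≤ τ - s := by
    rw [div_le_iff₀ hq]; linarith
  linarith

/-- There is no lens: two polar graphs over the same interval, with common end points at which
they form angles of `120` degrees. -/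
theorem no_lens (h₁ : IsPolarShrinker u₁ ψ₁ A B) (h₂ : IsPolarShrinker u₂ ψ₂ A B) (hAB : A < B)
    (hA : u₁ A = u₂ A) (hB : u₁ B = u₂ B) (hlt : ∀ t ∈ Set.Ioo A B, u₂ t < u₁ t)
    (hψA : ψ₁ A = ψ₂ A + 2 * Real.pi / 3) (hψB : ψ₁ B = ψ₂ B - 2 * Real.pi / 3) : False := by
  have hpi := Real.pi_pos
  have mA := h₂.memψ A ⟨le_rfl, hAB.le⟩
  have mB := h₂.memψ B ⟨hAB.le, le_rfl⟩
  rcases h₁.zero_structure hAB (by linarith [mA.1]) (by linarith [mB.2]) with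
    ⟨s, hs, h0, hpos, hneg⟩ | ⟨s, z, z', s', hs, hsz, hzz, hzs, hsB, ⟨h0, hu, hn, hz0, hz⟩,
      ⟨h0', hu', hp', hz0', hz'⟩⟩
  · have h1 := h₁.descent_turning_lt hs.1.le hs.2 h0 hneg (by linarith [mB.2])
    have h2 := h₁.reflect.descent_turning_lt (a := -s) (by linarith [hs.2]) (by linarith [hs.1])
      (by simpa using h0)
      (fun t ht => by simpa using hpos (-t) ⟨by linarith [ht.2], by linarith [ht.1]⟩)
      (by simp only [neg_neg]; linarith [mA.1])
    simp only [neg_neg] at h2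
    have h3 := sub_le_of_hasDerivAt_le (C := 1) hAB.le h₂.contψ h₂.derivψ
      (fun t _ => by linarith [Real.exp_pos (2 * u₂ t)])
    linarith
  · rcases le_or_gt (ψ₂ z) 0 with hle | hgt
    · exact no_lens_core (h₁.restrict le_rfl (by linarith)) (h₂.restrict le_rfl (by linarith)) hA
        (fun t ht => hlt t ⟨ht.1, by linarith [ht.2]⟩) hψA ⟨hs, hsz⟩ h0 hu hn hz0 hz hle
        (h₂.derivψ z ⟨by linarith, by linarith⟩)
    -- `ψ₁ - ψ₂` is nonincreasing because `u₂ < u₁`. Thus `ψ₂ z > 0` forces `ψ₂ z' > 0`, and the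
    -- reflected lens satisfies the hypotheses of `no_lens_core` at `-z'`.
    · have hδ : ψ₁ z' - ψ₂ z' ≤ ψ₁ z - ψ₂ z := by
        have := sub_le_of_hasDerivAt_le (C := 0) hzz
          ((h₁.restrict (by linarith) (by linarith)).contψ.sub
            (h₂.restrict (by linarith) (by linarith)).contψ)
          (fun t ht => (h₁.derivψ t ⟨by linarith [ht.1], by linarith [ht.2]⟩).sub
            (h₂.derivψ t ⟨by linarith [ht.1], by linarith [ht.2]⟩))
          (fun t ht => by
            have := hlt t ⟨by linarith [ht.1], by linarith [ht.2]⟩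
            have := Real.exp_le_exp.2 (by linarith : 2 * u₂ t ≤ 2 * u₁ t)
            linarith)
        simp only [Pi.sub_apply, zero_mul] at this
        linarith
      have hr₁ := (h₁.restrict (a := z') (b := B) (by linarith) le_rfl).reflect
      have hr₂ := (h₂.restrict (a := z') (b := B) (by linarith) le_rfl).reflect
      refine no_lens_core (s := -s') hr₁ hr₂ (by simpa using hB)
        (fun t ht => hlt (-t) ⟨by linarith [ht.2], by linarith [ht.1]⟩)
        (by simp only [neg_neg]; linarith) ⟨by linarith, by linarith⟩ (by simpa using h0')
        (by simpa using hu')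
        (fun t ht => by simpa using hp' (-t) ⟨by linarith [ht.2], by linarith [ht.1]⟩)
        (by simpa using hz0') (by simpa using hz') (by simp only [neg_neg]; linarith) ?_
      exact h₂.reflect.derivψ (-z') ⟨by linarith, by linarith⟩

/-! ### Oscillation in every half turn, and self-intersection of long graphs -/

/-- `w = sin ψ` satisfies `w'' = -(1 + e^{4u}) w`. This is Sturm comparison with `sin (t - A)`; the
function differentiated is their Wronskian. -/
theorem exists_zero_of_pi_of_pos (h : IsPolarShrinker u ψ A B) (hAB : B - A = Real.pi)
    (hpos : ∀ t ∈ Set.Icc A B, 0 < ψ t) : False := by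
  have hpi := Real.pi_pos
  have hlt : A < B := by linarith
  have key := sub_le_of_hasDerivAt_le (C := 0)
    (f := fun t => Real.cos (ψ t) * (1 - Real.exp (2 * u t)) * Real.sin (t - A)
      - Real.sin (ψ t) * Real.cos (t - A)) hlt.le ?_
    (fun t ht => ((((h.derivψ t ht).cos).mul
      ((((h.derivU t ht).const_mul 2).exp).const_sub 1)).mul
        (((hasDerivAt_id t).sub_const A).sin)).sub
        (((h.derivψ t ht).sin).mul (((hasDerivAt_id t).sub_const A).cos))) (fun t ht => ?_)
  · simp only [hAB, sub_self, Real.sin_pi, Real.cos_pi, Real.sin_zero, Real.cos_zero] at key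
    have hsin : ∀ t ∈ Set.Icc A B, 0 < Real.sin (ψ t) := fun t ht =>
      Real.sin_pos_of_pos_of_lt_pi (hpos t ht) (by linarith [(h.memψ t ht).2])
    have h1 := hsin A ⟨le_rfl, hlt.le⟩
    have h2 := hsin B ⟨hlt.le, le_rfl⟩
    linarith
  · have := h.contU
    have := h.contψ
    fun_prop
  · have hI := Set.Ioo_subset_Icc_self ht
    have hs : 0 < Real.sin (ψ t) :=
      Real.sin_pos_of_pos_of_lt_pi (hpos t hI) (by linarith [(h.memψ t hI).2])
    have hs' : 0 < Real.sin (t - A) :=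
      Real.sin_pos_of_pos_of_lt_pi (by linarith [ht.1]) (by linarith [ht.2])
    have hc := (h.cos_pos hI).ne'
    simp only [id, mul_one, Pi.mul_apply]
    rw [Real.tan_eq_sin_div_cos]
    have e : (-Real.sin (ψ t) * (1 - Real.exp (2 * u t)) * (1 - Real.exp (2 * u t)) +
        Real.cos (ψ t) * -(Real.exp (2 * u t) * (2 * (Real.sin (ψ t) / Real.cos (ψ t))))) *
        Real.sin (t - A) + Real.cos (ψ t) * (1 - Real.exp (2 * u t)) * Real.cos (t - A) -
        (Real.cos (ψ t) * (1 - Real.exp (2 * u t)) * Real.cos (t - A) +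
        Real.sin (ψ t) * -Real.sin (t - A))
        = -(Real.exp (2 * u t) ^ 2 * (Real.sin (ψ t) * Real.sin (t - A))) := by
      field_simp
      ring
    have h3 := mul_pos hs hs'
    have h4 : 0 < Real.exp (2 * u t) ^ 2 * (Real.sin (ψ t) * Real.sin (t - A)) := by positivity
    linarith [e]

/-- The slope angle vanishes somewhere in every half turn. -/
theorem exists_zero_of_pi (h : IsPolarShrinker u ψ A B) (hAB : B - A = Real.pi) :
    ∃ t ∈ Set.Icc A B, ψ t = 0 := by
  by_contra! hne
  have hlt : A ≤ B := by linarith [Real.pi_pos]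
  have hconst : ∀ t ∈ Set.Icc A B, 0 < ψ A * ψ t := by
    intro t ht
    by_contra! hle
    have hcont := h.contψ.mono (Set.Icc_subset_Icc le_rfl ht.2)
    have h0 : (0 : ℝ) ∈ Set.uIcc (ψ A) (ψ t) := by
      rw [Set.mem_uIcc]
      rcases mul_nonpos_iff.1 hle with ⟨h1, h2⟩ | ⟨h1, h2⟩
      · exact Or.inr ⟨h2, h1⟩
      · exact Or.inl ⟨h1, h2⟩
    rw [← Set.uIcc_of_le ht.1] at hcont
    obtain ⟨x, hx, hx0⟩ := intermediate_value_uIcc hcont h0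
    rw [Set.uIcc_of_le ht.1] at hx
    exact hne x ⟨hx.1, hx.2.trans ht.2⟩ hx0
  rcases lt_or_gt_of_ne (hne A ⟨le_rfl, hlt⟩) with hA | hA
  · refine h.reflect.exists_zero_of_pi_of_pos (by linarith) (fun t ht => ?_)
    have := hconst (-t) ⟨by linarith [ht.2], by linarith [ht.1]⟩
    simp only [Left.neg_pos_iff]
    by_contra! hle
    exact absurd this (mul_nonpos_of_nonpos_of_nonneg hA.le hle).not_gt
  · exact h.exists_zero_of_pi_of_pos hAB (fun t ht => (mul_pos_iff_of_pos_left hA).1 (hconst t ht))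

/-- A polar graph over five half turns meets itself. -/
theorem exists_self_meeting (h : IsPolarShrinker u ψ A B) (hAB : A + 5 * Real.pi ≤ B) :
    ∃ t ∈ Set.Icc A (A + 3 * Real.pi), u (t + 2 * Real.pi) = u t := by
  have hpi := Real.pi_pos
  -- An extremum in the third half turn leaves room for a full turn on either side.
  obtain ⟨s, hs, h0⟩ := (h.restrict (a := A + 2 * Real.pi) (b := A + 3 * Real.pi) (by linarith)
    (by linarith)).exists_zero_of_pi (by ring)
  have hsI : s ∈ Set.Icc A B := ⟨by linarith [hs.1], by linarith [hs.2]⟩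
  have h1I : s + 2 * Real.pi ∈ Set.Icc A B := ⟨by linarith [hs.1], by linarith [hs.2]⟩
  have h2I : s - 2 * Real.pi ∈ Set.Icc A B := ⟨by linarith [hs.1], by linarith [hs.2]⟩
  have hcont : ContinuousOn (fun t => u (t + 2 * Real.pi) - u t)
      (Set.uIcc (s - 2 * Real.pi) s) := by
    rw [Set.uIcc_of_le (by linarith)]
    refine ContinuousOn.sub (h.contU.comp (by fun_prop) ?_) (h.contU.mono ?_)
    · exact fun t ht => ⟨by linarith [ht.1, hs.1], by linarith [ht.2, hs.2]⟩
    · exact fun t ht => ⟨by linarith [ht.1, hs.1], by linarith [ht.2, hs.2]⟩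
  -- Since `s` is a global extremum, `u (t + 2π) - u t` has opposite weak signs at `s - 2π` and at
  -- `s`.
  have hmem : (0 : ℝ) ∈ Set.uIcc (u (s - 2 * Real.pi + 2 * Real.pi) - u (s - 2 * Real.pi))
      (u (s + 2 * Real.pi) - u s) := by
    rw [sub_add_cancel, Set.mem_uIcc]
    rcases le_total 0 (u s) with hu | hu
    · have a := h.le_of_psi_eq_zero hsI h1I h0 hu
      have b := h.le_of_psi_eq_zero hsI h2I h0 hu
      right; constructor <;> linarith
    · have a := h.ge_of_psi_eq_zero hsI h1I h0 hu
      have b := h.ge_of_psi_eq_zero hsI h2I h0 hu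
      left; constructor <;> linarith
  obtain ⟨t, ht, ht0⟩ := intermediate_value_uIcc hcont hmem
  rw [Set.uIcc_of_le (by linarith)] at ht
  exact ⟨t, ⟨by linarith [ht.1, hs.1], by linarith [ht.2, hs.2]⟩, sub_eq_zero.1 ht0⟩

end IsPolarShrinker

/-! ### Shrinker arcs parametrized by arclength and their polar form -/

/-- An arc of a shrinker, parametrized by arclength: the curvature vector is
`Im (conj γ * T) • (I * T)`. -/
structure IsShrinkerArc (γ T : ℝ → ℂ) (a b : ℝ) : Prop where
  lt : a < b
  derivγ : ∀ s ∈ Set.Icc a b, HasDerivWithinAt γ (T s) (Set.Icc a b) s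
  derivT : ∀ s ∈ Set.Icc a b,
    HasDerivWithinAt T ((star (γ s) * T s).im * (Complex.I * T s)) (Set.Icc a b) s
  unit : ∀ s ∈ Set.Icc a b, ‖T s‖ = 1

namespace IsShrinkerArc

variable {γ T : ℝ → ℂ} {a b : ℝ}

theorem star_mul_self (h : IsShrinkerArc γ T a b) {s : ℝ} (hs : s ∈ Set.Icc a b) :
    star (T s) * T s = 1 := by
  have h1 := Complex.conj_mul' (T s)
  rw [h.unit s hs] at h1
  simpa using h1

theorem normSq_eq (h : IsShrinkerArc γ T a b) {s : ℝ} (hs : s ∈ Set.Icc a b) :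
    (star (γ s) * T s).re ^ 2 + (star (γ s) * T s).im ^ 2 = ‖γ s‖ ^ 2 := by
  have h1 : ‖star (γ s) * T s‖ = ‖γ s‖ := by rw [norm_mul, h.unit s hs, norm_star, mul_one]
  rw [← h1, Complex.sq_norm, Complex.normSq_apply]
  ring

/-- With `star γ * T = p + iκ` the equation becomes the closed system `p' = 1 - κ²`, `κ' = κ p`,
from which everything below is derived. -/
theorem hasDerivWithinAt_moment (h : IsShrinkerArc γ T a b) {s : ℝ} (hs : s ∈ Set.Icc a b) :
    HasDerivWithinAt (fun s => star (γ s) * T s)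
      (1 + (star (γ s) * T s).im * (Complex.I * (star (γ s) * T s))) (Set.Icc a b) s := by
  refine ((h.derivγ s hs).star.mul (h.derivT s hs)).congr_deriv ?_
  rw [h.star_mul_self hs]
  ring

theorem hasDerivWithinAt_re (h : IsShrinkerArc γ T a b) {s : ℝ} (hs : s ∈ Set.Icc a b) :
    HasDerivWithinAt (fun s => (star (γ s) * T s).re)
      (1 - (star (γ s) * T s).im ^ 2) (Set.Icc a b) s := by
  have := Complex.reCLM.hasFDerivAt.comp_hasDerivWithinAt s (h.hasDerivWithinAt_moment hs)
  refine this.congr_deriv ?_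
  simp only [Complex.reCLM_apply, Complex.add_re, Complex.one_re, Complex.re_ofReal_mul,
    Complex.I_mul_re]
  ring

theorem hasDerivWithinAt_im (h : IsShrinkerArc γ T a b) {s : ℝ} (hs : s ∈ Set.Icc a b) :
    HasDerivWithinAt (fun s => (star (γ s) * T s).im)
      ((star (γ s) * T s).im * (star (γ s) * T s).re) (Set.Icc a b) s := by
  have := Complex.imCLM.hasFDerivAt.comp_hasDerivWithinAt s (h.hasDerivWithinAt_moment hs)
  refine this.congr_deriv ?_
  simp only [Complex.imCLM_apply, Complex.add_im, Complex.one_im, Complex.im_ofReal_mul,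
    Complex.I_mul_im, zero_add]

theorem hasDerivWithinAt_norm_sq (h : IsShrinkerArc γ T a b) {s : ℝ} (hs : s ∈ Set.Icc a b) :
    HasDerivWithinAt (fun s => ‖γ s‖ ^ 2) (2 * (star (γ s) * T s).re) (Set.Icc a b) s := by
  have h1 := Complex.reCLM.hasFDerivAt.comp_hasDerivWithinAt s
    ((h.derivγ s hs).star.mul (h.derivγ s hs))
  refine (h1.congr_deriv ?_).congr_of_mem (fun x _ => ?_) hs
  · simp only [Complex.reCLM_apply, Complex.add_re, Complex.mul_re, Complex.star_def,
      Complex.conj_re, Complex.conj_im]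
    ring
  · simp only [Function.comp, Complex.reCLM_apply, Pi.mul_apply]
    rw [Complex.star_def, Complex.conj_mul', ← Complex.ofReal_pow, Complex.ofReal_re]

/-- The first integral of the shrinker equation. -/
theorem im_eq (h : IsShrinkerArc γ T a b) {s : ℝ} (hs : s ∈ Set.Icc a b) :
    (star (γ s) * T s).im =
      (star (γ a) * T a).im * Real.exp (-‖γ a‖ ^ 2 / 2) * Real.exp (‖γ s‖ ^ 2 / 2) := by
  have hd : ∀ x ∈ Set.Icc a b, HasDerivWithinAt
      (fun s => (star (γ s) * T s).im * Real.exp (-‖γ s‖ ^ 2 / 2)) 0 (Set.Icc a b) x := by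
    intro x hx
    have h1 : HasDerivWithinAt (fun s => Real.exp (-‖γ s‖ ^ 2 / 2)) _ (Set.Icc a b) x :=
      ((h.hasDerivWithinAt_norm_sq hx).neg.div_const 2).exp
    refine ((h.hasDerivWithinAt_im hx).mul h1).congr_deriv ?_
    simp only [Pi.neg_apply]
    ring
  have h2 := constant_of_derivWithin_zero (fun x hx => (hd x hx).differentiableWithinAt)
    (fun x hx => (hd x (Set.Ico_subset_Icc_self hx)).derivWithin
      (uniqueDiffOn_Icc h.lt x (Set.Ico_subset_Icc_self hx))) s hs
  rw [← h2, mul_assoc, ← Real.exp_add]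
  ring_nf
  simp

/-- A shrinker arc of zero momentum is a segment of a line through the origin. -/
theorem radial_of_im_eq_zero (h : IsShrinkerArc γ T a b) (h0 : (star (γ a) * T a).im = 0) {s : ℝ}
    (hs : s ∈ Set.Icc a b) :
    T s = T a ∧ γ s = ((s - a + (star (γ a) * T a).re : ℝ) : ℂ) * T a := by
  have hu := uniqueDiffOn_Icc h.lt
  have him : ∀ x ∈ Set.Icc a b, (star (γ x) * T x).im = 0 := fun x hx => by
    rw [h.im_eq hx, h0]; ring
  have hT : ∀ x ∈ Set.Icc a b, T x = T a :=
    constant_of_derivWithin_zero (fun x hx => (h.derivT x hx).differentiableWithinAt)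
      (fun x hx => by
        rw [(h.derivT x (Set.Ico_subset_Icc_self hx)).derivWithin
          (hu x (Set.Ico_subset_Icc_self hx)), him x (Set.Ico_subset_Icc_self hx)]
        simp)
  refine ⟨hT s hs, ?_⟩
  have haI : a ∈ Set.Icc a b := ⟨le_rfl, h.lt.le⟩
  have hd : ∀ x ∈ Set.Icc a b, HasDerivWithinAt (fun s => γ s - ((s - a : ℝ) : ℂ) * T a) 0
      (Set.Icc a b) x := by
    intro x hx
    have h1 : HasDerivAt (fun s : ℝ => ((s - a : ℝ) : ℂ)) 1 x :=
      ((hasDerivAt_id x).sub_const a).ofReal_comp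
    refine ((h.derivγ x hx).sub (h1.hasDerivWithinAt.mul_const (T a))).congr_deriv ?_
    rw [hT x hx]; ring
  have h2 := constant_of_derivWithin_zero (fun x hx => (hd x hx).differentiableWithinAt)
    (fun x hx => (hd x (Set.Ico_subset_Icc_self hx)).derivWithin
      (hu x (Set.Ico_subset_Icc_self hx))) s hs
  have h3 : ((star (γ a) * T a).re : ℂ) = star (γ a) * T a :=
    Complex.ext (by simp) (by rw [h0]; simp)
  have h4 : γ a = ((star (γ a) * T a).re : ℂ) * T a := by
    have h5 : ((star (γ a) * T a).re : ℂ) = star (star (γ a) * T a) := by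
      rw [← h3, Complex.star_def, Complex.conj_ofReal, Complex.ofReal_re]
    rw [h5, star_mul, star_star, mul_comm (star (T a)), mul_assoc, h.star_mul_self haI, mul_one]
  simp only [sub_self, Complex.ofReal_zero, zero_mul, sub_zero] at h2
  rw [Complex.ofReal_add, add_mul, ← h4, ← h2]
  ring

theorem reverse (h : IsShrinkerArc γ T a b) :
    IsShrinkerArc (fun s => γ (-s)) (fun s => -T (-s)) (-b) (-a) := by
  have hm : Set.MapsTo (fun s : ℝ => -s) (Set.Icc (-b) (-a)) (Set.Icc a b) := fun s hs =>
    ⟨by linarith [hs.2], by linarith [hs.1]⟩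
  refine ⟨neg_lt_neg h.lt, fun s hs => ?_, fun s hs => ?_, fun s hs => ?_⟩
  · have := (h.derivγ (-s) (hm hs)).scomp s (hasDerivAt_neg s).hasDerivWithinAt hm
    exact this.congr_deriv (by simp)
  · have := ((h.derivT (-s) (hm hs)).scomp s (hasDerivAt_neg s).hasDerivWithinAt hm).neg
    refine this.congr_deriv ?_
    simp
    ring
  · rw [norm_neg, h.unit _ (hm hs)]

/-- The description of a shrinker arc of positive momentum as a polar graph. -/
theorem exists_polar (h : IsShrinkerArc γ T a b) (hpos : 0 < (star (γ a) * T a).im) :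
    ∃ u ψ φ : ℝ → ℝ, IsPolarShrinker u ψ (φ a) (φ b) ∧ StrictMono φ ∧
      φ '' Set.Icc a b = Set.Icc (φ a) (φ b) ∧
      (∀ s ∈ Set.Icc a b, γ s = Complex.exp (u (φ s) + φ s * Complex.I) ∧
        T s = Complex.I * Complex.exp (-(ψ (φ s)) * Complex.I) *
          Complex.exp (φ s * Complex.I)) ∧
      (star (γ a) * T a).im * Real.exp (-‖γ a‖ ^ 2 / 2) * (b - a) ≤ φ b - φ a := by
  set c := (star (γ a) * T a).im * Real.exp (-‖γ a‖ ^ 2 / 2) with hc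
  have hc0 : 0 < c := mul_pos hpos (Real.exp_pos _)
  have hab := h.lt.le
  set κ : ℝ → ℝ := fun s => (star (γ s) * T s).im with hκ
  set p : ℝ → ℝ := fun s => (star (γ s) * T s).re with hp
  have hκe : ∀ s ∈ Set.Icc a b, κ s = c * Real.exp (‖γ s‖ ^ 2 / 2) := fun s hs => h.im_eq hs
  have hκ0 : ∀ s ∈ Set.Icc a b, 0 < κ s := fun s hs => by
    rw [hκe s hs]; exact mul_pos hc0 (Real.exp_pos _)
  have hr : ∀ s ∈ Set.Icc a b, p s ^ 2 + κ s ^ 2 = ‖γ s‖ ^ 2 := fun s hs => h.normSq_eq hs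
  have hγ0 : ∀ s ∈ Set.Icc a b, γ s ≠ 0 := by
    intro s hs h0
    have := hκ0 s hs
    simp [hκ, h0] at this
  have hγn : ∀ s ∈ Set.Icc a b, 0 < ‖γ s‖ := fun s hs => norm_pos_iff.2 (hγ0 s hs)
  have hquot : ∀ s ∈ Set.Icc a b, T s / γ s = (p s / ‖γ s‖ ^ 2 : ℝ) + (κ s / ‖γ s‖ ^ 2 : ℝ) * Complex.I := by
    intro s hs
    have h1 : star (γ s) * T s = p s + κ s * Complex.I := (Complex.re_add_im _).symm
    have h2 : star (γ s) * γ s = (‖γ s‖ : ℂ) ^ 2 := Complex.conj_mul' _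
    have h3 : star (γ s) ≠ 0 := star_ne_zero.2 (hγ0 s hs)
    have h4 : (‖γ s‖ : ℂ) ≠ 0 := by exact_mod_cast (hγn s hs).ne'
    rw [← mul_div_mul_left _ _ h3, h1, h2]
    push_cast
    ring
  have hcontγ : ContinuousOn γ (Set.Icc a b) := fun s hs => (h.derivγ s hs).continuousWithinAt
  have hcontT : ContinuousOn T (Set.Icc a b) := fun s hs => (h.derivT s hs).continuousWithinAt
  set g : ℝ → ℂ := fun s => T s / γ s with hg
  have hcontg : ContinuousOn g (Set.Icc a b) := hcontT.div hcontγ hγ0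
  -- The logarithmic derivative `T / γ` is continued by constants, so that its primitive and the
  -- inverse of the angle are defined on the whole line.
  set G : ℝ → ℂ := Set.IccExtend hab ((Set.Icc a b).domRestrict g) with hG
  have hGcont : Continuous G := (continuousOn_iff_continuous_domRestrict.1 hcontg).Icc_extend'
  have hGeq : ∀ s ∈ Set.Icc a b, G s = g s := fun s hs => by
    rw [hG, Set.IccExtend_of_mem _ _ hs]; rfl
  have hGim : ∀ s, c ≤ (G s).im := by
    intro s
    obtain ⟨x, hx, hxG⟩ : ∃ x ∈ Set.Icc a b, G s = g x :=
      ⟨Set.projIcc a b hab s, (Set.projIcc a b hab s).2, rfl⟩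
    rw [hxG, hg]
    simp only
    rw [hquot x hx]
    simp only [Complex.add_im, Complex.ofReal_im, Complex.mul_im, Complex.ofReal_re, Complex.I_im,
      Complex.I_re, mul_one, mul_zero, zero_add, add_zero]
    rw [le_div_iff₀ (pow_pos (hγn x hx) 2), hκe x hx]
    -- What remains is `r² ≤ e^{r²/2}`, from `e^{r²/4} ≥ 1 + r²/4` and `(1 + a)² ≥ 4a`.
    refine mul_le_mul_of_nonneg_left ?_ hc0.le
    have h1 := Real.add_one_le_exp (‖γ x‖ ^ 2 / 4)
    have h2 : Real.exp (‖γ x‖ ^ 2 / 2) = Real.exp (‖γ x‖ ^ 2 / 4) ^ 2 := by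
      rw [← Real.exp_nat_mul]; congr 1; push_cast; ring
    rw [h2]
    nlinarith [sq_nonneg (‖γ x‖ ^ 2 / 4 - 1), sq_nonneg ‖γ x‖]
  -- A continuous logarithm of `γ` along the arc: its imaginary part is the polar angle, its real
  -- part the logarithmic radius.
  set w : ℝ → ℂ := fun s => Complex.log (γ a) + ∫ x in a..s, G x with hw
  have hwd : ∀ s, HasDerivAt w (G s) s := fun s =>
    ((hGcont.integral_hasStrictDerivAt a s).hasDerivAt).const_add _
  set φ : ℝ → ℝ := fun s => (w s).im with hφ
  set U : ℝ → ℝ := fun s => (w s).re with hU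
  have hφd : ∀ s, HasDerivAt φ (G s).im s := fun s =>
    Complex.imCLM.hasFDerivAt.comp_hasDerivAt s (hwd s)
  have hUd : ∀ s, HasDerivAt U (G s).re s := fun s =>
    Complex.reCLM.hasFDerivAt.comp_hasDerivAt s (hwd s)
  have hmono : StrictMono φ := strictMono_of_hasDerivAt_pos hφd (fun s => hc0.trans_le (hGim s))
  have hφc : Continuous φ := continuous_iff_continuousAt.2 fun s => (hφd s).continuousAt
  have hUc : Continuous U := continuous_iff_continuousAt.2 fun s => (hUd s).continuousAt
  have hgrow : ∀ s t, s ≤ t → c * (t - s) ≤ φ t - φ s := fun s t hst =>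
    sub_le_of_hasDerivAt_ge hst hφc.continuousOn (fun x _ => hφd x) (fun x _ => hGim x)
  have hsurj : Function.Surjective φ := by
    refine hφc.surjective ?_ ?_
    · refine Filter.tendsto_atTop_mono' _ (f₁ := fun t => φ 0 + c * t) ?_
        (Filter.tendsto_atTop_add_const_left _ _ (Filter.tendsto_id.const_mul_atTop hc0))
      filter_upwards [Filter.eventually_ge_atTop 0] with t ht
      linarith [hgrow 0 t ht]
    · refine Filter.tendsto_atBot_mono' _ (f₁ := fun t => φ 0 + c * t) ?_
        (Filter.tendsto_atBot_add_const_left _ _ (Filter.tendsto_id.const_mul_atBot hc0))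
      filter_upwards [Filter.eventually_le_atBot 0] with t ht
      linarith [hgrow t 0 ht]
  set e := hmono.orderIsoOfSurjective φ hsurj with he
  have heφ : ∀ s, e.symm (φ s) = s := fun s => e.symm_apply_apply s
  have hφe : ∀ t, φ (e.symm t) = t := fun t => e.apply_symm_apply t
  have hec : Continuous e.symm := e.symm.continuous
  have hemem : ∀ t ∈ Set.Icc (φ a) (φ b), e.symm t ∈ Set.Icc a b := fun t ht => by
    rw [← heφ a, ← heφ b]; exact ⟨e.symm.monotone ht.1, e.symm.monotone ht.2⟩
  have hemem' : ∀ t ∈ Set.Ioo (φ a) (φ b), e.symm t ∈ Set.Ioo a b := fun t ht => by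
    rw [← heφ a, ← heφ b]; exact ⟨e.symm.strictMono ht.1, e.symm.strictMono ht.2⟩
  have hed : ∀ t, HasDerivAt e.symm ((G (e.symm t)).im)⁻¹ t := fun t =>
    HasDerivAt.of_local_left_inverse hec.continuousAt (hφd _)
      (hc0.trans_le (hGim _)).ne' (Filter.Eventually.of_forall hφe)
  have hγw : ∀ s ∈ Set.Icc a b, γ s = Complex.exp (w s) := by
    have hd : ∀ x ∈ Set.Icc a b, HasDerivWithinAt (fun s => γ s * Complex.exp (-w s)) 0
        (Set.Icc a b) x := by
      intro x hx
      refine ((h.derivγ x hx).mul (hwd x).neg.cexp.hasDerivWithinAt).congr_deriv ?_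
      rw [hGeq x hx, hg]
      have := hγ0 x hx
      field_simp
      ring
    intro s hs
    have h2 := constant_of_derivWithin_zero (fun x hx => (hd x hx).differentiableWithinAt)
      (fun x hx => (hd x (Set.Ico_subset_Icc_self hx)).derivWithin
        (uniqueDiffOn_Icc h.lt x (Set.Ico_subset_Icc_self hx))) s hs
    have h3 : Complex.exp (w a) = γ a := by
      rw [hw]; simp [Complex.exp_log (hγ0 a ⟨le_rfl, hab⟩)]
    simp only [Complex.exp_neg] at h2
    rw [h3, mul_inv_cancel₀ (hγ0 a ⟨le_rfl, hab⟩)] at h2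
    field_simp at h2
    exact h2
  have hUnorm : ∀ s ∈ Set.Icc a b, ‖γ s‖ = Real.exp (U s) := fun s hs => by
    rw [hγw s hs, Complex.norm_exp]
  refine ⟨fun t => U (e.symm t), fun t => Real.arctan (p (e.symm t) / κ (e.symm t)), φ, ?_, hmono,
    ?_, fun s hs => ⟨?_, ?_⟩, hgrow a b hab⟩
  · have hpc : ContinuousOn p (Set.Icc a b) := fun s hs => (h.hasDerivWithinAt_re hs).continuousWithinAt
    have hκc : ContinuousOn κ (Set.Icc a b) := fun s hs => (h.hasDerivWithinAt_im hs).continuousWithinAt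
    refine ⟨(hUc.comp hec).continuousOn, ?_, fun t ht => ?_, fun t ht => ?_, fun t _ =>
      ⟨Real.neg_pi_div_two_lt_arctan _, Real.arctan_lt_pi_div_two _⟩⟩
    · exact Real.continuous_arctan.comp_continuousOn
        ((hpc.div hκc (fun s hs => (hκ0 s hs).ne')).comp hec.continuousOn hemem)
    · have hs := Set.Ioo_subset_Icc_self (hemem' t ht)
      refine ((hUd (e.symm t)).comp t (hed t)).congr_deriv ?_
      have h1 := (hκ0 _ hs).ne'
      have h2 := (hγn _ hs).ne'
      rw [Real.tan_arctan, hGeq _ hs, hg]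
      simp only
      rw [hquot _ hs]
      simp only [Complex.add_im, Complex.ofReal_im, Complex.mul_im, Complex.ofReal_re, Complex.I_im,
        Complex.I_re, mul_one, mul_zero, zero_add, add_zero, Complex.add_re, Complex.mul_re, sub_zero]
      field_simp
    · have hs := Set.Ioo_subset_Icc_self (hemem' t ht)
      have hnh : Set.Icc a b ∈ 𝓝 (e.symm t) := Icc_mem_nhds (hemem' t ht).1 (hemem' t ht).2
      have hpd : HasDerivAt p (1 - κ (e.symm t) ^ 2) (e.symm t) := (h.hasDerivWithinAt_re hs).hasDerivAt hnh
      have hκd : HasDerivAt κ (κ (e.symm t) * p (e.symm t)) (e.symm t) :=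
        (h.hasDerivWithinAt_im hs).hasDerivAt hnh
      have h1 := (hκ0 _ hs).ne'
      have h2 := (hγn _ hs).ne'
      refine (((hpd.div hκd h1).comp t (hed t)).arctan).congr_deriv ?_
      have h3 := hr _ hs
      have h4 : Real.exp (2 * U (e.symm t)) = ‖γ (e.symm t)‖ ^ 2 := by
        rw [hUnorm _ hs, ← Real.exp_nat_mul]; norm_num
      have h5 : p (e.symm t) ^ 2 + κ (e.symm t) ^ 2 ≠ 0 := by rw [h3]; positivity
      have h6 : 1 + (p (e.symm t) / κ (e.symm t)) ^ 2 ≠ 0 := by positivity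
      rw [h4, hGeq _ hs, hg]
      simp only [Function.comp, Pi.div_apply]
      rw [hquot _ hs]
      simp only [Complex.add_im, Complex.ofReal_im, Complex.mul_im, Complex.ofReal_re, Complex.I_im,
        Complex.I_re, mul_one, mul_zero, zero_add, add_zero]
      rw [← h3]
      have h7 : κ (e.symm t) ^ 2 + p (e.symm t) ^ 2 ≠ 0 := by rwa [add_comm]
      field_simp
      ring
  · ext t
    constructor
    · rintro ⟨s, hs, rfl⟩
      exact ⟨hmono.monotone hs.1, hmono.monotone hs.2⟩
    · intro ht
      exact ⟨e.symm t, hemem t ht, hφe t⟩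
  · simp only [heφ]
    rw [hγw s hs]
    congr 1
    exact (Complex.re_add_im _).symm
  · simp only [heφ]
    have h1 := hκ0 s hs
    have h2 := hγn s hs
    have h3 := hr s hs
    have hsq : √(1 + (p s / κ s) ^ 2) = ‖γ s‖ / κ s := by
      have : 1 + (p s / κ s) ^ 2 = (‖γ s‖ / κ s) ^ 2 := by
        rw [div_pow, div_pow, ← h3]
        field_simp
        ring
      rw [this, Real.sqrt_sq (div_pos h2 h1).le]
    have hsin : Real.sin (Real.arctan (p s / κ s)) = p s / ‖γ s‖ := by
      rw [Real.sin_arctan, hsq]; field_simp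
    have hcos : Real.cos (Real.arctan (p s / κ s)) = κ s / ‖γ s‖ := by
      rw [Real.cos_arctan, hsq]; field_simp
    have h4 : Complex.I * Complex.exp (-(Real.arctan (p s / κ s)) * Complex.I) =
        (p s / ‖γ s‖ : ℝ) + (κ s / ‖γ s‖ : ℝ) * Complex.I := by
      rw [← hsin, ← hcos, Complex.exp_mul_I, Complex.cos_neg, Complex.sin_neg, Complex.ofReal_sin,
        Complex.ofReal_cos]
      linear_combination -(Complex.sin (Real.arctan (p s / κ s))) * Complex.I_sq
    have h5 : γ s = ‖γ s‖ * Complex.exp (φ s * Complex.I) := by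
      rw [hUnorm s hs, Complex.ofReal_exp, ← Complex.exp_add, hγw s hs]
      congr 1
      exact (Complex.re_add_im _).symm
    have h7 : (‖γ s‖ : ℂ) ≠ 0 := by exact_mod_cast h2.ne'
    calc T s = T s / γ s * γ s := (div_mul_cancel₀ _ (hγ0 s hs)).symm
      _ = ((p s / ‖γ s‖ ^ 2 : ℝ) + (κ s / ‖γ s‖ ^ 2 : ℝ) * Complex.I) *
          (‖γ s‖ * Complex.exp (φ s * Complex.I)) := by
        rw [hquot s hs]; exact congrArg _ h5
      _ = _ := by
        rw [h4]
        push_cast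
        field_simp

end IsShrinkerArc

/-! ### Polar coordinates, and the curves of a network as polar graphs or radial lines -/

/-- The point with logarithmic radius `x` and angle `t`. -/
noncomputable def polar (x t : ℝ) : ℂ := Complex.exp (x + t * Complex.I)

/-- The unit tangent vector at angle `t` of a polar graph with slope angle `y`. -/
noncomputable def polarTangent (y t : ℝ) : ℂ :=
  Complex.I * Complex.exp (-y * Complex.I) * Complex.exp (t * Complex.I)

theorem polar_ne_zero (x t : ℝ) : polar x t ≠ 0 := Complex.exp_ne_zero _

theorem polar_eq_iff {x t x' t' : ℝ} :
    polar x t = polar x' t' ↔ x = x' ∧ ∃ n : ℤ, t = t' + n * (2 * Real.pi) := by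
  rw [polar, polar, Complex.exp_eq_exp_iff_exists_int]
  constructor
  · rintro ⟨n, hn⟩
    have h1 := congrArg Complex.re hn
    have h2 := congrArg Complex.im hn
    simp at h1 h2
    exact ⟨h1, n, h2⟩
  · rintro ⟨rfl, n, rfl⟩
    refine ⟨n, ?_⟩
    push_cast
    ring

theorem polar_add_two_pi (x t : ℝ) (n : ℤ) : polar x (t + n * (2 * Real.pi)) = polar x t :=
  polar_eq_iff.2 ⟨rfl, n, rfl⟩

theorem norm_polar (x t : ℝ) : ‖polar x t‖ = Real.exp x := by
  rw [polar, Complex.norm_exp]; simp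

theorem continuous_polar : Continuous fun p : ℝ × ℝ => polar p.1 p.2 := by
  unfold polar; fun_prop

theorem eq_of_exp_mul_I_eq {x y : ℝ} (h : Complex.exp (x * Complex.I) = Complex.exp (y * Complex.I))
    (hlt : |x - y| < 2 * Real.pi) : x = y := by
  have h1 : polar 0 x = polar 0 y := by simpa [polar] using h
  obtain ⟨-, n, hn⟩ := polar_eq_iff.1 h1
  have hpi := Real.pi_pos
  rw [hn, add_sub_cancel_left, abs_mul, abs_of_pos (by linarith : 0 < 2 * Real.pi)] at hlt
  have h2 : |(n : ℝ)| < 1 := by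
    by_contra! hle
    nlinarith
  have h3 : n = 0 := by
    rw [← Int.abs_lt_one_iff]; exact_mod_cast h2
  rw [hn, h3]; simp

/-- Negative momentum is reduced to `exists_polar` by reversing the arc, which flips the tangent.
The last inequality makes long arcs wind many times. -/
theorem IsShrinkerArc.exists_polar_of_im_ne_zero {γ T : ℝ → ℂ} {a b : ℝ}
    (h : IsShrinkerArc γ T a b) (hne : (star (γ a) * T a).im ≠ 0) :
    ∃ (u ψ φ : ℝ → ℝ) (A B : ℝ), A < B ∧ IsPolarShrinker u ψ A B ∧
      Set.BijOn φ (Set.Icc a b) (Set.Icc A B) ∧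
      ((φ a = A ∧ φ b = B ∧ StrictMonoOn φ (Set.Icc a b) ∧
          ∀ s ∈ Set.Icc a b, T s = polarTangent (ψ (φ s)) (φ s)) ∨
        (φ a = B ∧ φ b = A ∧ StrictAntiOn φ (Set.Icc a b) ∧
          ∀ s ∈ Set.Icc a b, T s = -polarTangent (ψ (φ s)) (φ s))) ∧
      (∀ s ∈ Set.Icc a b, γ s = polar (u (φ s)) (φ s)) ∧
      |(star (γ a) * T a).im| * Real.exp (-‖γ a‖ ^ 2 / 2) * (b - a) ≤ B - A := by
  rcases lt_or_gt_of_ne hne with hneg | hpos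
  · have hrev := h.reverse
    have hb : (star (γ b) * T b).im < 0 := by
      rw [h.im_eq ⟨h.lt.le, le_rfl⟩]
      exact mul_neg_of_neg_of_pos (mul_neg_of_neg_of_pos hneg (Real.exp_pos _)) (Real.exp_pos _)
    have e0 : (star (γ (- -b)) * -T (- -b)).im = -(star (γ b) * T b).im := by
      rw [neg_neg, mul_neg, Complex.neg_im]
    obtain ⟨u, ψ, φ, h1, h2, h3, h4, h5⟩ := hrev.exists_polar (by rw [e0]; linarith)
    refine ⟨u, ψ, fun s => φ (-s), φ (-b), φ (-a), h2 (neg_lt_neg h.lt), h1, ⟨?_, ?_, ?_⟩,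
      Or.inr ⟨rfl, rfl, fun s _ t _ hst => h2 (neg_lt_neg hst), fun s hs => ?_⟩, fun s hs => ?_, ?_⟩
    · exact fun s hs => ⟨h2.monotone (neg_le_neg hs.2), h2.monotone (neg_le_neg hs.1)⟩
    · exact fun s _ t _ hst => neg_injective (h2.injective hst)
    · intro t ht
      rw [← h3] at ht
      obtain ⟨s, hs, rfl⟩ := ht
      exact ⟨-s, ⟨by linarith [hs.2], by linarith [hs.1]⟩, by simp⟩
    · have := (h4 (-s) ⟨by linarith [hs.2], by linarith [hs.1]⟩).2
      rw [neg_neg] at this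
      rw [polarTangent, ← this, neg_neg]
    · have := (h4 (-s) ⟨by linarith [hs.2], by linarith [hs.1]⟩).1
      rwa [neg_neg] at this
    · refine le_trans (le_of_eq ?_) h5
      rw [e0, h.im_eq ⟨h.lt.le, le_rfl⟩, abs_of_neg hneg, neg_neg]
      have : Real.exp (‖γ b‖ ^ 2 / 2) * Real.exp (-‖γ b‖ ^ 2 / 2) = 1 := by
        rw [← Real.exp_add, neg_div, add_neg_cancel, Real.exp_zero]
      linear_combination (star (γ a) * T a).im * Real.exp (-‖γ a‖ ^ 2 / 2) * (b - a) * this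
  · obtain ⟨u, ψ, φ, h1, h2, h3, h4, h5⟩ := h.exists_polar hpos
    refine ⟨u, ψ, φ, φ a, φ b, h2 h.lt, h1, ⟨?_, h2.injective.injOn, h3.ge⟩,
      Or.inl ⟨rfl, rfl, h2.strictMonoOn _, fun s hs => (h4 s hs).2⟩, fun s hs => (h4 s hs).1, ?_⟩
    · exact fun s hs => h3 ▸ Set.mem_image_of_mem φ hs
    · rwa [abs_of_pos hpos]

/-- Gives points of a curve close to an end both in arclength and in polar angle, as the clause on
`arm` in `IsPolar` demands. -/
theorem exists_small_param {φ : ℝ → ℝ} {ℓ A B δ : ℝ} (hℓ : 0 < ℓ) (h0 : φ 0 = A) (h1 : φ ℓ = B)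
    (hmono : StrictMonoOn φ (Set.Icc 0 ℓ)) (hsurj : Set.SurjOn φ (Set.Icc 0 ℓ) (Set.Icc A B))
    (hδ : 0 < δ) : ∃ s ∈ Set.Ioo 0 δ, s ∈ Set.Icc 0 ℓ ∧ φ s ∈ Set.Ioo A B ∧ φ s < A + δ := by
  have hs0 : min (δ / 2) (ℓ / 2) ∈ Set.Icc 0 ℓ :=
    ⟨by positivity, (min_le_right _ _).trans (by linarith)⟩
  have hpos : 0 < min (δ / 2) (ℓ / 2) := by positivity
  have h2 := hmono ⟨le_rfl, hℓ.le⟩ hs0 hpos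
  have h3 := hmono.monotoneOn hs0 ⟨hℓ.le, le_rfl⟩ hs0.2
  rw [h0] at h2
  rw [h1] at h3
  obtain ⟨t, ht1, ht2⟩ := exists_between (lt_min h2 (by linarith : A < A + δ))
  rw [lt_min_iff] at ht2
  obtain ⟨s, hs, rfl⟩ := hsurj (⟨ht1.le, ht2.1.le.trans h3⟩ : t ∈ Set.Icc A B)
  have hlt := (hmono.lt_iff_lt hs hs0).1 ht2.1
  have hs1 : s ≠ 0 := by rintro rfl; exact ht1.ne h0.symm
  exact ⟨s, ⟨lt_of_le_of_ne hs.1 hs1.symm, hlt.trans_le ((min_le_left _ _).trans (by linarith))⟩, hs,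
    ⟨ht1, ht2.1.trans_le h3⟩, ht2.2⟩

namespace PlaneNetwork

variable {ι : Type*} {N : PlaneNetwork ι}

/-- The curve with end `e`, parametrized starting from this end. -/
noncomputable def arm (N : PlaneNetwork ι) (e : ι × ℝ) (s : ℝ) : ℂ :=
  if e.2 = 0 then N.curve e.1 s else N.curve e.1 (e.2 - s)

/-- The `i`-th curve is the polar graph of `u` over `[A, B]`. -/
structure IsPolar (N : PlaneNetwork ι) (i : ι) (u ψ : ℝ → ℝ) (A B : ℝ) : Prop where
  lt : A < B
  sol : IsPolarShrinker u ψ A B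
  trace_eq : N.trace i = (fun t => polar (u t) t) '' Set.Icc A B
  simple : ∀ t ∈ Set.Ioo A B, ∀ t' ∈ Set.Icc A B, polar (u t) t = polar (u t') t' → t = t'
  disjoint : ∀ t ∈ Set.Ioo A B, ∀ j, j ≠ i → polar (u t) t ∉ N.trace j
  ends : (∃ eA eB : ι × ℝ, eA ≠ eB ∧ eA.1 = i ∧ eB.1 = i ∧ eA ∈ N.curveEnds ∧ eB ∈ N.curveEnds ∧
      (∀ e ∈ N.curveEnds, e.1 = i → e = eA ∨ e = eB) ∧
      N.endPoint eA = polar (u A) A ∧ N.endPoint eB = polar (u B) B ∧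
      N.endTangent eA = polarTangent (ψ A) A ∧ N.endTangent eB = -polarTangent (ψ B) B ∧
      (∀ δ > 0, ∃ s ∈ Set.Ioo 0 δ, ∃ t ∈ Set.Ioo A B, t < A + δ ∧
        N.arm eA s = polar (u t) t) ∧
      ∀ δ > 0, ∃ s ∈ Set.Ioo 0 δ, ∃ t ∈ Set.Ioo A B, B - δ < t ∧ N.arm eB s = polar (u t) t) ∨
    ((∀ e ∈ N.curveEnds, e.1 ≠ i) ∧ polar (u A) A = polar (u B) B ∧ ψ A = ψ B ∧
      ∀ k, k ≠ i → polar (u A) A ∉ N.trace k)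

/-- The `i`-th curve is a segment of a line through the origin. -/
structure IsRadial (N : PlaneNetwork ι) (i : ι) (d : ℂ) (a b : ℝ) : Prop where
  lt : a < b
  norm_eq : ‖d‖ = 1
  trace_eq : N.trace i = (fun x : ℝ => (x : ℂ) * d) '' Set.Icc a b
  disjoint : ∀ x ∈ Set.Ioo a b, ∀ j, j ≠ i → (x : ℂ) * d ∉ N.trace j
  ends : ∃ eA eB : ι × ℝ, eA ≠ eB ∧ eA.1 = i ∧ eB.1 = i ∧ eA ∈ N.curveEnds ∧ eB ∈ N.curveEnds ∧
      (∀ e ∈ N.curveEnds, e.1 = i → e = eA ∨ e = eB) ∧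
      N.endPoint eA = (a : ℂ) * d ∧ N.endPoint eB = (b : ℂ) * d ∧
      N.endTangent eA = d ∧ N.endTangent eB = -d

theorem IsRegular.uniqueDiffOn (hreg : N.IsRegular) (i : ι) : UniqueDiffOn ℝ (N.domain i) := by
  have h := hreg.admissible i
  unfold domain
  cases hk : N.kind i with
  | arc ℓ => rw [hk] at h; exact uniqueDiffOn_Icc h
  | ray => exact uniqueDiffOn_Ici 0
  | line => exact uniqueDiffOn_univ
  | closed ℓ => exact uniqueDiffOn_univ

theorem IsRegular.hasDerivWithinAt_curve (hreg : N.IsRegular) {i : ι} {s : ℝ}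
    (hs : s ∈ N.domain i) : HasDerivWithinAt (N.curve i) (N.tangent i s) (N.domain i) s :=
  (((hreg.contDiffOn i).differentiableOn (by norm_num)) s hs).hasDerivWithinAt

theorem IsRegular.contDiffOn_tangent (hreg : N.IsRegular) (i : ι) :
    ContDiffOn ℝ 1 (N.tangent i) (N.domain i) :=
  (hreg.contDiffOn i).derivWithin (hreg.uniqueDiffOn i) (by norm_num)

theorem IsRegular.isShrinkerArc (hreg : N.IsRegular) (hshr : N.IsShrinking) (i : ι) {a b : ℝ}
    (hab : a < b) (hsub : Set.Icc a b ⊆ N.domain i) :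
    IsShrinkerArc (N.curve i) (N.tangent i) a b := by
  refine ⟨hab, fun s hs => (hreg.hasDerivWithinAt_curve (hsub hs)).mono hsub, fun s hs => ?_,
    fun s hs => hreg.arclength i s (hsub hs)⟩
  have h1 : HasDerivWithinAt (N.tangent i) (N.curvatureVector i s) (N.domain i) s :=
    (((hreg.contDiffOn_tangent i).differentiableOn (by norm_num)) s (hsub hs)).hasDerivWithinAt
  refine (h1.mono hsub).congr_deriv ?_
  have h2 := eq_neg_of_add_eq_zero_left (hshr i s (hsub hs))
  have h3 : star (N.tangent i s) * N.tangent i s = 1 := by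
    have := Complex.conj_mul' (N.tangent i s)
    rw [hreg.arclength i s (hsub hs)] at this
    simpa using this
  rw [h2, normalPosition, Complex.inner, Complex.real_smul]
  set m := star (N.curve i s) * N.tangent i s with hm
  -- In the moving frame the position is `Re m` along `T` and `-Im m` along `iT`, so the equation
  -- says that the curvature vector is `Im m • iT`.
  have h4 : N.curve i s = star m * N.tangent i s := by
    rw [hm, star_mul, star_star]
    linear_combination -(N.curve i s) * h3
  have h5 : N.tangent i s * (starRingEnd ℂ) (N.curve i s) = m := mul_comm _ _
  rw [h5]
  nth_rewrite 1 [h4]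
  have h6 : star m = m.re - m.im * Complex.I := by
    apply Complex.ext <;> simp
  rw [h6]
  ring

theorem isPolar_or_isRadial_of_arc (hreg : N.IsRegular) (hshr : N.IsShrinking) {i : ι} {ℓ : ℝ}
    (hk : N.kind i = CurveKind.arc ℓ) :
    (∃ u ψ A B, N.IsPolar i u ψ A B) ∨ ∃ d a b, N.IsRadial i d a b := by
  have hℓ : 0 < ℓ := by have := hreg.admissible i; rwa [hk] at this
  have hdom : N.domain i = Set.Icc 0 ℓ := by rw [domain, hk]; rfl
  have harc := hreg.isShrinkerArc hshr i hℓ hdom.ge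
  have hends : ∀ s, (i, s) ∈ N.curveEnds ↔ s = 0 ∨ s = ℓ := by
    intro s
    simp [curveEnds, hk, CurveKind.ends]
  have hends' : ∀ e ∈ N.curveEnds, e.1 = i → e = (i, 0) ∨ e = (i, ℓ) := by
    rintro ⟨j, s⟩ he rfl
    rcases (hends s).1 he with rfl | rfl <;> simp
  have hemb : ∀ s ∈ Set.Ioo 0 ℓ, ∀ j, ∀ t ∈ N.domain j, N.curve i s = N.curve j t →
      i = j ∧ s = t := by
    intro s hs j t ht heq
    have h1 : s ∉ (N.kind i).ends := by
      rw [hk]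
      simp only [CurveKind.ends, Set.mem_insert_iff, Set.mem_singleton_iff]
      rintro (rfl | rfl)
      · exact hs.1.false
      · exact hs.2.false
    have h2 := hreg.embedded i j s t (hdom ▸ Set.Ioo_subset_Icc_self hs) h1 ht heq
    rw [hk] at h2
    exact h2
  have h0I : (0 : ℝ) ∈ Set.Icc 0 ℓ := ⟨le_rfl, hℓ.le⟩
  have hℓI : ℓ ∈ Set.Icc 0 ℓ := ⟨hℓ.le, le_rfl⟩
  have hne : ((i, (0 : ℝ)) : ι × ℝ) ≠ (i, ℓ) := by simp [hℓ.ne]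
  have ht0 : N.endTangent (i, 0) = N.tangent i 0 := by simp [endTangent]
  have htℓ : N.endTangent (i, ℓ) = -N.tangent i ℓ := by simp [endTangent, hℓ.ne']
  rcases eq_or_ne ((star (N.curve i 0) * N.tangent i 0).im) 0 with h0 | h0
  · right
    have hrad := fun s hs => harc.radial_of_im_eq_zero h0 (s := s) hs
    set m := (star (N.curve i 0) * N.tangent i 0).re with hm
    set d := N.tangent i 0 with hd
    simp only [sub_zero] at hrad
    refine ⟨d, m, ℓ + m, by linarith, harc.unit 0 h0I, ?_, ?_, (i, 0), (i, ℓ), hne, rfl, rfl,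
      (hends 0).2 (Or.inl rfl), (hends ℓ).2 (Or.inr rfl), hends', ?_, ?_, ht0, ?_⟩
    · rw [trace, hdom]
      ext z
      constructor
      · rintro ⟨s, hs, rfl⟩
        exact ⟨s + m, ⟨by linarith [hs.1], by linarith [hs.2]⟩, (hrad s hs).2.symm⟩
      · rintro ⟨x, hx, rfl⟩
        refine ⟨x - m, ⟨by linarith [hx.1], by linarith [hx.2]⟩, ?_⟩
        rw [(hrad (x - m) ⟨by linarith [hx.1], by linarith [hx.2]⟩).2, sub_add_cancel]
    · rintro x hx j hj ⟨t, ht, heq⟩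
      have h1 : x - m ∈ Set.Ioo 0 ℓ := ⟨by linarith [hx.1], by linarith [hx.2]⟩
      refine hj (hemb (x - m) h1 j t ht ?_).1.symm
      rw [(hrad _ (Set.Ioo_subset_Icc_self h1)).2, sub_add_cancel, heq]
    · rw [endPoint, (hrad 0 h0I).2, zero_add]
    · rw [endPoint, (hrad ℓ hℓI).2]
    · rw [htℓ, (hrad ℓ hℓI).1]
  · left
    obtain ⟨u, ψ, φ, A, B, hAB, hsol, hφ, hT, hγ, -⟩ := harc.exists_polar_of_im_ne_zero h0
    have hinner : ∀ s ∈ Set.Icc 0 ℓ, φ s ∈ Set.Ioo A B → s ∈ Set.Ioo 0 ℓ := by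
      intro s hs hφs
      refine ⟨lt_of_le_of_ne hs.1 ?_, lt_of_le_of_ne hs.2 ?_⟩
      · rintro rfl
        rcases hT with h | h
        · exact (h.1 ▸ hφs.1).false
        · exact (h.1 ▸ hφs.2).false
      · rintro rfl
        rcases hT with h | h
        · exact (h.2.1 ▸ hφs.2).false
        · exact (h.2.1 ▸ hφs.1).false
    have htr : N.trace i = (fun t => polar (u t) t) '' Set.Icc A B := by
      rw [trace, hdom, ← hφ.image_eq, Set.image_image]
      exact Set.image_congr hγ
    have ha0 : ∀ s, N.arm (i, 0) s = N.curve i s := fun s => by simp [arm]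
    have haℓ : ∀ s, N.arm (i, ℓ) s = N.curve i (ℓ - s) := fun s => by simp [arm, hℓ.ne']
    have hrev : ∀ s ∈ Set.Icc 0 ℓ, ℓ - s ∈ Set.Icc 0 ℓ := fun s hs =>
      ⟨by linarith [hs.2], by linarith [hs.1]⟩
    have hsurj : Set.SurjOn (fun s => -φ (ℓ - s)) (Set.Icc 0 ℓ) (Set.Icc (-B) (-A)) ∧
        Set.SurjOn (fun s => φ (ℓ - s)) (Set.Icc 0 ℓ) (Set.Icc A B) ∧
        Set.SurjOn (fun s => -φ s) (Set.Icc 0 ℓ) (Set.Icc (-B) (-A)) := by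
      refine ⟨fun t ht => ?_, fun t ht => ?_, fun t ht => ?_⟩
      · obtain ⟨s, hs, hst⟩ := hφ.surjOn
          (⟨by linarith [ht.2], by linarith [ht.1]⟩ : -t ∈ Set.Icc A B)
        exact ⟨ℓ - s, hrev s hs, by simp [hst]⟩
      · obtain ⟨s, hs, hst⟩ := hφ.surjOn ht
        exact ⟨ℓ - s, hrev s hs, by simp [hst]⟩
      · obtain ⟨s, hs, hst⟩ := hφ.surjOn
          (⟨by linarith [ht.2], by linarith [ht.1]⟩ : -t ∈ Set.Icc A B)
        exact ⟨s, hs, by simp [hst]⟩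
    refine ⟨u, ψ, A, B, hAB, hsol, htr, ?_, ?_, Or.inl ?_⟩
    · intro t ht t' ht' heq
      obtain ⟨s, hs, rfl⟩ := hφ.surjOn (Set.Ioo_subset_Icc_self ht)
      obtain ⟨s', hs', rfl⟩ := hφ.surjOn ht'
      rw [← hγ s hs, ← hγ s' hs'] at heq
      rw [(hemb s (hinner s hs ht) i s' (hdom ▸ hs') heq).2]
    · rintro t ht j hj ⟨x, hx, heq⟩
      obtain ⟨s, hs, rfl⟩ := hφ.surjOn (Set.Ioo_subset_Icc_self ht)
      rw [← hγ s hs] at heq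
      exact hj (hemb s (hinner s hs ht) j x hx heq.symm).1.symm
    · rcases hT with ⟨ha, hb, hm, h⟩ | ⟨ha, hb, hm, h⟩
      · refine ⟨(i, 0), (i, ℓ), hne, rfl, rfl, (hends 0).2 (Or.inl rfl), (hends ℓ).2 (Or.inr rfl),
          hends', ?_, ?_, ?_, ?_, fun δ hδ => ?_, fun δ hδ => ?_⟩
        · rw [endPoint, hγ 0 h0I, ha]
        · rw [endPoint, hγ ℓ hℓI, hb]
        · rw [ht0, h 0 h0I, ha]
        · rw [htℓ, h ℓ hℓI, hb]
        · obtain ⟨s, hs, hsI, ht, hlt⟩ := exists_small_param hℓ ha hb hm hφ.surjOn hδ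
          exact ⟨s, hs, φ s, ht, hlt, by rw [ha0, hγ s hsI]⟩
        · obtain ⟨s, hs, hsI, ht, hlt⟩ := exists_small_param (φ := fun s => -φ (ℓ - s)) hℓ
            (by simp [hb]) (by simp [ha])
            (fun x hx y hy hxy => neg_lt_neg (hm (hrev y hy) (hrev x hx) (by linarith)))
            (hsurj.1) hδ
          exact ⟨s, hs, φ (ℓ - s), ⟨by linarith [ht.2], by linarith [ht.1]⟩, by linarith,
            by rw [haℓ, hγ _ (hrev s hsI)]⟩
      · refine ⟨(i, ℓ), (i, 0), hne.symm, rfl, rfl, (hends ℓ).2 (Or.inr rfl),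
          (hends 0).2 (Or.inl rfl), fun e he hei => (hends' e he hei).symm, ?_, ?_, ?_, ?_,
          fun δ hδ => ?_, fun δ hδ => ?_⟩
        · rw [endPoint, hγ ℓ hℓI, hb]
        · rw [endPoint, hγ 0 h0I, ha]
        · rw [htℓ, h ℓ hℓI, hb, neg_neg]
        · rw [ht0, h 0 h0I, ha]
        · obtain ⟨s, hs, hsI, ht, hlt⟩ := exists_small_param (φ := fun s => φ (ℓ - s)) hℓ
            (by simp [hb]) (by simp [ha])
            (fun x hx y hy hxy => hm (hrev y hy) (hrev x hx) (by linarith)) hsurj.2.1 hδ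
          exact ⟨s, hs, φ (ℓ - s), ht, hlt, by rw [haℓ, hγ _ (hrev s hsI)]⟩
        · obtain ⟨s, hs, hsI, ht, hlt⟩ := exists_small_param (φ := fun s => -φ s) hℓ
            (by simp [ha]) (by simp [hb]) (fun x hx y hy hxy => neg_lt_neg (hm hx hy hxy))
            hsurj.2.2 hδ
          exact ⟨s, hs, φ s, ⟨by linarith [ht.2], by linarith [ht.1]⟩, by linarith,
            by rw [ha0, hγ s hsI]⟩

theorem trace_eq_of_closed (hreg : N.IsRegular) {i : ι} {ℓ : ℝ}
    (hk : N.kind i = CurveKind.closed ℓ) : N.trace i = N.curve i '' Set.Icc 0 ℓ := by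
  have hℓ : 0 < ℓ := by have := hreg.admissible i; rwa [hk] at this
  have hdom : N.domain i = Set.univ := by rw [domain, hk]; rfl
  have := (hreg.periodic i ℓ hk).image_Icc hℓ 0
  rw [zero_add] at this
  rw [trace, hdom, Set.image_univ, this]

theorem isPolar_of_closed (hreg : N.IsRegular) (hshr : N.IsShrinking) {i : ι} {ℓ : ℝ}
    (hk : N.kind i = CurveKind.closed ℓ) : ∃ u ψ A B, N.IsPolar i u ψ A B := by
  have hℓ : 0 < ℓ := by have := hreg.admissible i; rwa [hk] at this
  have hdom : N.domain i = Set.univ := by rw [domain, hk]; rfl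
  have harc := hreg.isShrinkerArc hshr i hℓ (hdom ▸ Set.subset_univ _)
  have hends : ∀ e ∈ N.curveEnds, e.1 ≠ i := by
    rintro ⟨j, s⟩ he rfl
    simp [curveEnds, hk, CurveKind.ends] at he
  have hper := hreg.periodic i ℓ hk
  have hperT : N.tangent i ℓ = N.tangent i 0 := by
    have h1 := deriv_comp_add_const (N.curve i) ℓ 0
    rw [hper.funext] at h1
    rw [tangent, tangent, hdom, derivWithin_univ, h1, zero_add]
  have hper0 : N.curve i ℓ = N.curve i 0 := by simpa using hper 0
  have hemb : ∀ s, ∀ j, ∀ t ∈ N.domain j, N.curve i s = N.curve j t →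
      i = j ∧ ∃ n : ℤ, t = s + n * ℓ := by
    intro s j t ht heq
    have h2 := hreg.embedded i j s t (hdom ▸ Set.mem_univ _) (by rw [hk]; simp [CurveKind.ends]) ht
      heq
    rw [hk] at h2
    exact h2
  have h0I : (0 : ℝ) ∈ Set.Icc 0 ℓ := ⟨le_rfl, hℓ.le⟩
  have hℓI : ℓ ∈ Set.Icc 0 ℓ := ⟨hℓ.le, le_rfl⟩
  rcases eq_or_ne ((star (N.curve i 0) * N.tangent i 0).im) 0 with h0 | h0
  -- Zero momentum would make the closed curve a straight segment, which does not close up.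
  · exfalso
    have h1 := (harc.radial_of_im_eq_zero h0 h0I).2
    have h2 := (harc.radial_of_im_eq_zero h0 hℓI).2
    have h3 : N.tangent i 0 ≠ 0 := by
      rw [← norm_pos_iff, harc.unit 0 h0I]; exact one_pos
    have h4 := Complex.ofReal_injective
      (mul_right_cancel₀ h3 (h1.symm.trans (hper0.symm.trans h2)))
    linarith
  · obtain ⟨u, ψ, φ, A, B, hAB, hsol, hφ, hT, hγ, -⟩ := harc.exists_polar_of_im_ne_zero h0
    have hinner : ∀ s ∈ Set.Icc 0 ℓ, φ s ∈ Set.Ioo A B → s ∈ Set.Ioo 0 ℓ := by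
      intro s hs hφs
      refine ⟨lt_of_le_of_ne hs.1 ?_, lt_of_le_of_ne hs.2 ?_⟩
      · rintro rfl
        rcases hT with h | h
        · exact (h.1 ▸ hφs.1).false
        · exact (h.1 ▸ hφs.2).false
      · rintro rfl
        rcases hT with h | h
        · exact (h.2.1 ▸ hφs.2).false
        · exact (h.2.1 ▸ hφs.1).false
    have hp : polar (u A) A = polar (u B) B ∧ polarTangent (ψ A) A = polarTangent (ψ B) B := by
      have e1 := hγ 0 h0I
      have e2 := hγ ℓ hℓI
      rcases hT with ⟨ha, hb, hm, h⟩ | ⟨ha, hb, hm, h⟩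
      · rw [ha] at e1
        rw [hb] at e2
        have e3 := h 0 h0I
        have e4 := h ℓ hℓI
        rw [ha] at e3
        rw [hb] at e4
        exact ⟨by rw [← e1, ← e2, hper0], by rw [← e3, ← e4, hperT]⟩
      · rw [ha] at e1
        rw [hb] at e2
        have e3 := h 0 h0I
        have e4 := h ℓ hℓI
        rw [ha] at e3
        rw [hb] at e4
        exact ⟨by rw [← e1, ← e2, hper0], neg_injective (by rw [← e3, ← e4, hperT])⟩
    refine ⟨u, ψ, A, B, hAB, hsol, ?_, ?_, ?_, Or.inr ⟨hends, hp.1, ?_, ?_⟩⟩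
    · rw [trace_eq_of_closed hreg hk, ← hφ.image_eq, Set.image_image]
      exact Set.image_congr hγ
    · intro t ht t' ht' heq
      obtain ⟨s, hs, rfl⟩ := hφ.surjOn (Set.Ioo_subset_Icc_self ht)
      obtain ⟨s', hs', rfl⟩ := hφ.surjOn ht'
      rw [← hγ s hs, ← hγ s' hs'] at heq
      have hs0 := hinner s hs ht
      obtain ⟨-, n, hn⟩ := hemb s i s' (hdom ▸ Set.mem_univ _) heq
      have h1 : (n : ℝ) < 1 := by
        by_contra! hle
        nlinarith [hs'.2, hs0.1]
      have h2 : (-1 : ℝ) < n := by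
        by_contra! hle
        nlinarith [hs'.1, hs0.2]
      have h3 : n = 0 := by
        have : n < 1 := by exact_mod_cast h1
        have : -1 < n := by exact_mod_cast h2
        omega
      rw [hn, h3]; simp
    · rintro t ht j hj ⟨x, hx, heq⟩
      obtain ⟨s, hs, rfl⟩ := hφ.surjOn (Set.Ioo_subset_Icc_self ht)
      rw [← hγ s hs] at heq
      exact hj (hemb s j x hx heq.symm).1.symm
    · obtain ⟨-, n, hn⟩ := polar_eq_iff.1 hp.1
      have h1 : Complex.exp (A * Complex.I) = Complex.exp (B * Complex.I) := by
        have := polar_add_two_pi 0 B n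
        rw [← hn] at this
        simpa [polar] using this
      have h2 := hp.2
      rw [polarTangent, polarTangent, h1] at h2
      have h3 := mul_left_cancel₀ Complex.I_ne_zero
        (mul_right_cancel₀ (Complex.exp_ne_zero _) h2)
      have mA := hsol.memψ A ⟨le_rfl, hAB.le⟩
      have mB := hsol.memψ B ⟨hAB.le, le_rfl⟩
      have h4 : -ψ A = -ψ B := by
        refine eq_of_exp_mul_I_eq (by push_cast; exact h3) ?_
        rw [abs_lt]
        constructor <;> linarith [mA.1, mA.2, mB.1, mB.2, Real.pi_pos]
      linarith
    · rintro k hk ⟨x, hx, heq⟩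
      obtain ⟨s, hs, hsA⟩ := hφ.surjOn (⟨le_rfl, hAB.le⟩ : A ∈ Set.Icc A B)
      have := hγ s hs
      rw [hsA, ← heq] at this
      exact hk (hemb s k x hx this).1.symm

/-- A half-infinite or doubly infinite curve of a shrinking network is radial. -/
theorem curve_eq_of_unbounded (hreg : N.IsRegular) (hshr : N.IsShrinking) {i : ι}
    (hk : N.kind i = CurveKind.ray ∨ N.kind i = CurveKind.line) {s : ℝ} (hs : s ∈ N.domain i) :
    N.curve i s = N.curve i 0 + s * N.tangent i 0 := by
  have hIci : Set.Ici 0 ⊆ N.domain i := by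
    rcases hk with hk | hk <;> simp [domain, hk, CurveKind.domain]
  have h0 : (star (N.curve i 0) * N.tangent i 0).im = 0 := by
    by_contra hne
    set c := |(star (N.curve i 0) * N.tangent i 0).im| * Real.exp (-‖N.curve i 0‖ ^ 2 / 2) with hc
    have hc0 : 0 < c := mul_pos (abs_pos.2 hne) (Real.exp_pos _)
    have hpi := Real.pi_pos
    -- The polar angle grows at rate at least `c`, so this length yields five half turns and a
    -- self-intersection.
    have hL : 0 < 5 * Real.pi / c := by positivity
    have hsub : Set.Icc 0 (5 * Real.pi / c) ⊆ N.domain i := fun x hx => hIci hx.1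
    obtain ⟨u, ψ, φ, A, B, hAB, hsol, hφ, -, hγ, hlen⟩ :=
      (hreg.isShrinkerArc hshr i hL hsub).exists_polar_of_im_ne_zero hne
    rw [← hc, sub_zero, mul_div_cancel₀ _ hc0.ne'] at hlen
    obtain ⟨t, ht, hut⟩ := hsol.exists_self_meeting (by linarith)
    obtain ⟨x, hx, hxt⟩ := hφ.surjOn (⟨ht.1, by linarith [ht.2]⟩ : t ∈ Set.Icc A B)
    obtain ⟨y, hy, hyt⟩ := hφ.surjOn
      (⟨by linarith [ht.1], by linarith [ht.2]⟩ : t + 2 * Real.pi ∈ Set.Icc A B)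
    have heq : N.curve i x = N.curve i y := by
      rw [hγ x hx, hγ y hy, hxt, hyt, hut]
      have := polar_add_two_pi (u t) t 1
      simp only [Int.cast_one, one_mul] at this
      exact this.symm
    have hxy : x ≠ y := by
      rintro rfl
      linarith
    have key : ∀ a b, a ∈ N.domain i → b ∈ N.domain i → a ≠ 0 → N.curve i a = N.curve i b →
        a = b := by
      intro a b ha hb ha0 hab
      have h1 : a ∉ (N.kind i).ends := by
        rcases hk with hk | hk <;> simp [hk, CurveKind.ends, ha0]
      have h2 := (hreg.embedded i i a b ha h1 hb hab).2
      rcases hk with hk | hk <;> (rw [hk] at h2; exact h2)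
    -- The parameter `0` may be the end of a ray, where embeddedness is not asserted; one of `x`,
    -- `y` differs from it.
    rcases eq_or_ne x 0 with hx0 | hx0
    · exact hxy (key y x (hsub hy) (hsub hx) (fun h => hxy (hx0.trans h.symm)) heq.symm).symm
    · exact hxy (key x y (hsub hx) (hsub hy) hx0 heq)
  rcases lt_trichotomy s 0 with hlt | rfl | hgt
  · have hline : N.domain i = Set.univ := by
      rcases hk with hk | hk
      · simp only [domain, hk, CurveKind.domain, Set.mem_Ici] at hs
        linarith
      · simp [domain, hk, CurveKind.domain]
    have harc := hreg.isShrinkerArc hshr i hlt (hline ▸ Set.subset_univ _)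
    have h1 := harc.im_eq (s := 0) ⟨hlt.le, le_rfl⟩
    rw [h0, eq_comm, mul_assoc, mul_eq_zero] at h1
    have h2 := h1.resolve_right (mul_pos (Real.exp_pos _) (Real.exp_pos _)).ne'
    have h3 := harc.radial_of_im_eq_zero h2 (s := 0) ⟨hlt.le, le_rfl⟩
    have h4 := harc.radial_of_im_eq_zero h2 (s := s) ⟨le_rfl, hlt.le⟩
    rw [h3.2, h3.1]
    nth_rewrite 1 [h4.2]
    push_cast
    ring
  · simp
  · have harc := hreg.isShrinkerArc hshr i hgt (fun x hx => hIci hx.1)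
    have h3 := harc.radial_of_im_eq_zero h0 (s := 0) ⟨le_rfl, hgt.le⟩
    have h4 := harc.radial_of_im_eq_zero h0 (s := s) ⟨hgt.le, le_rfl⟩
    rw [h4.2]
    nth_rewrite 2 [h3.2]
    push_cast
    ring

theorem isClosed_trace (hreg : N.IsRegular) (hshr : N.IsShrinking) (i : ι) :
    IsClosed (N.trace i) := by
  have hcont : ContinuousOn (N.curve i) (N.domain i) := (hreg.contDiffOn i).continuousOn
  have hunb : (N.kind i = CurveKind.ray ∨ N.kind i = CurveKind.line) → IsClosed (N.domain i) →
      IsClosed (N.trace i) := by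
    intro hk hcl
    have h0 : (0 : ℝ) ∈ N.domain i := by
      rcases hk with hk | hk <;> simp [domain, hk, CurveKind.domain]
    have hiso : Isometry fun s : ℝ => N.curve i 0 + s * N.tangent i 0 := by
      refine Isometry.of_dist_eq fun x y => ?_
      rw [dist_add_left, dist_eq_norm, ← sub_mul, norm_mul, hreg.arclength i 0 h0, mul_one,
        ← Complex.ofReal_sub, Complex.norm_real, Real.dist_eq, Real.norm_eq_abs]
    have : N.trace i = (fun s : ℝ => N.curve i 0 + s * N.tangent i 0) '' N.domain i :=
      Set.image_congr fun s hs => curve_eq_of_unbounded hreg hshr hk hs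
    rw [this]
    exact hiso.isClosedEmbedding.isClosedMap _ hcl
  cases hk : N.kind i with
  | arc ℓ =>
    have hdom : N.domain i = Set.Icc 0 ℓ := by rw [domain, hk]; rfl
    rw [hdom] at hcont
    rw [trace, hdom]
    exact (isCompact_Icc.image_of_continuousOn hcont).isClosed
  | ray => exact hunb (Or.inl hk) (by simp [domain, hk, CurveKind.domain, isClosed_Ici])
  | line => exact hunb (Or.inr hk) (by simp [domain, hk, CurveKind.domain])
  | closed ℓ =>
    have hdom : N.domain i = Set.univ := by rw [domain, hk]; rfl
    rw [trace_eq_of_closed hreg hk]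
    exact (isCompact_Icc.image_of_continuousOn
      (hcont.mono (hdom ▸ Set.subset_univ _))).isClosed

theorem isClosed_support (hreg : N.IsRegular) (hshr : N.IsShrinking) : IsClosed N.support :=
  hreg.locallyFinite.isClosed_iUnion (isClosed_trace hreg hshr)

theorem kind_of_isBounded (hreg : N.IsRegular) (hshr : N.IsShrinking) {i : ι}
    (hb : Bornology.IsBounded (N.trace i)) :
    (∃ ℓ, N.kind i = CurveKind.arc ℓ) ∨ ∃ ℓ, N.kind i = CurveKind.closed ℓ := by
  have hunb : ¬(N.kind i = CurveKind.ray ∨ N.kind i = CurveKind.line) := by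
    intro hk
    obtain ⟨C, hC⟩ := hb.exists_norm_le
    have hmem : ∀ s : ℝ, 0 ≤ s → s ∈ N.domain i := by
      intro s hs
      rcases hk with hk | hk <;> simp [domain, hk, CurveKind.domain, hs]
    have h1 := hC _ ⟨0, hmem 0 le_rfl, rfl⟩
    have hC0 : 0 ≤ C := (norm_nonneg _).trans h1
    have hs := hmem (2 * C + 1) (by linarith)
    have h2 := hC _ ⟨2 * C + 1, hs, rfl⟩
    have h3 := curve_eq_of_unbounded hreg hshr hk hs
    have h4 : ‖((2 * C + 1 : ℝ) : ℂ) * N.tangent i 0‖ = 2 * C + 1 := by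
      rw [norm_mul, hreg.arclength i 0 (hmem 0 le_rfl), mul_one, Complex.norm_real,
        Real.norm_of_nonneg (by linarith)]
    have h5 := norm_sub_le (N.curve i (2 * C + 1)) (N.curve i 0)
    rw [h3, add_sub_cancel_left, h4, ← h3] at h5
    linarith
  cases hk : N.kind i with
  | arc ℓ => exact Or.inl ⟨ℓ, rfl⟩
  | ray => exact absurd (Or.inl hk) hunb
  | line => exact absurd (Or.inr hk) hunb
  | closed ℓ => exact Or.inr ⟨ℓ, rfl⟩

/-- The bounded curves of a shrinking network are polar graphs and radial segments. -/
theorem isPolar_or_isRadial (hreg : N.IsRegular) (hshr : N.IsShrinking) {i : ι}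
    (hb : Bornology.IsBounded (N.trace i)) :
    (∃ u ψ A B, N.IsPolar i u ψ A B) ∨ ∃ d a b, N.IsRadial i d a b := by
  rcases kind_of_isBounded hreg hshr hb with ⟨ℓ, hk⟩ | ⟨ℓ, hk⟩
  · exact isPolar_or_isRadial_of_arc hreg hshr hk
  · exact Or.inl (isPolar_of_closed hreg hshr hk)

end PlaneNetwork

/-! ### The sides of a curve with respect to an open set -/

section Frontier

variable {U : Set ℂ}

theorem subset_of_isPreconnected (hU : IsOpen U) {S : Set ℂ} (hS : IsPreconnected S)
    (hd : ∀ z ∈ S, z ∉ frontier U) (hmeet : (S ∩ U).Nonempty) : S ⊆ U := by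
  refine hS.subset_of_closure_inter_subset hU hmeet fun z hz => ?_
  by_contra hzU
  exact hd z hz.2 ⟨hz.1, by rwa [hU.interior_eq]⟩

theorem forall_mem_or_forall_notMem (hU : IsOpen U) {X : Type*} [TopologicalSpace X] {f : X → ℂ}
    {s : Set X} (hs : IsPreconnected s) (hf : ContinuousOn f s)
    (hd : ∀ x ∈ s, f x ∉ frontier U) : (∀ x ∈ s, f x ∈ U) ∨ ∀ x ∈ s, f x ∉ U := by
  by_cases h : ∃ x ∈ s, f x ∈ U
  · obtain ⟨x, hx, hxU⟩ := h
    left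
    have := subset_of_isPreconnected hU (hs.image f hf) (by rintro _ ⟨y, hy, rfl⟩; exact hd y hy)
      ⟨f x, ⟨x, hx, rfl⟩, hxU⟩
    exact fun y hy => this ⟨y, hy, rfl⟩
  · push Not at h
    exact Or.inr h

theorem exists_exit (hU : IsOpen U) {f : ℝ → ℂ} (hf : Continuous f) {x y : ℝ} (hxy : x ≤ y)
    (hx : f x ∈ U) (hy : f y ∉ U) :
    ∃ z ∈ Set.Ioc x y, f z ∈ frontier U ∧ ∀ w ∈ Set.Ico x z, f w ∈ U := by
  have hcomp : IsCompact (Set.Icc x y ∩ f ⁻¹' Uᶜ) :=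
    isCompact_Icc.inter_right (hU.isClosed_compl.preimage hf)
  obtain ⟨z, ⟨hz, hzU⟩, hmin⟩ := hcomp.exists_isLeast ⟨y, ⟨hxy, le_rfl⟩, hy⟩
  have hin : ∀ w ∈ Set.Ico x z, f w ∈ U := by
    intro w hw
    by_contra hwU
    exact absurd (hmin ⟨⟨hw.1, hw.2.le.trans hz.2⟩, hwU⟩) (not_le.2 hw.2)
  have hxz : x < z := lt_of_le_of_ne hz.1 (by rintro rfl; exact hzU hx)
  refine ⟨z, ⟨hxz, hz.2⟩, ⟨?_, by rwa [hU.interior_eq]⟩, hin⟩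
  refine mem_closure_of_tendsto (f := f) (b := 𝓝[<] z) (hf.tendsto z |>.mono_left nhdsWithin_le_nhds) ?_
  exact Filter.mem_of_superset (Ioo_mem_nhdsLT hxz) fun w hw => hin w ⟨hw.1.le, hw.2⟩

theorem exists_exit_outward (hU : IsOpen U) (hb : Bornology.IsBounded U) {x t : ℝ}
    (hx : polar x t ∈ U) :
    ∃ z, x < z ∧ polar z t ∈ frontier U ∧ ∀ w ∈ Set.Ico x z, polar w t ∈ U := by
  obtain ⟨C, hC⟩ := hb.exists_norm_le
  have hy : polar (max x C) t ∉ U := by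
    intro hm
    have h1 := hC _ hm
    rw [norm_polar] at h1
    have h2 := Real.add_one_le_exp (max x C)
    linarith [le_max_right x C]
  obtain ⟨z, hz, h1, h2⟩ := exists_exit hU (f := fun x => polar x t)
    (continuous_polar.comp (by fun_prop : Continuous fun x : ℝ => (x, t))) (le_max_left x C) hx hy
  exact ⟨z, hz.1, h1, h2⟩

/-- The origin sits at logarithmic radius `-∞`, so an inward ray leaves `U` because `0` is not in
its closure. -/
theorem exists_exit_inward (hU : IsOpen U) (h0 : (0 : ℂ) ∉ closure U) {x t : ℝ}
    (hx : polar x t ∈ U) :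
    ∃ z, z < x ∧ polar z t ∈ frontier U ∧ ∀ w ∈ Set.Ioc z x, polar w t ∈ U := by
  have hlim : Filter.Tendsto (fun y => polar y t) Filter.atBot (𝓝 0) := by
    rw [tendsto_zero_iff_norm_tendsto_zero]
    simp only [norm_polar]
    exact Real.tendsto_exp_atBot
  obtain ⟨y, hy, hyx⟩ := ((hlim.eventually (isClosed_closure.isOpen_compl.mem_nhds h0)).and
    (Filter.eventually_le_atBot x)).exists
  obtain ⟨z, hz, h1, h2⟩ := exists_exit hU (f := fun x => polar (-x) t)
    (continuous_polar.comp (by fun_prop : Continuous fun x : ℝ => (-x, t))) (neg_le_neg hyx)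
    (by simpa using hx) (by simpa using fun h => hy (subset_closure h))
  refine ⟨-z, by linarith [hz.1], h1, fun w hw => ?_⟩
  simpa using h2 (-w) ⟨by linarith [hw.2], by linarith [hw.1]⟩

end Frontier

/-- The points on the side of sign `σ` of the polar graph of `u` at `t` belong to `U`: the side
`-1` faces the origin. -/
def SideAt (U : Set ℂ) (u : ℝ → ℝ) (σ t : ℝ) : Prop :=
  ∀ᶠ x in 𝓝[>] (0 : ℝ), polar (u t + σ * x) t ∈ U

theorem sideAt_neg_of_exit {U : Set ℂ} {u : ℝ → ℝ} {x t : ℝ} (hx : x < u t)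
    (h : ∀ w ∈ Set.Ico x (u t), polar w t ∈ U) : SideAt U u (-1) t := by
  have : Set.Ioo 0 (u t - x) ∈ 𝓝[>] (0 : ℝ) := Ioo_mem_nhdsGT (by linarith)
  filter_upwards [this] with y hy
  exact h _ ⟨by linarith [hy.2], by linarith [hy.1]⟩

theorem sideAt_one_of_exit {U : Set ℂ} {u : ℝ → ℝ} {x t : ℝ} (hx : u t < x)
    (h : ∀ w ∈ Set.Ioc (u t) x, polar w t ∈ U) : SideAt U u 1 t := by
  have : Set.Ioo 0 (x - u t) ∈ 𝓝[>] (0 : ℝ) := Ioo_mem_nhdsGT (by linarith)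
  filter_upwards [this] with y hy
  exact h _ ⟨by linarith [hy.1], by linarith [hy.2]⟩

/-- The angle between the rotation about the start of a polar graph and the graph is positive. -/
theorem IsPolarShrinker.rotation_pos {u ψ : ℝ → ℝ} {A B : ℝ} (h : IsPolarShrinker u ψ A B)
    (hAB : A < B) : ∃ δ > 0, ∀ t ∈ Set.Ioo A B, t < A + δ →
      0 < Real.exp (u A - u t) * Real.sin (t - A) +
        Real.tan (ψ t) * (1 - Real.exp (u A - u t) * Real.cos (t - A)) := by
  have hAI : A ∈ Set.Icc A B := ⟨le_rfl, hAB.le⟩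
  have hu : HasDerivWithinAt u (Real.tan (ψ A)) (Set.Ioi A) A :=
    (h.hasDerivWithinAt_Ici ⟨le_rfl, hAB⟩).mono Set.Ioi_subset_Ici_self
  have he : HasDerivWithinAt (fun t => Real.exp (u A - u t)) _ (Set.Ioi A) A := (hu.const_sub (u A)).exp
  have hs : HasDerivWithinAt (fun t => Real.sin (t - A)) _ (Set.Ioi A) A :=
    ((hasDerivAt_id A).sub_const A).sin.hasDerivWithinAt
  have hc : HasDerivWithinAt (fun t => Real.cos (t - A)) _ (Set.Ioi A) A :=
    ((hasDerivAt_id A).sub_const A).cos.hasDerivWithinAt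
  have h1 := (hasDerivWithinAt_iff_tendsto_slope' (by simp)).1 (he.mul hs)
  have h2 := (hasDerivWithinAt_iff_tendsto_slope' (by simp)).1 ((he.mul hc).const_sub 1)
  have h3 : Filter.Tendsto (fun t => Real.tan (ψ t)) (𝓝[>] A) (𝓝 (Real.tan (ψ A))) := by
    refine (Real.continuousAt_tan.2 (h.cos_pos hAI).ne').tendsto.comp ?_
    exact (h.contψ A hAI).mono_of_mem_nhdsWithin (Filter.mem_of_superset (Ioo_mem_nhdsGT hAB)
      Set.Ioo_subset_Icc_self)
  have h4 := h1.add (h3.mul h2)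
  -- The expression vanishes at `t = A` and this is its right derivative there.
  have hpos : 0 < 1 + Real.tan (ψ A) ^ 2 := by positivity
  have h5 := h4.eventually (lt_mem_nhds (a := 0) (by
    simp only [id, sub_self, Real.exp_zero, Real.sin_zero, Real.cos_zero]
    nlinarith))
  obtain ⟨y, hy, hsub⟩ := mem_nhdsGT_iff_exists_Ioc_subset.1 h5
  refine ⟨y - A, sub_pos.2 hy, fun t ht hty => ?_⟩
  have h6 : t ∈ Set.Ioc A y := ⟨ht.1, by linarith⟩
  have h7 := hsub h6
  simp only [Set.mem_ofPred_eq, slope_def_field, Pi.mul_apply, sub_self, Real.exp_zero,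
    Real.sin_zero, Real.cos_zero, mul_zero, mul_one, sub_zero] at h7
  have h8 : 0 < t - A := sub_pos.2 ht.1
  rw [← mul_div_assoc, ← add_div] at h7
  exact (div_pos_iff_of_pos_right h8).1 h7

theorem IsPolarShrinker.rotation_neg {u ψ : ℝ → ℝ} {A B : ℝ} (h : IsPolarShrinker u ψ A B)
    (hAB : A < B) : ∃ δ > 0, ∀ t ∈ Set.Ioo A B, B - δ < t →
      Real.exp (u B - u t) * Real.sin (t - B) +
        Real.tan (ψ t) * (1 - Real.exp (u B - u t) * Real.cos (t - B)) < 0 := by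
  obtain ⟨δ, hδ, H⟩ := h.reflect.rotation_pos (neg_lt_neg hAB)
  refine ⟨δ, hδ, fun t ht hlt => ?_⟩
  have h1 := H (-t) ⟨by linarith [ht.2], by linarith [ht.1]⟩ (by linarith)
  have e1 : -t - -B = -(t - B) := by ring
  simp only [neg_neg] at h1
  rw [e1, Real.sin_neg, Real.cos_neg, Real.tan_neg] at h1
  linarith

namespace PlaneNetwork

variable {ι : Type*} {N : PlaneNetwork ι} {i j : ι} {u ψ : ℝ → ℝ} {A B : ℝ} {U : Set ℂ}

/-- Points near an interior point of a polar graph meet the frontier only on the graph. -/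
theorem IsPolar.exists_tube (h : N.IsPolar i u ψ A B) (hj : j ≠ i) (hcl : IsClosed (N.trace j))
    (hK : frontier U ⊆ N.trace i ∪ N.trace j) {t₀ : ℝ} (ht₀ : t₀ ∈ Set.Ioo A B) :
    ∃ δ > 0, ∀ t, |t - t₀| < δ → t ∈ Set.Ioo A B ∧
      ∀ x, |x| < δ → x ≠ 0 → polar (u t + x) t ∉ frontier U := by
  have hcont : ContinuousOn (fun t => polar (u t) t) (Set.Icc A B) :=
    continuous_polar.comp_continuousOn (h.sol.contU.prodMk continuousOn_id)
  -- `K` collects the other curve and the part of the graph at parameters at least `1` away from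
  -- `t₀`; it is closed and misses the given point.
  set K := N.trace j ∪ (fun t => polar (u t) t) '' (Set.Icc A B \ Set.Ioo (t₀ - 1) (t₀ + 1))
  have hKcl : IsClosed K := hcl.union
    ((isCompact_Icc.diff isOpen_Ioo).image_of_continuousOn (hcont.mono Set.sdiff_subset)).isClosed
  have h0 : polar (u t₀ + 0) t₀ ∉ K := by
    rw [add_zero]
    rintro (hm | ⟨t, ht, heq⟩)
    · exact h.disjoint t₀ ht₀ j hj hm
    · have := h.simple t₀ ht₀ t ht.1 heq.symm
      subst this
      exact ht.2 ⟨by linarith, by linarith⟩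
  have hca : ContinuousAt (fun p : ℝ × ℝ => polar (u p.1 + p.2) p.1) (t₀, 0) := by
    have h1 : ContinuousAt u t₀ := h.sol.contU.continuousAt (Icc_mem_nhds ht₀.1 ht₀.2)
    have h2 : ContinuousAt (fun p : ℝ × ℝ => u p.1) (t₀, 0) :=
      ContinuousAt.comp (f := Prod.fst) h1 continuousAt_fst
    exact ContinuousAt.comp (f := fun p : ℝ × ℝ => (u p.1 + p.2, p.1)) continuous_polar.continuousAt
      ((h2.add continuousAt_snd).prodMk continuousAt_fst)
  obtain ⟨ε, hε, hball⟩ := Metric.eventually_nhds_iff.1 (hca.eventually (hKcl.isOpen_compl.mem_nhds h0))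
  refine ⟨min (min ε 1) (min (t₀ - A) (B - t₀)), by
    have := ht₀.1; have := ht₀.2
    simp only [gt_iff_lt, lt_min_iff, sub_pos]
    exact ⟨⟨hε, one_pos⟩, ht₀⟩, fun t ht => ?_⟩
  simp only [lt_min_iff, abs_lt] at ht
  have htI : t ∈ Set.Ioo A B := ⟨by linarith [ht.2.1.1], by linarith [ht.2.2.2]⟩
  refine ⟨htI, fun x hx hx0 hfr => ?_⟩
  simp only [lt_min_iff] at hx
  have hnK : polar (u t + x) t ∉ K := by
    apply hball (y := (t, x))
    rw [Prod.dist_eq, max_lt_iff, Real.dist_eq, Real.dist_eq, sub_zero]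
    exact ⟨abs_lt.2 ht.1.1, hx.1.1⟩
  rcases hK hfr with hm | hm
  · rw [h.trace_eq] at hm
    obtain ⟨t', ht', heq⟩ := hm
    by_cases hnear : t' ∈ Set.Ioo (t₀ - 1) (t₀ + 1)
    · obtain ⟨h1, n, hn⟩ := polar_eq_iff.1 heq
      -- Within distance `1` of `t₀`, equality of angles modulo `2π` determines the parameter.
      have h2 : t' = t := by
        refine eq_of_exp_mul_I_eq ?_ ?_
        · have := polar_add_two_pi 0 t n
          rw [← hn] at this
          simpa [polar] using this
        · rw [abs_lt]
          have := Real.pi_gt_three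
          constructor <;> linarith [hnear.1, hnear.2, ht.1.2.1, ht.1.2.2]
      subst h2
      exact hx0 (by linarith)
    · exact hnK (Or.inr ⟨t', ⟨ht', hnear⟩, heq⟩)
  · exact hnK (Or.inl hm)

theorem IsPolar.tube_dichotomy (h : N.IsPolar i u ψ A B) (hj : j ≠ i) (hcl : IsClosed (N.trace j))
    (hU : IsOpen U) (hK : frontier U ⊆ N.trace i ∪ N.trace j) {σ : ℝ} (hσ : |σ| = 1) {t₀ : ℝ}
    (ht₀ : t₀ ∈ Set.Ioo A B) :
    ∃ δ > 0, ((∀ t x, |t - t₀| < δ → x ∈ Set.Ioo 0 δ → polar (u t + σ * x) t ∈ U) ∨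
      ∀ t x, |t - t₀| < δ → x ∈ Set.Ioo 0 δ → polar (u t + σ * x) t ∉ U) := by
  obtain ⟨δ, hδ, H⟩ := h.exists_tube hj hcl hK ht₀
  refine ⟨δ, hδ, ?_⟩
  have hmem : ∀ t, |t - t₀| < δ ↔ t ∈ Set.Ioo (t₀ - δ) (t₀ + δ) := by
    intro t
    rw [abs_lt, Set.mem_Ioo]
    constructor <;> rintro ⟨h1, h2⟩ <;> constructor <;> linarith
  have key := forall_mem_or_forall_notMem hU
    (f := fun p : ℝ × ℝ => polar (u p.1 + σ * p.2) p.1)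
    (s := Set.Ioo (t₀ - δ) (t₀ + δ) ×ˢ Set.Ioo 0 δ)
    (isPreconnected_Ioo.prod isPreconnected_Ioo) ?_ ?_
  · rcases key with h1 | h1
    · exact Or.inl fun t x ht hx => h1 (t, x) ⟨(hmem t).1 ht, hx⟩
    · exact Or.inr fun t x ht hx => h1 (t, x) ⟨(hmem t).1 ht, hx⟩
  · refine continuous_polar.comp_continuousOn (ContinuousOn.prodMk (ContinuousOn.add ?_ (by fun_prop))
      continuousOn_fst)
    exact h.sol.contU.comp continuousOn_fst fun p hp =>
      Set.Ioo_subset_Icc_self (H p.1 ((hmem _).2 hp.1)).1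
  · rintro ⟨t, x⟩ ⟨ht, hx⟩
    refine (H t ((hmem t).2 ht)).2 _ ?_ ?_
    · rw [abs_mul, hσ, one_mul, abs_of_pos hx.1]; exact hx.2
    · refine mul_ne_zero ?_ hx.1.ne'
      rw [← abs_pos, hσ]; exact one_pos

theorem sideAt_of_tube {σ δ t : ℝ} (hδ : 0 < δ)
    (H : ∀ x ∈ Set.Ioo 0 δ, polar (u t + σ * x) t ∈ U) : SideAt U u σ t :=
  Filter.mem_of_superset (Ioo_mem_nhdsGT hδ) H

theorem not_sideAt_of_tube {σ δ t : ℝ} (hδ : 0 < δ)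
    (H : ∀ x ∈ Set.Ioo 0 δ, polar (u t + σ * x) t ∉ U) : ¬SideAt U u σ t := by
  intro h
  obtain ⟨x, hx1, hx2⟩ := (h.and (Ioo_mem_nhdsGT hδ)).exists
  exact H x hx2 hx1

/-- The side of a curve on which `U` lies does not change along the curve. -/
theorem IsPolar.sideAt_congr (h : N.IsPolar i u ψ A B) (hj : j ≠ i) (hcl : IsClosed (N.trace j))
    (hU : IsOpen U) (hK : frontier U ⊆ N.trace i ∪ N.trace j) {σ : ℝ} (hσ : |σ| = 1) {t t' : ℝ}
    (ht : t ∈ Set.Ioo A B) (ht' : t' ∈ Set.Ioo A B) : SideAt U u σ t ↔ SideAt U u σ t' := by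
  refine (isPreconnected_Ioo (a := A) (b := B)).induction₂ (fun x y => SideAt U u σ x ↔ SideAt U u σ y)
    (fun t₀ ht₀ => ?_) (fun x y z _ _ _ h1 h2 => h1.trans h2) (fun x y _ _ h1 => h1.symm) ht ht'
  obtain ⟨δ, hδ, H⟩ := h.tube_dichotomy hj hcl hU hK hσ ht₀
  refine nhdsWithin_le_nhds ?_
  filter_upwards [Metric.ball_mem_nhds t₀ hδ] with y hy
  rw [Metric.mem_ball, Real.dist_eq] at hy
  have h0 : |t₀ - t₀| < δ := by simpa using hδ
  rcases H with H | H
  · exact ⟨fun _ => sideAt_of_tube hδ fun x hx => H y x hy hx,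
      fun _ => sideAt_of_tube hδ fun x hx => H t₀ x h0 hx⟩
  · exact ⟨fun h1 => absurd h1 (not_sideAt_of_tube hδ fun x hx => H t₀ x h0 hx),
      fun h1 => absurd h1 (not_sideAt_of_tube hδ fun x hx => H y x hy hx)⟩

/-- A path leaving a polar graph transversally runs into the corresponding side. -/
theorem IsPolar.side_of_path (h : N.IsPolar i u ψ A B) (hj : j ≠ i) (hcl : IsClosed (N.trace j))
    (hU : IsOpen U) (hK : frontier U ⊆ N.trace i ∪ N.trace j) {σ : ℝ} (hσ : |σ| = 1) {t₀ : ℝ}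
    (ht₀ : t₀ ∈ Set.Ioo A B) {L : ℝ → ℂ} {l : ℂ} (hL0 : L 0 = 0) (hL : HasDerivAt L l 0)
    (hsign : 0 < σ * (l.re - Real.tan (ψ t₀) * l.im)) :
    (SideAt U u σ t₀ → ∀ᶠ η : ℝ in 𝓝[>] 0,
      polar (u t₀ + (L η).re) (t₀ + (L η).im) ∈ U) ∧
    (¬SideAt U u σ t₀ → ∀ᶠ η : ℝ in 𝓝[>] 0,
      polar (u t₀ + (L η).re) (t₀ + (L η).im) ∉ U) := by
  obtain ⟨δ, hδ, H⟩ := h.tube_dichotomy hj hcl hU hK hσ ht₀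
  have hσ2 : σ * σ = 1 := by rw [← abs_mul_abs_self, hσ, one_mul]
  have hre : HasDerivAt (fun η => (L η).re) l.re 0 :=
    Complex.reCLM.hasFDerivAt.comp_hasDerivAt (0 : ℝ) hL
  have him : HasDerivAt (fun η => (L η).im) l.im 0 :=
    Complex.imCLM.hasFDerivAt.comp_hasDerivAt (0 : ℝ) hL
  -- The signed height of the path above the graph: it starts at `0` with positive derivative, so
  -- the path enters the tube on the side `σ`.
  have hX : HasDerivAt (fun η => σ * (u t₀ + (L η).re - u (t₀ + (L η).im)))
      (σ * (l.re - Real.tan (ψ t₀) * l.im)) 0 := by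
    have h1 : HasDerivAt (fun η => t₀ + (L η).im) l.im 0 := him.const_add t₀
    have h2 : HasDerivAt (fun η => u (t₀ + (L η).im)) (Real.tan (ψ t₀) * l.im) 0 := by
      refine HasDerivAt.comp (h₂ := u) (0 : ℝ) ?_ h1
      simp only [hL0, Complex.zero_im, add_zero]
      exact h.sol.derivU t₀ ht₀
    exact ((hre.const_add (u t₀)).sub h2).const_mul σ
  have hX0 : (fun η => σ * (u t₀ + (L η).re - u (t₀ + (L η).im))) 0 = 0 := by simp [hL0]
  obtain ⟨y, hy, hpos⟩ := exists_Ioc_pos_of_hasDerivAt_pos one_pos hX hX0 hsign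
  have e1 : ∀ᶠ η : ℝ in 𝓝[>] 0, 0 < σ * (u t₀ + (L η).re - u (t₀ + (L η).im)) :=
    Filter.mem_of_superset (Ioo_mem_nhdsGT hy.1) fun η hη => hpos η ⟨hη.1, hη.2.le⟩
  have e2 : ∀ᶠ η : ℝ in 𝓝[>] 0, σ * (u t₀ + (L η).re - u (t₀ + (L η).im)) < δ :=
    nhdsWithin_le_nhds (hX.continuousAt.eventually (gt_mem_nhds (by rw [hX0]; exact hδ)))
  have e3 : ∀ᶠ η : ℝ in 𝓝[>] 0, |t₀ + (L η).im - t₀| < δ := by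
    have hc : ContinuousAt (fun η => |t₀ + (L η).im - t₀|) 0 :=
      ((him.const_add t₀).sub_const t₀).continuousAt.abs
    exact nhdsWithin_le_nhds (hc.eventually (gt_mem_nhds (by simpa [hL0] using hδ)))
  have e4 : ∀ η, u (t₀ + (L η).im) + σ * (σ * (u t₀ + (L η).re - u (t₀ + (L η).im))) =
      u t₀ + (L η).re := fun η => by
    rw [← mul_assoc, hσ2]; ring
  have h0 : |t₀ - t₀| < δ := by simpa using hδ
  constructor
  · intro hside
    have H' := H.resolve_right fun H => not_sideAt_of_tube hδ (fun x hx => H t₀ x h0 hx) hside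
    filter_upwards [e1, e2, e3] with η h1 h2 h3
    have := H' _ _ h3 ⟨h1, h2⟩
    rwa [e4] at this
  · intro hside
    have H' := H.resolve_left fun H => hside (sideAt_of_tube hδ fun x hx => H t₀ x h0 hx)
    filter_upwards [e1, e2, e3] with η h1 h2 h3
    have := H' _ _ h3 ⟨h1, h2⟩
    rwa [e4] at this

/-- A rotation about a point `P'` multiplies `P` by `1 + (1 - P'/P)(w - 1)`; its logarithm is the
displacement in logarithmic polar coordinates. -/
theorem polar_rotation {x t x' t' : ℝ} {w : ℂ}
    (hw : 1 + (1 - polar (x' - x) (t' - t)) * (w - 1) ≠ 0) :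
    polar (x + (Complex.log (1 + (1 - polar (x' - x) (t' - t)) * (w - 1))).re)
      (t + (Complex.log (1 + (1 - polar (x' - x) (t' - t)) * (w - 1))).im) =
      polar x' t' + (polar x t - polar x' t') * w := by
  set L := Complex.log (1 + (1 - polar (x' - x) (t' - t)) * (w - 1)) with hL
  have h1 : polar (x + L.re) (t + L.im) = polar x t * Complex.exp L := by
    rw [polar, polar, ← Complex.exp_add]
    congr 1
    nth_rewrite 3 [← Complex.re_add_im L]
    push_cast
    ring
  have h2 : polar x t * polar (x' - x) (t' - t) = polar x' t' := by
    rw [polar, polar, polar, ← Complex.exp_add]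
    congr 1
    push_cast
    ring
  rw [h1, hL, Complex.exp_log hw]
  linear_combination (1 - w) * h2

/-- The rotated point starts with velocity `iτ (1 - P'/P)` in logarithmic polar coordinates; `hsign`
says that this is transversal to the graph, towards the side `σ`. -/
theorem IsPolar.side_of_rotation (h : N.IsPolar i u ψ A B) (hj : j ≠ i) (hcl : IsClosed (N.trace j))
    (hU : IsOpen U) (hK : frontier U ⊆ N.trace i ∪ N.trace j) {σ τ : ℝ} (hσ : |σ| = 1) {t₀ : ℝ}
    (ht₀ : t₀ ∈ Set.Ioo A B) {x' t' : ℝ}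
    (hsign : 0 < -(σ * τ) * (Real.exp (x' - u t₀) * Real.sin (t₀ - t') +
        Real.tan (ψ t₀) * (1 - Real.exp (x' - u t₀) * Real.cos (t₀ - t')))) :
    (SideAt U u σ t₀ → ∀ᶠ η : ℝ in 𝓝[>] 0,
      polar x' t' + (polar (u t₀) t₀ - polar x' t') * Complex.exp (τ * η * Complex.I) ∈ U) ∧
    (¬SideAt U u σ t₀ → ∀ᶠ η : ℝ in 𝓝[>] 0,
      polar x' t' + (polar (u t₀) t₀ - polar x' t') * Complex.exp (τ * η * Complex.I) ∉ U) := by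
  set q := 1 - polar (x' - u t₀) (t' - t₀) with hq
  have hqre : q.re = 1 - Real.exp (x' - u t₀) * Real.cos (t₀ - t') := by
    rw [hq, polar, Complex.sub_re, Complex.exp_re]
    simp only [Complex.one_re, Complex.add_re, Complex.ofReal_re, Complex.re_ofReal_mul,
      Complex.I_re, mul_zero, add_zero, Complex.add_im, Complex.ofReal_im, Complex.im_ofReal_mul,
      Complex.I_im, mul_one, zero_add]
    rw [← Real.cos_neg, neg_sub]
  have hqim : q.im = Real.exp (x' - u t₀) * Real.sin (t₀ - t') := by
    rw [hq, polar, Complex.sub_im, Complex.exp_im]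
    simp only [Complex.one_im, Complex.add_re, Complex.ofReal_re, Complex.re_ofReal_mul,
      Complex.I_re, mul_zero, add_zero, Complex.add_im, Complex.ofReal_im, Complex.im_ofReal_mul,
      Complex.I_im, mul_one, zero_add]
    rw [← neg_sub t₀ t', Real.sin_neg]
    ring
  set F : ℝ → ℂ := fun η => 1 + q * (Complex.exp (τ * η * Complex.I) - 1) with hF
  have hF0 : F 0 = 1 := by simp [hF]
  have hFd : HasDerivAt F (q * (τ * Complex.I)) 0 := by
    have h1 : HasDerivAt (fun η : ℝ => (τ * η * Complex.I : ℂ)) (τ * Complex.I) 0 := by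
      have := ((hasDerivAt_id (0 : ℝ)).ofReal_comp.const_mul (τ : ℂ)).mul_const Complex.I
      simpa using this
    have h2 := ((h1.cexp.sub_const 1).const_mul q).const_add 1
    exact h2.congr_deriv (by simp)
  have hLd : HasDerivAt (fun η => Complex.log (F η)) (q * (τ * Complex.I)) 0 := by
    have := hFd.clog_real (by rw [hF0]; exact Complex.one_mem_slitPlane)
    simpa [hF0] using this
  have hne : ∀ᶠ η : ℝ in 𝓝[>] 0, F η ≠ 0 :=
    nhdsWithin_le_nhds (hFd.continuousAt.eventually_ne (by rw [hF0]; exact one_ne_zero))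
  have hl : (q * (τ * Complex.I)).re = -(τ * q.im) ∧ (q * (τ * Complex.I)).im = τ * q.re := by
    constructor <;> simp <;> ring
  have key := h.side_of_path hj hcl hU hK hσ ht₀ (L := fun η => Complex.log (F η))
    (by simp [hF0]) hLd (by rw [hl.1, hl.2, hqre, hqim]; linarith)
  refine ⟨fun hs => ?_, fun hs => ?_⟩
  · filter_upwards [key.1 hs, hne] with η h1 h2
    rwa [polar_rotation h2] at h1
  · filter_upwards [key.2 hs, hne] with η h1 h2
    rwa [polar_rotation h2] at h1

/-- The points obtained by rotating the curve at the end `e` slightly about the end point, in the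
direction `τ`, belong to `U`. -/
def RotIn (N : PlaneNetwork ι) (U : Set ℂ) (e : ι × ℝ) (τ : ℝ) : Prop :=
  ∃ δ > 0, ∀ s ∈ Set.Ioo 0 δ, ∀ᶠ η : ℝ in 𝓝[>] 0,
    N.endPoint e + (N.arm e s - N.endPoint e) * Complex.exp (τ * η * Complex.I) ∈ U

/-- Passes from the sectors at the junction to a side along the whole graph. Near its start, turning
the curve counterclockwise moves it towards the origin (`rotation_pos`), hence the sign `-τ`; at the
finish it is `τ`. -/
theorem IsPolar.sideAt_start (h : N.IsPolar i u ψ A B) (hj : j ≠ i) (hcl : IsClosed (N.trace j))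
    (hU : IsOpen U) (hK : frontier U ⊆ N.trace i ∪ N.trace j) {τ : ℝ} (hτ : |τ| = 1) {e : ι × ℝ}
    (he : N.endPoint e = polar (u A) A)
    (harm : ∀ δ > 0, ∃ s ∈ Set.Ioo 0 δ, ∃ t ∈ Set.Ioo A B, t < A + δ ∧
      N.arm e s = polar (u t) t) {t : ℝ} (ht : t ∈ Set.Ioo A B) :
    (N.RotIn U e τ → SideAt U u (-τ) t) ∧ (N.RotIn Uᶜ e τ → ¬SideAt U u (-τ) t) := by
  have hστ : |(-τ)| = 1 := by rwa [abs_neg]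
  have hτ2 : τ * τ = 1 := by rw [← abs_mul_abs_self, hτ, one_mul]
  obtain ⟨δ₁, hδ₁, hrot⟩ := h.sol.rotation_pos h.lt
  have key : ∀ δ > 0, ∃ s ∈ Set.Ioo 0 δ, ∃ t₀ ∈ Set.Ioo A B, N.arm e s = polar (u t₀) t₀ ∧ _ :=
    fun δ hδ => by
      obtain ⟨s, hs, t₀, ht₀, hlt, heq⟩ := harm (min δ δ₁) (lt_min hδ hδ₁)
      refine ⟨s, ⟨hs.1, hs.2.trans_le (min_le_left _ _)⟩, t₀, ht₀, heq,
        h.side_of_rotation hj hcl hU hK hστ ht₀ (τ := τ) (x' := u A) (t' := A) ?_⟩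
      have h1 := hrot t₀ ht₀ (hlt.trans_le (add_le_add_right (min_le_right _ _) _))
      rw [show -(-τ * τ) = 1 by linarith, one_mul]
      exact h1
  constructor
  · rintro ⟨δ, hδ, hin⟩
    obtain ⟨s, hs, t₀, ht₀, heq, hk⟩ := key δ hδ
    rw [h.sideAt_congr hj hcl hU hK hστ ht ht₀]
    by_contra hn
    have h1 := hin s hs
    rw [he, heq] at h1
    obtain ⟨η, h2, h3⟩ := (h1.and (hk.2 hn)).exists
    exact h3 h2
  · rintro ⟨δ, hδ, hin⟩
    obtain ⟨s, hs, t₀, ht₀, heq, hk⟩ := key δ hδ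
    rw [h.sideAt_congr hj hcl hU hK hστ ht ht₀]
    intro hn
    have h1 := hin s hs
    rw [he, heq] at h1
    obtain ⟨η, h2, h3⟩ := (h1.and (hk.1 hn)).exists
    exact h2 h3

theorem IsPolar.sideAt_end (h : N.IsPolar i u ψ A B) (hj : j ≠ i) (hcl : IsClosed (N.trace j))
    (hU : IsOpen U) (hK : frontier U ⊆ N.trace i ∪ N.trace j) {τ : ℝ} (hτ : |τ| = 1) {e : ι × ℝ}
    (he : N.endPoint e = polar (u B) B)
    (harm : ∀ δ > 0, ∃ s ∈ Set.Ioo 0 δ, ∃ t ∈ Set.Ioo A B, B - δ < t ∧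
      N.arm e s = polar (u t) t) {t : ℝ} (ht : t ∈ Set.Ioo A B) :
    (N.RotIn U e τ → SideAt U u τ t) ∧ (N.RotIn Uᶜ e τ → ¬SideAt U u τ t) := by
  have hτ2 : τ * τ = 1 := by rw [← abs_mul_abs_self, hτ, one_mul]
  obtain ⟨δ₁, hδ₁, hrot⟩ := h.sol.rotation_neg h.lt
  have key : ∀ δ > 0, ∃ s ∈ Set.Ioo 0 δ, ∃ t₀ ∈ Set.Ioo A B, N.arm e s = polar (u t₀) t₀ ∧ _ :=
    fun δ hδ => by
      obtain ⟨s, hs, t₀, ht₀, hlt, heq⟩ := harm (min δ δ₁) (lt_min hδ hδ₁)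
      refine ⟨s, ⟨hs.1, hs.2.trans_le (min_le_left _ _)⟩, t₀, ht₀, heq,
        h.side_of_rotation hj hcl hU hK hτ ht₀ (τ := τ) (x' := u B) (t' := B) ?_⟩
      have h1 := hrot t₀ ht₀ (by linarith [min_le_right δ δ₁])
      rw [hτ2, neg_one_mul]
      linarith
  constructor
  · rintro ⟨δ, hδ, hin⟩
    obtain ⟨s, hs, t₀, ht₀, heq, hk⟩ := key δ hδ
    rw [h.sideAt_congr hj hcl hU hK hτ ht ht₀]
    by_contra hn
    have h1 := hin s hs
    rw [he, heq] at h1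
    obtain ⟨η, h2, h3⟩ := (h1.and (hk.2 hn)).exists
    exact h3 h2
  · rintro ⟨δ, hδ, hin⟩
    obtain ⟨s, hs, t₀, ht₀, heq, hk⟩ := key δ hδ
    rw [h.sideAt_congr hj hcl hU hK hτ ht ht₀]
    intro hn
    have h1 := hin s hs
    rw [he, heq] at h1
    obtain ⟨η, h2, h3⟩ := (h1.and (hk.1 hn)).exists
    exact h2 h3

end PlaneNetwork

/-! ### The three arms and the three sectors at a junction -/

theorem exists_norm_sub_id_le {h h' : ℝ → ℂ} {δ : ℝ} (hδ : 0 < δ)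
    (hd : ∀ s ∈ Set.Icc 0 δ, HasDerivWithinAt h (h' s) (Set.Icc 0 δ) s)
    (hc : ContinuousOn h' (Set.Icc 0 δ)) (h0 : h 0 = 0) (h1 : h' 0 = 1) :
    ∃ δ₁ > 0, δ₁ ≤ δ ∧ ∀ s ∈ Set.Icc 0 δ₁, ‖h' s - 1‖ ≤ 1 / 4 ∧ ‖h s - s‖ ≤ s / 4 := by
  have h0I : (0 : ℝ) ∈ Set.Icc 0 δ := ⟨le_rfl, hδ.le⟩
  obtain ⟨ε, hε, hball⟩ := Metric.continuousWithinAt_iff.1 (hc 0 h0I) (1 / 4) (by norm_num)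
  have hlt : 0 < min (ε / 2) δ := by positivity
  have hb : ∀ s ∈ Set.Icc 0 (min (ε / 2) δ), ‖h' s - 1‖ ≤ 1 / 4 := by
    intro s hs
    have h2 := hball (x := s) ⟨hs.1, hs.2.trans (min_le_right _ _)⟩ (by
      rw [Real.dist_eq, sub_zero, abs_of_nonneg hs.1]
      linarith [hs.2.trans (min_le_left _ _)])
    rw [h1, dist_eq_norm] at h2
    exact h2.le
  refine ⟨_, hlt, min_le_right _ _, fun s hs => ⟨hb s hs, ?_⟩⟩
  have hsub : Set.Icc 0 (min (ε / 2) δ) ⊆ Set.Icc 0 δ := Set.Icc_subset_Icc_right (min_le_right _ _)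
  have h3 := (convex_Icc (0 : ℝ) (min (ε / 2) δ)).norm_image_sub_le_of_norm_hasDerivWithin_le
    (f := fun s => h s - (s : ℂ)) (f' := fun s => h' s - 1) (C := 1 / 4)
    (fun x hx => ((hd x (hsub hx)).mono hsub).sub
      (Complex.ofRealCLM.hasFDerivAt.hasDerivAt.hasDerivWithinAt.congr_deriv (by simp)))
    hb ⟨le_rfl, hlt.le⟩ hs
  simp only [h0, Complex.ofReal_zero, sub_zero] at h3
  rw [Real.norm_of_nonneg hs.1] at h3
  linarith

theorem re_im_bounds {z : ℂ} {s : ℝ} (h : ‖z - s‖ ≤ s / 4) :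
    3 * s / 4 ≤ z.re ∧ |z.im| ≤ s / 4 := by
  have h1 := (Complex.abs_re_le_norm (z - s)).trans h
  have h2 := (Complex.abs_im_le_norm (z - s)).trans h
  simp only [Complex.sub_re, Complex.ofReal_re, Complex.sub_im, Complex.ofReal_im, sub_zero] at h1 h2
  exact ⟨by linarith [(abs_le.1 h1).1], h2⟩

theorem abs_arg_lt_of_bounds {z : ℂ} {s : ℝ} (hs : 0 < s) (h : ‖z - s‖ ≤ s / 4) :
    |Complex.arg z| < Real.pi / 6 := by
  obtain ⟨h1, h2⟩ := re_im_bounds h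
  have hre : 0 < z.re := by linarith
  have hn : 0 < ‖z‖ := hre.trans_le ((le_abs_self _).trans (Complex.abs_re_le_norm z))
  have hn2 : 3 * s / 4 ≤ ‖z‖ := h1.trans ((le_abs_self _).trans (Complex.abs_re_le_norm z))
  rw [Complex.arg_of_re_nonneg hre.le]
  have h3 : |z.im / ‖z‖| < 1 / 2 := by
    rw [abs_div, abs_of_pos hn, div_lt_iff₀ hn]; linarith
  rw [abs_lt] at h3 ⊢
  have hpi := Real.pi_pos
  constructor
  · rw [Real.lt_arcsin_iff_sin_lt ⟨by linarith, by linarith⟩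
      ⟨by linarith, by linarith⟩, Real.sin_neg, Real.sin_pi_div_six]
    linarith
  · rw [Real.arcsin_lt_iff_lt_sin ⟨by linarith, by linarith⟩
      ⟨by linarith, by linarith⟩, Real.sin_pi_div_six]
    linarith

theorem inner_pos_of_bounds {z a : ℂ} {s : ℝ} (hs : 0 < s) (h : ‖z - s‖ ≤ s / 4)
    (ha : ‖a - 1‖ ≤ 1 / 4) : 0 < inner ℝ z a := by
  obtain ⟨h5, h6⟩ := re_im_bounds h
  have h7 := (Complex.abs_re_le_norm _).trans ha
  have h8 := (Complex.abs_im_le_norm _).trans ha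
  simp only [Complex.sub_re, Complex.one_re, Complex.sub_im, Complex.one_im, sub_zero] at h7 h8
  have h9 : |z.im * a.im| ≤ s / 4 * (1 / 4) :=
    abs_mul z.im a.im ▸ mul_le_mul h6 h8 (abs_nonneg _) (by linarith)
  rw [abs_le] at h7 h9
  have h10 : 3 * s / 4 * (3 / 4) ≤ z.re * a.re :=
    mul_le_mul h5 (by linarith [h7.1]) (by norm_num) (by linarith)
  rw [Complex.inner, Complex.mul_re, Complex.conj_re, Complex.conj_im]
  linarith [h9.1]

/-- Near its starting point, a `C¹` arc is a graph over the distance to this point. -/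
theorem exists_arm_polar {α α' : ℝ → ℂ} {P d : ℂ} {δ : ℝ} (hδ : 0 < δ)
    (hd : ∀ s ∈ Set.Icc 0 δ, HasDerivWithinAt α (α' s) (Set.Icc 0 δ) s)
    (hc : ContinuousOn α' (Set.Icc 0 δ)) (h0 : α 0 = P) (h1 : α' 0 = d) (hn : ‖d‖ = 1) :
    ∃ δ₁ > 0, δ₁ ≤ δ ∧ ∃ r > 0, ∃ θ : ℝ → ℝ, ContinuousOn θ (Set.Ioo 0 r) ∧
      (∀ ρ ∈ Set.Ioo 0 r, |θ ρ| < Real.pi / 6 ∧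
        ∃ s ∈ Set.Ioo 0 δ₁, α s = P + ρ * d * Complex.exp (θ ρ * Complex.I)) ∧
      ∀ s ∈ Set.Ioo 0 δ₁, ∃ ρ ∈ Set.Ioo 0 r, α s = P + ρ * d * Complex.exp (θ ρ * Complex.I) := by
  have hdd : d * star d = 1 := by
    have := Complex.mul_conj' d
    rw [hn] at this
    simpa using this
  set h : ℝ → ℂ := fun s => (α s - P) * star d with hh
  have hαh : ∀ s, α s = P + d * h s := fun s => by
    rw [hh]; linear_combination -(α s - P) * hdd
  obtain ⟨δ₁, hδ₁, hle, hb⟩ := exists_norm_sub_id_le (h := h) (h' := fun s => α' s * star d) hδ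
    (fun s hs => ((hd s hs).sub_const P).mul_const _) (hc.mul continuousOn_const)
    (by simp [hh, h0]) (by simp only [h1, hdd])
  have hsub : Set.Icc 0 δ₁ ⊆ Set.Icc 0 δ := Set.Icc_subset_Icc_right hle
  have hhd : ∀ s ∈ Set.Icc 0 δ₁, HasDerivWithinAt h (α' s * star d) (Set.Icc 0 δ₁) s :=
    fun s hs => (((hd s (hsub hs)).mono hsub).sub_const P).mul_const _
  have hhc : ContinuousOn h (Set.Icc 0 δ₁) := fun s hs => (hhd s hs).continuousWithinAt
  -- The distance to the starting point increases strictly along the arc, so it can serve as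
  -- parameter.
  have hmono2 : StrictMonoOn (fun s => ‖h s‖ ^ 2) (Set.Icc 0 δ₁) := by
    refine strictMonoOn_of_deriv_pos (convex_Icc _ _) (hhc.norm.pow 2) fun s hs => ?_
    rw [interior_Icc] at hs
    have hsI := Set.Ioo_subset_Icc_self hs
    have h2 := ((hhd s hsI).hasDerivAt (Icc_mem_nhds hs.1 hs.2)).norm_sq
    rw [h2.deriv]
    exact mul_pos two_pos (inner_pos_of_bounds hs.1 (hb s hsI).2 (hb s hsI).1)
  have hmono : StrictMonoOn (fun s => ‖h s‖) (Set.Icc 0 δ₁) := fun x hx y hy hxy =>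
    lt_of_pow_lt_pow_left₀ 2 (norm_nonneg _) (hmono2 hx hy hxy)
  have h0I : (0 : ℝ) ∈ Set.Icc 0 δ₁ := ⟨le_rfl, hδ₁.le⟩
  have h1I : δ₁ ∈ Set.Icc 0 δ₁ := ⟨hδ₁.le, le_rfl⟩
  have hN0 : ‖h 0‖ = 0 := by simp [hh, h0]
  have hsurj : ∀ ρ ∈ Set.Ioo 0 ‖h δ₁‖, ∃ s ∈ Set.Ioo 0 δ₁, ‖h s‖ = ρ := fun ρ hρ =>
    intermediate_value_Ioo hδ₁.le hhc.norm (by rwa [hN0])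
  have hmaps : ∀ s ∈ Set.Ioo 0 δ₁, ‖h s‖ ∈ Set.Ioo 0 ‖h δ₁‖ := fun s hs =>
    ⟨hN0 ▸ hmono h0I (Set.Ioo_subset_Icc_self hs) hs.1, hmono (Set.Ioo_subset_Icc_self hs) h1I hs.2⟩
  choose! τ hτ hτN using hsurj
  have hτh : ∀ s ∈ Set.Ioo 0 δ₁, τ ‖h s‖ = s := fun s hs =>
    hmono.injOn (Set.Ioo_subset_Icc_self (hτ _ (hmaps s hs))) (Set.Ioo_subset_Icc_self hs)
      (hτN _ (hmaps s hs))
  have hτmono : MonotoneOn τ (Set.Ioo 0 ‖h δ₁‖) := by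
    intro x hx y hy hxy
    by_contra! hlt
    have := hmono (Set.Ioo_subset_Icc_self (hτ y hy)) (Set.Ioo_subset_Icc_self (hτ x hx)) hlt
    simp only [hτN x hx, hτN y hy] at this
    linarith
  have hτc : ∀ ρ ∈ Set.Ioo 0 ‖h δ₁‖, ContinuousAt τ ρ := fun ρ hρ => by
    refine continuousAt_of_monotoneOn_of_image_mem_nhds hτmono (Ioo_mem_nhds hρ.1 hρ.2) ?_
    refine Filter.mem_of_superset (Ioo_mem_nhds (hτ ρ hρ).1 (hτ ρ hρ).2) fun s hs => ?_
    exact ⟨‖h s‖, hmaps s hs, hτh s hs⟩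
  have hform : ∀ ρ ∈ Set.Ioo 0 ‖h δ₁‖,
      α (τ ρ) = P + ρ * d * Complex.exp (Complex.arg (h (τ ρ)) * Complex.I) := fun ρ hρ => by
    rw [hαh]
    nth_rewrite 1 [← Complex.norm_mul_exp_arg_mul_I (h (τ ρ))]
    rw [hτN ρ hρ]
    ring
  refine ⟨δ₁, hδ₁, hle, ‖h δ₁‖, hN0 ▸ hmono h0I h1I hδ₁, fun ρ => Complex.arg (h (τ ρ)), ?_,
    fun ρ hρ => ⟨abs_arg_lt_of_bounds (hτ ρ hρ).1 (hb _ (Set.Ioo_subset_Icc_self (hτ ρ hρ))).2,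
      τ ρ, hτ ρ hρ, hform ρ hρ⟩, fun s hs => ⟨‖h s‖, hmaps s hs, ?_⟩⟩
  · intro ρ hρ
    refine ContinuousAt.continuousWithinAt ?_
    have hs := hτ ρ hρ
    have h2 : ContinuousAt h (τ ρ) := (hhd _ (Set.Ioo_subset_Icc_self hs)).continuousWithinAt.continuousAt
      (Icc_mem_nhds hs.1 hs.2)
    have h3 := (re_im_bounds (hb _ (Set.Ioo_subset_Icc_self hs)).2).1
    have h4 : h (τ ρ) ∈ Complex.slitPlane := Complex.mem_slitPlane_iff.2 (Or.inl (by linarith [hs.1]))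
    exact ContinuousAt.comp (f := h ∘ τ) (Complex.continuousAt_arg h4) (h2.comp (hτc ρ hρ))
  · have := hform _ (hmaps s hs)
    rw [hτh s hs] at this
    simp only [hτh s hs]
    exact this

/-- The point at distance `ρ` from `P`, at the angle `θ` with the direction `d`. -/
noncomputable def starPoint (P d : ℂ) (ρ θ : ℝ) : ℂ := P + ρ * d * Complex.exp (θ * Complex.I)

theorem norm_starPoint_sub {P d : ℂ} (hd : ‖d‖ = 1) {ρ : ℝ} (hρ : 0 < ρ) (θ : ℝ) :
    ‖starPoint P d ρ θ - P‖ = ρ := by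
  rw [starPoint, add_sub_cancel_left, norm_mul, norm_mul, hd, Complex.norm_exp_ofReal_mul_I,
    mul_one, mul_one, Complex.norm_real, Real.norm_of_nonneg hρ.le]

theorem starPoint_add_two_pi (P d : ℂ) (ρ θ : ℝ) :
    starPoint P d ρ (θ + 2 * Real.pi) = starPoint P d ρ θ := by
  rw [starPoint, starPoint]
  push_cast
  rw [add_mul, Complex.exp_periodic]

theorem starPoint_inj {P d : ℂ} (hd : ‖d‖ = 1) {ρ : ℝ} (hρ : 0 < ρ) {θ θ' : ℝ}
    (h : starPoint P d ρ θ = starPoint P d ρ θ') (hlt : |θ - θ'| < 2 * Real.pi) : θ = θ' := by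
  have hd0 : d ≠ 0 := by rw [← norm_pos_iff, hd]; exact one_pos
  have hρ0 : (ρ : ℂ) ≠ 0 := by exact_mod_cast hρ.ne'
  exact eq_of_exp_mul_I_eq (mul_left_cancel₀ (mul_ne_zero hρ0 hd0) (add_left_cancel h)) hlt

theorem continuous_starPoint (P d : ℂ) : Continuous fun p : ℝ × ℝ => starPoint P d p.1 p.2 := by
  unfold starPoint; fun_prop

theorem starPoint_rotate (P d : ℂ) (ρ θ η : ℝ) :
    P + (starPoint P d ρ θ - P) * Complex.exp (η * Complex.I) = starPoint P d ρ (θ + η) := by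
  rw [starPoint, starPoint, add_sub_cancel_left, mul_assoc _ (Complex.exp _), ← Complex.exp_add]
  push_cast
  rw [add_mul]

theorem exists_starPoint {P d : ℂ} (hd : ‖d‖ = 1) (z : ℂ) (β : ℝ) :
    ∃ θ ∈ Set.Ico β (β + 2 * Real.pi), z = starPoint P d ‖z - P‖ θ := by
  have hd0 : d ≠ 0 := by rw [← norm_pos_iff, hd]; exact one_pos
  have hpi := Real.pi_pos
  obtain ⟨n, hn, -⟩ := existsUnique_add_zsmul_mem_Ico (by linarith : 0 < 2 * Real.pi)
    (Complex.arg ((z - P) / d)) β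
  refine ⟨_, hn, ?_⟩
  have h1 := Complex.norm_mul_exp_arg_mul_I ((z - P) / d)
  rw [norm_div, hd, div_one] at h1
  have h2 : Complex.exp ((Complex.arg ((z - P) / d) + n • (2 * Real.pi) : ℝ) * Complex.I) =
      Complex.exp (Complex.arg ((z - P) / d) * Complex.I) := by
    have := Complex.exp_periodic.int_mul n (Complex.arg ((z - P) / d) * Complex.I)
    rw [← this]
    congr 1
    push_cast [zsmul_eq_mul]
    ring
  rw [starPoint, h2, mul_right_comm, h1, div_mul_cancel₀ _ hd0]
  ring

/-- The sector between two graphs over the radius is the continuous image of a rectangle, hence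
connected. -/
theorem sector_dichotomy {U : Set ℂ} (hU : IsOpen U) {P d : ℂ} {r : ℝ} {a b : ℝ → ℝ}
    (ha : ContinuousOn a (Set.Ioo 0 r)) (hb : ContinuousOn b (Set.Ioo 0 r))
    (hab : ∀ ρ ∈ Set.Ioo 0 r, a ρ < b ρ)
    (hfr : ∀ ρ ∈ Set.Ioo 0 r, ∀ θ ∈ Set.Ioo (a ρ) (b ρ), starPoint P d ρ θ ∉ frontier U) :
    (∀ ρ ∈ Set.Ioo 0 r, ∀ θ ∈ Set.Ioo (a ρ) (b ρ), starPoint P d ρ θ ∈ U) ∨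
      ∀ ρ ∈ Set.Ioo 0 r, ∀ θ ∈ Set.Ioo (a ρ) (b ρ), starPoint P d ρ θ ∉ U := by
  have key := forall_mem_or_forall_notMem hU
    (f := fun p : ℝ × ℝ => starPoint P d p.1 (a p.1 + p.2 * (b p.1 - a p.1)))
    (s := Set.Ioo 0 r ×ˢ Set.Ioo 0 1) (isPreconnected_Ioo.prod isPreconnected_Ioo) ?_ ?_
  · have hrep : ∀ ρ ∈ Set.Ioo 0 r, ∀ θ ∈ Set.Ioo (a ρ) (b ρ), ∃ x ∈ Set.Ioo (0 : ℝ) 1,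
        θ = a ρ + x * (b ρ - a ρ) := fun ρ hρ θ hθ => by
      have h1 := sub_pos.2 (hab ρ hρ)
      refine ⟨(θ - a ρ) / (b ρ - a ρ), ⟨div_pos (sub_pos.2 hθ.1) h1, ?_⟩, ?_⟩
      · rw [div_lt_one h1]; linarith [hθ.2]
      · field_simp; ring
    rcases key with h | h
    · refine Or.inl fun ρ hρ θ hθ => ?_
      obtain ⟨x, hx, rfl⟩ := hrep ρ hρ θ hθ
      exact h (ρ, x) ⟨hρ, hx⟩
    · refine Or.inr fun ρ hρ θ hθ => ?_
      obtain ⟨x, hx, rfl⟩ := hrep ρ hρ θ hθ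
      exact h (ρ, x) ⟨hρ, hx⟩
  · have h1 : ContinuousOn (fun p : ℝ × ℝ => a p.1) (Set.Ioo 0 r ×ˢ Set.Ioo 0 1) :=
      ha.comp continuousOn_fst fun p hp => hp.1
    have h2 : ContinuousOn (fun p : ℝ × ℝ => b p.1) (Set.Ioo 0 r ×ˢ Set.Ioo 0 1) :=
      hb.comp continuousOn_fst fun p hp => hp.1
    exact (continuous_starPoint P d).comp_continuousOn
      (continuousOn_fst.prodMk (h1.add (continuousOn_snd.mul (h2.sub h1))))
  · rintro ⟨ρ, x⟩ ⟨hρ, hx⟩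
    have h1 := sub_pos.2 (hab ρ hρ)
    have h2 := mul_pos hx.1 h1
    have h3 := mul_lt_mul_of_pos_right hx.2 h1
    exact hfr ρ hρ _ ⟨by linarith, by linarith⟩

theorem starPoint_mem_closure {U : Set ℂ} {P d : ℂ} {ρ a b : ℝ} (hab : a < b)
    (h : ∀ θ ∈ Set.Ioo a b, starPoint P d ρ θ ∈ U) :
    starPoint P d ρ a ∈ closure U ∧ starPoint P d ρ b ∈ closure U := by
  have hc : Continuous fun θ : ℝ => starPoint P d ρ θ :=
    (continuous_starPoint P d).comp (by fun_prop : Continuous fun θ : ℝ => (ρ, θ))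
  exact ⟨mem_closure_of_tendsto (b := 𝓝[>] a) (hc.tendsto a |>.mono_left nhdsWithin_le_nhds)
      (Filter.mem_of_superset (Ioo_mem_nhdsGT hab) h),
    mem_closure_of_tendsto (b := 𝓝[<] b) (hc.tendsto b |>.mono_left nhdsWithin_le_nhds)
      (Filter.mem_of_superset (Ioo_mem_nhdsLT hab) h)⟩

/-- The rotation by `120` degrees. -/
noncomputable def rot120 : ℂ := Complex.exp ((2 * Real.pi / 3 : ℝ) * Complex.I)

theorem rot120_cube : rot120 * rot120 * rot120 = 1 := by
  rw [rot120, ← Complex.exp_add, ← Complex.exp_add, ← Complex.exp_two_pi_mul_I]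
  congr 1
  push_cast
  ring

theorem eq_rot120_mul_of_angle {x y : ℂ} (hx : ‖x‖ = 1) (hy : ‖y‖ = 1)
    (h : InnerProductGeometry.angle x y = 2 * Real.pi / 3) : y = rot120 * x ∨ x = rot120 * y := by
  have hx0 : x ≠ 0 := by rw [← norm_pos_iff, hx]; exact one_pos
  have hy0 : y ≠ 0 := by rw [← norm_pos_iff, hy]; exact one_pos
  rw [Complex.angle_eq_abs_arg hx0 hy0] at h
  have h1 := Complex.norm_mul_exp_arg_mul_I (x / y)
  rw [norm_div, hx, hy, div_one, Complex.ofReal_one, one_mul] at h1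
  have hpi := Real.pi_pos
  rcases (abs_eq (by linarith)).1 h with h2 | h2
  · right
    rw [h2] at h1
    rw [rot120, h1, div_mul_cancel₀ _ hy0]
  · left
    rw [h2] at h1
    have h3 : rot120 * (x / y) = 1 := by
      rw [rot120, ← h1, ← Complex.exp_add, ← Complex.exp_zero]
      congr 1
      push_cast
      ring
    field_simp at h3
    exact h3.symm

namespace PlaneNetwork

variable {ι : Type*} {N : PlaneNetwork ι} {i j : ι} {U : Set ℂ}

theorem IsRegular.exists_arm (hreg : N.IsRegular) {e : ι × ℝ} (he : e ∈ N.curveEnds) :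
    ∃ ℓ > 0, ∃ α' : ℝ → ℂ,
      (∀ s ∈ Set.Icc 0 ℓ, HasDerivWithinAt (N.arm e) (α' s) (Set.Icc 0 ℓ) s) ∧
      ContinuousOn α' (Set.Icc 0 ℓ) ∧ N.arm e 0 = N.endPoint e ∧ α' 0 = N.endTangent e ∧
      ‖N.endTangent e‖ = 1 ∧ N.endPoint e ∈ N.trace e.1 ∧
      ∀ s ∈ Set.Ioo 0 ℓ, N.arm e s ∈ N.trace e.1 ∧ ∀ k, N.arm e s ∈ N.trace k → k = e.1 := by
  obtain ⟨i, p⟩ := e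
  have hTc := (hreg.contDiffOn_tangent i).continuousOn
  have hgen : ∀ ℓ > 0, Set.Icc 0 ℓ ⊆ N.domain i → p = 0 →
      (∀ s ∈ Set.Ioo 0 ℓ, s ∉ (N.kind i).ends) → ∃ ℓ > 0, ∃ α' : ℝ → ℂ,
      (∀ s ∈ Set.Icc 0 ℓ, HasDerivWithinAt (N.arm (i, p)) (α' s) (Set.Icc 0 ℓ) s) ∧
      ContinuousOn α' (Set.Icc 0 ℓ) ∧ N.arm (i, p) 0 = N.endPoint (i, p) ∧
      α' 0 = N.endTangent (i, p) ∧
      ‖N.endTangent (i, p)‖ = 1 ∧ N.endPoint (i, p) ∈ N.trace i ∧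
      ∀ s ∈ Set.Ioo 0 ℓ, N.arm (i, p) s ∈ N.trace i ∧ ∀ k, N.arm (i, p) s ∈ N.trace k → k = i := by
    rintro ℓ hℓ hsub rfl hends
    have h0 : (0 : ℝ) ∈ N.domain i := hsub ⟨le_rfl, hℓ.le⟩
    have ha : N.arm (i, 0) = N.curve i := by ext s; simp [arm]
    have ht : N.endTangent (i, 0) = N.tangent i 0 := by simp [endTangent]
    rw [ha, ht]
    refine ⟨ℓ, hℓ, N.tangent i, fun s hs => (hreg.hasDerivWithinAt_curve (hsub hs)).mono hsub,
      hTc.mono hsub, rfl, rfl, hreg.arclength i 0 h0, ⟨0, h0, rfl⟩, fun s hs => ?_⟩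
    have hsD := hsub (Set.Ioo_subset_Icc_self hs)
    refine ⟨⟨s, hsD, rfl⟩, ?_⟩
    rintro k ⟨t, ht, heq⟩
    exact (hreg.embedded i k s t hsD (hends s hs) ht heq.symm).1.symm
  have hp : p ∈ (N.kind i).ends := he
  cases hk : N.kind i with
  | arc ℓ =>
    have hℓ : 0 < ℓ := by have := hreg.admissible i; rwa [hk] at this
    have hdom : N.domain i = Set.Icc 0 ℓ := by rw [domain, hk]; rfl
    have hends : ∀ s ∈ Set.Ioo 0 ℓ, s ∉ (N.kind i).ends := by
      intro s hs
      rw [hk]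
      simp only [CurveKind.ends, Set.mem_insert_iff, Set.mem_singleton_iff]
      rintro (rfl | rfl)
      · exact hs.1.false
      · exact hs.2.false
    rw [hk] at hp
    rcases hp with rfl | rfl
    · exact hgen ℓ hℓ hdom.ge rfl hends
    · have hrev : ∀ s ∈ Set.Icc 0 p, p - s ∈ N.domain i := fun s hs => by
        rw [hdom]; exact ⟨by linarith [hs.2], by linarith [hs.1]⟩
      have ha : N.arm (i, p) = fun s => N.curve i (p - s) := by ext s; simp [arm, hℓ.ne']
      have ht : N.endTangent (i, p) = -N.tangent i p := by simp [endTangent, hℓ.ne']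
      have hpD : p ∈ N.domain i := by rw [hdom]; exact ⟨hℓ.le, le_rfl⟩
      rw [ha, ht]
      refine ⟨p, hℓ, fun s => -N.tangent i (p - s), fun s hs => ?_, ?_, by simp [endPoint],
        by simp, by rw [norm_neg]; exact hreg.arclength i p hpD, ⟨p, hpD, rfl⟩, fun s hs => ?_⟩
      · have h1 : HasDerivWithinAt (fun s : ℝ => p - s) (-1) (Set.Icc 0 p) s :=
          ((hasDerivAt_id s).const_sub p).hasDerivWithinAt
        have := (hreg.hasDerivWithinAt_curve (hrev s hs)).scomp s h1 hrev
        exact this.congr_deriv (by simp)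
      · exact (hTc.comp (by fun_prop) hrev).neg
      · have hsD := hrev s (Set.Ioo_subset_Icc_self hs)
        refine ⟨⟨p - s, hsD, rfl⟩, ?_⟩
        rintro k ⟨t, ht, heq⟩
        exact (hreg.embedded i k (p - s) t hsD
          (hends _ ⟨by linarith [hs.2], by linarith [hs.1]⟩) ht heq.symm).1.symm
  | ray =>
    rw [hk] at hp
    refine hgen 1 one_pos (fun x hx => ?_) hp (fun s hs => ?_)
    · simp only [domain, hk, CurveKind.domain, Set.mem_Ici]; exact hx.1
    · simp [hk, CurveKind.ends, hs.1.ne']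
  | line => rw [hk] at hp; exact hp.elim
  | closed ℓ => rw [hk] at hp; exact hp.elim

/-- After removal of short arms at the junction, what is left of a bounded curve is compact and
misses the junction, hence keeps a positive distance from it. -/
theorem IsRegular.exists_ball_trace (hreg : N.IsRegular)
    (hi : (∃ ℓ, N.kind i = CurveKind.arc ℓ) ∨ ∃ ℓ, N.kind i = CurveKind.closed ℓ) {e : ι × ℝ}
    (he : e ∈ N.curveEnds) {δ : ℝ} (hδ : 0 < δ) :
    ∃ r > 0, ∀ z ∈ N.trace i, ‖z - N.endPoint e‖ < r → z = N.endPoint e ∨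
      ∃ e' ∈ N.curveEnds, e'.1 = i ∧ N.endPoint e' = N.endPoint e ∧ ∃ s ∈ Set.Ioo 0 δ,
        z = N.arm e' s := by
  have hcont : ContinuousOn (N.curve i) (N.domain i) := (hreg.contDiffOn i).continuousOn
  have heD : e.2 ∈ N.domain e.1 := by
    have h1 : e.2 ∈ (N.kind e.1).ends := he
    have h2 := hreg.admissible e.1
    unfold domain
    cases hk : N.kind e.1 with
    | arc ℓ =>
      rw [hk] at h1 h2
      have h3 : 0 < ℓ := h2
      rcases h1 with h1 | h1 <;> rw [h1]
      · exact ⟨le_rfl, h3.le⟩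
      · exact ⟨h3.le, le_rfl⟩
    | ray =>
      rw [hk] at h1
      exact Set.mem_Ici.2 (Set.mem_singleton_iff.1 h1).ge
    | line => rw [hk] at h1; exact h1.elim
    | closed ℓ => rw [hk] at h1; exact h1.elim
  have hnot : ∀ s ∈ N.domain i, s ∉ (N.kind i).ends → N.curve i s ≠ N.endPoint e := by
    intro s hs hse heq
    obtain ⟨h1, h2⟩ := hreg.embedded i e.1 s e.2 hs hse heD heq
    have h3 : e.2 ∈ (N.kind i).ends := by rw [h1]; exact he
    cases hk : N.kind i <;> rw [hk] at h2 h3 hse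
    · exact hse (by have h4 : s = e.2 := h2; rwa [h4])
    · exact hse (by have h4 : s = e.2 := h2; rwa [h4])
    · exact h3
    · exact h3
  have hsep : ∀ C : Set ℂ, IsClosed C → N.endPoint e ∉ C → ∃ r > 0, ∀ z ∈ C, r ≤ ‖z - N.endPoint e‖ := by
    intro C hC hP
    obtain ⟨r, hr, hball⟩ := Metric.isOpen_iff.1 hC.isOpen_compl _ hP
    refine ⟨r, hr, fun z hz => ?_⟩
    by_contra! hlt
    exact hball (by rwa [Metric.mem_ball, dist_eq_norm]) hz
  rcases hi with ⟨ℓ, hk⟩ | ⟨ℓ, hk⟩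
  · have hℓ : 0 < ℓ := by have := hreg.admissible i; rwa [hk] at this
    have hdom : N.domain i = Set.Icc 0 ℓ := by rw [domain, hk]; rfl
    have hends : ∀ s, (i, s) ∈ N.curveEnds ↔ s = 0 ∨ s = ℓ := by
      intro s
      simp [curveEnds, hk, CurveKind.ends]
    set R : Set ℝ := (Set.Icc 0 ℓ ∩ {s | N.curve i 0 = N.endPoint e → δ ≤ s}) ∩
      {s | N.curve i ℓ = N.endPoint e → δ ≤ ℓ - s} with hR
    have hRc : IsCompact R := by
      refine (isCompact_Icc.inter_right ?_).inter_right ?_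
      · by_cases h : N.curve i 0 = N.endPoint e
        · simpa [h] using isClosed_le continuous_const continuous_id
        · simp [h]
      · by_cases h : N.curve i ℓ = N.endPoint e
        · simpa [h] using isClosed_le continuous_const (continuous_const.sub continuous_id)
        · simp [h]
    obtain ⟨r, hr, hrC⟩ := hsep (N.curve i '' R)
      (hRc.image_of_continuousOn (hcont.mono fun s hs => hdom ▸ hs.1.1)).isClosed (by
        rintro ⟨s, hs, heq⟩
        by_cases hse : s = 0 ∨ s = ℓ
        · rcases hse with rfl | rfl
          · exact absurd (hs.1.2 heq) (not_le.2 hδ)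
          · have := hs.2 heq
            rw [sub_self] at this
            exact absurd this (not_le.2 hδ)
        · refine hnot s (hdom ▸ hs.1.1) ?_ heq
          rw [hk]
          simpa [CurveKind.ends] using hse)
    refine ⟨r, hr, ?_⟩
    rintro z ⟨s, hs, rfl⟩ hz
    rw [hdom] at hs
    have hsR : s ∉ R := fun h => absurd (hrC _ ⟨s, h, rfl⟩) (not_le.2 hz)
    by_cases h1 : N.curve i 0 = N.endPoint e ∧ s < δ
    · rcases hs.1.eq_or_lt with rfl | hpos
      · exact Or.inl h1.1
      · exact Or.inr ⟨(i, 0), (hends 0).2 (Or.inl rfl), rfl, h1.1, s, ⟨hpos, h1.2⟩, by simp [arm]⟩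
    · by_cases h2 : N.curve i ℓ = N.endPoint e ∧ ℓ - s < δ
      · rcases hs.2.eq_or_lt with rfl | hpos
        · exact Or.inl h2.1
        · exact Or.inr ⟨(i, ℓ), (hends ℓ).2 (Or.inr rfl), rfl, h2.1, ℓ - s,
            ⟨by linarith, h2.2⟩, by simp [arm, hℓ.ne']⟩
      · push Not at h1 h2
        exact absurd ⟨⟨hs, h1⟩, h2⟩ hsR
  · have hdom : N.domain i = Set.univ := by rw [domain, hk]; rfl
    have hcl : IsClosed (N.trace i) := by
      rw [trace_eq_of_closed hreg hk]
      exact (isCompact_Icc.image_of_continuousOn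
        (hcont.mono (hdom ▸ Set.subset_univ _))).isClosed
    obtain ⟨r, hr, hrC⟩ := hsep _ hcl (by
      rintro ⟨s, hs, heq⟩
      exact hnot s hs (by rw [hk]; simp [CurveKind.ends]) heq)
    exact ⟨r, hr, fun z hz hlt => absurd (hrC z hz) (not_le.2 hlt)⟩

/-- The three ends at a junction, in counterclockwise order. -/
theorem IsRegular.exists_junction (hreg : N.IsRegular) {e : ι × ℝ} (he : e ∈ N.curveEnds) :
    ∃ e₁ ∈ N.curveEnds, ∃ e₂ ∈ N.curveEnds, e ≠ e₁ ∧ e ≠ e₂ ∧ e₁ ≠ e₂ ∧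
      N.endPoint e₁ = N.endPoint e ∧ N.endPoint e₂ = N.endPoint e ∧
      (∀ e' ∈ N.curveEnds, N.endPoint e' = N.endPoint e → e' = e ∨ e' = e₁ ∨ e' = e₂) ∧
      N.endTangent e₁ = rot120 * N.endTangent e ∧
      N.endTangent e₂ = rot120 * rot120 * N.endTangent e := by
  have hmem : e ∈ {e' ∈ N.curveEnds | N.endPoint e' = N.endPoint e} := ⟨he, rfl⟩
  obtain ⟨a, b, ha, hb, hab, hea, heb, hE⟩ : ∃ a b, a ∈ N.curveEnds ∧ b ∈ N.curveEnds ∧ a ≠ b ∧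
      e ≠ a ∧ e ≠ b ∧ {e' ∈ N.curveEnds | N.endPoint e' = N.endPoint e} = {e, a, b} := by
    obtain ⟨x, y, z, hxy, hxz, hyz, hE⟩ := Set.ncard_eq_three.1 (hreg.triple e he)
    have hx : x ∈ N.curveEnds := (hE.ge (by simp : x ∈ ({x, y, z} : Set _))).1
    have hy : y ∈ N.curveEnds := (hE.ge (by simp : y ∈ ({x, y, z} : Set _))).1
    have hz : z ∈ N.curveEnds := (hE.ge (by simp : z ∈ ({x, y, z} : Set _))).1
    have hcase := hE.le hmem
    simp only [Set.mem_insert_iff, Set.mem_singleton_iff] at hcase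
    rcases hcase with h | h | h
    · exact ⟨y, z, hy, hz, hyz, h ▸ hxy, h ▸ hxz, by rw [hE, h]⟩
    · exact ⟨x, z, hx, hz, hxz, h ▸ hxy.symm, h ▸ hyz, by rw [hE, h, Set.insert_comm]⟩
    · exact ⟨x, y, hx, hy, hxy, h ▸ hxz.symm, h ▸ hyz.symm, by
        rw [hE, h, Set.insert_comm x y, Set.pair_comm x z, Set.insert_comm y z,
          Set.pair_comm y x]⟩
  have hpa : N.endPoint a = N.endPoint e := (hE.ge (by simp : a ∈ ({e, a, b} : Set _))).2
  have hpb : N.endPoint b = N.endPoint e := (hE.ge (by simp : b ∈ ({e, a, b} : Set _))).2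
  have hall : ∀ e' ∈ N.curveEnds, N.endPoint e' = N.endPoint e → e' = e ∨ e' = a ∨ e' = b :=
    fun e' h1 h2 => by simpa using hE.le (⟨h1, h2⟩ : e' ∈ {e' ∈ N.curveEnds | _})
  have hne : ∀ e' ∈ N.curveEnds, ‖N.endTangent e'‖ = 1 := fun e' he' => by
    obtain ⟨_, _, _, _, _, _, _, h, _⟩ := hreg.exists_arm he'
    exact h
  have hA := eq_rot120_mul_of_angle (hne e he) (hne a ha) (hreg.angles e he a ha hea hpa.symm)
  have hB := eq_rot120_mul_of_angle (hne e he) (hne b hb) (hreg.angles e he b hb heb hpb.symm)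
  have hAB := hreg.angles a ha b hb hab (hpa.trans hpb.symm)
  have hdiff : N.endTangent a ≠ N.endTangent b := by
    intro h
    rw [h, InnerProductGeometry.angle_self] at hAB
    · linarith [Real.pi_pos]
    · rw [← norm_pos_iff, hne b hb]; exact one_pos
  have hinv : ∀ x y : ℂ, x = rot120 * y → y = rot120 * rot120 * x := fun x y h => by
    rw [h]; linear_combination -y * rot120_cube
  rcases hA with hA | hA <;> rcases hB with hB | hB
  · exact absurd (hA.trans hB.symm) hdiff
  · exact ⟨a, ha, b, hb, hea, heb, hab, hpa, hpb, hall, hA, hinv _ _ hB⟩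
  · exact ⟨b, hb, a, ha, heb, hea, hab.symm, hpb, hpa,
      fun e' h1 h2 => by have := hall e' h1 h2; tauto, hB, hinv _ _ hA⟩
  · exact absurd ((hinv _ _ hA).trans (hinv _ _ hB).symm) hdiff

end PlaneNetwork

theorem starPoint_rot120 (P d : ℂ) (ρ θ : ℝ) :
    starPoint P (rot120 * d) ρ θ = starPoint P d ρ (θ + 2 * Real.pi / 3) := by
  rw [starPoint, starPoint, rot120]
  push_cast
  rw [add_mul, Complex.exp_add]
  ring

namespace PlaneNetwork

variable {ι : Type*} {N : PlaneNetwork ι} {i j : ι} {U : Set ℂ}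

theorem IsRegular.exists_arm_graph (hreg : N.IsRegular) {e : ι × ℝ} (he : e ∈ N.curveEnds) :
    ∃ δ > 0, ∃ r > 0, ∃ θ : ℝ → ℝ, ContinuousOn θ (Set.Ioo 0 r) ∧
      (∀ ρ ∈ Set.Ioo 0 r, |θ ρ| < Real.pi / 6 ∧ ∃ s ∈ Set.Ioo 0 δ,
        N.arm e s = starPoint (N.endPoint e) (N.endTangent e) ρ (θ ρ)) ∧
      (∀ s ∈ Set.Ioo 0 δ, (∃ ρ ∈ Set.Ioo 0 r,
        N.arm e s = starPoint (N.endPoint e) (N.endTangent e) ρ (θ ρ)) ∧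
        N.arm e s ∈ N.trace e.1 ∧ ∀ k, N.arm e s ∈ N.trace k → k = e.1) ∧
      ∀ ε > 0, ∃ δ' > 0, δ' ≤ δ ∧ ∀ s ∈ Set.Ioo 0 δ', ‖N.arm e s - N.endPoint e‖ < ε := by
  obtain ⟨ℓ, hℓ, α', hd, hc, h0, h1, hn, -, htr⟩ := hreg.exists_arm he
  obtain ⟨δ, hδ, hδℓ, r, hr, θ, hθ, hA, hB⟩ := exists_arm_polar hℓ hd hc h0 h1 hn
  refine ⟨δ, hδ, r, hr, θ, hθ, hA, fun s hs => ⟨hB s hs, htr s ⟨hs.1, hs.2.trans_le hδℓ⟩⟩,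
    fun ε hε => ?_⟩
  obtain ⟨δ', hδ', hball⟩ := Metric.continuousWithinAt_iff.1
    (hd 0 ⟨le_rfl, hℓ.le⟩).continuousWithinAt ε hε
  refine ⟨min δ' δ, lt_min hδ' hδ, min_le_right _ _, fun s hs => ?_⟩
  have h2 := hs.2.trans_le (min_le_left _ _)
  have h3 := hs.2.trans_le (min_le_right _ _)
  have := hball (x := s) ⟨hs.1.le, (h3.trans_le hδℓ).le⟩ (by
    rwa [Real.dist_eq, sub_zero, abs_of_pos hs.1])
  rwa [h0, dist_eq_norm] at this

/-- The local structure of a two-curve region at an end of one of its two curves. -/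
theorem IsRegular.star_at_end (hreg : N.IsRegular) (hU : IsOpen U) (hS : ∀ z ∈ U, z ∉ N.support)
    (hK : frontier U = N.trace i ∪ N.trace j)
    (hi : (∃ ℓ, N.kind i = CurveKind.arc ℓ) ∨ ∃ ℓ, N.kind i = CurveKind.closed ℓ)
    (hj : (∃ ℓ, N.kind j = CurveKind.arc ℓ) ∨ ∃ ℓ, N.kind j = CurveKind.closed ℓ)
    {e : ι × ℝ} (he : e ∈ N.curveEnds) (heJ : e.1 = i ∨ e.1 = j) :
    ∃ e₁ ∈ N.curveEnds, ∃ e₂ ∈ N.curveEnds, e ≠ e₁ ∧ e ≠ e₂ ∧ e₁ ≠ e₂ ∧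
      N.endPoint e₁ = N.endPoint e ∧ N.endPoint e₂ = N.endPoint e ∧
      (∀ e' ∈ N.curveEnds, N.endPoint e' = N.endPoint e → e' = e ∨ e' = e₁ ∨ e' = e₂) ∧
      N.endTangent e₁ = rot120 * N.endTangent e ∧
      N.endTangent e₂ = rot120 * rot120 * N.endTangent e ∧
      ∃ p₀ p₁ p₂ : Prop, (p₀ ∨ p₁ ∨ p₂) ∧ (p₀ → e₁.1 = i ∨ e₁.1 = j) ∧
        (p₁ → (e₁.1 = i ∨ e₁.1 = j) ∧ (e₂.1 = i ∨ e₂.1 = j)) ∧ (p₂ → e₂.1 = i ∨ e₂.1 = j) ∧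
        (p₀ → N.RotIn U e 1) ∧ (¬p₀ → N.RotIn Uᶜ e 1) ∧
        (p₂ → N.RotIn U e (-1)) ∧ (¬p₂ → N.RotIn Uᶜ e (-1)) := by
  have hpi := Real.pi_pos
  obtain ⟨e₁, he₁, e₂, he₂, h01, h02, h12, hP₁, hP₂, hall, hT₁, hT₂⟩ := hreg.exists_junction he
  refine ⟨e₁, he₁, e₂, he₂, h01, h02, h12, hP₁, hP₂, hall, hT₁, hT₂, ?_⟩
  obtain ⟨_, _, _, _, _, _, _, hd, hPtr, _⟩ := hreg.exists_arm he
  obtain ⟨δ₀, hδ₀, r₀, hr₀, θ₀, hc₀, hρ₀, hs₀, hsmall⟩ := hreg.exists_arm_graph he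
  obtain ⟨δ₁, hδ₁, r₁, hr₁, θ₁, hc₁, hρ₁, hs₁, -⟩ := hreg.exists_arm_graph he₁
  obtain ⟨δ₂, hδ₂, r₂, hr₂, θ₂, hc₂, hρ₂, hs₂, -⟩ := hreg.exists_arm_graph he₂
  set P := N.endPoint e with hP
  set d := N.endTangent e with hdd
  have e1 : ∀ ρ θ, starPoint (N.endPoint e₁) (N.endTangent e₁) ρ θ =
      starPoint P d ρ (θ + 2 * Real.pi / 3) := fun ρ θ => by rw [hP₁, hT₁, starPoint_rot120]
  have e2 : ∀ ρ θ, starPoint (N.endPoint e₂) (N.endTangent e₂) ρ θ =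
      starPoint P d ρ (θ + 4 * Real.pi / 3) := fun ρ θ => by
    rw [hP₂, hT₂, mul_assoc, starPoint_rot120, starPoint_rot120]; congr 1; ring
  simp only [e1] at hρ₁ hs₁
  simp only [e2] at hρ₂ hs₂
  set δ := min δ₀ (min δ₁ δ₂) with hδ
  have hδpos : 0 < δ := lt_min hδ₀ (lt_min hδ₁ hδ₂)
  obtain ⟨ri, hri, hbi⟩ := hreg.exists_ball_trace hi he hδpos
  obtain ⟨rj, hrj, hbj⟩ := hreg.exists_ball_trace hj he hδpos
  set r := min (min r₀ (min r₁ r₂)) (min ri rj) with hr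
  have hrpos : 0 < r := lt_min (lt_min hr₀ (lt_min hr₁ hr₂)) (lt_min hri hrj)
  have hlt : ∀ ρ, ρ < r → (ρ < r₀ ∧ ρ < r₁ ∧ ρ < r₂) ∧ ρ < ri ∧ ρ < rj := fun ρ h => by
    simpa only [hr, lt_min_iff] using h
  -- The angles of the three arms at distance `ρ`, measured from the tangent at `e`. They stay
  -- within 30 degrees of 0, 120 and 240 degrees, so their order is fixed.
  set β₀ : ℝ → ℝ := θ₀ with hβ₀
  set β₁ : ℝ → ℝ := fun ρ => θ₁ ρ + 2 * Real.pi / 3 with hβ₁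
  set β₂ : ℝ → ℝ := fun ρ => θ₂ ρ + 4 * Real.pi / 3 with hβ₂
  have hb₀ : ∀ ρ ∈ Set.Ioo 0 r, -(Real.pi / 6) < β₀ ρ ∧ β₀ ρ < Real.pi / 6 := fun ρ h =>
    abs_lt.1 (hρ₀ ρ ⟨h.1, (hlt ρ h.2).1.1⟩).1
  have hb₁ : ∀ ρ ∈ Set.Ioo 0 r, Real.pi / 2 < β₁ ρ ∧ β₁ ρ < 5 * Real.pi / 6 := fun ρ h => by
    have := abs_lt.1 (hρ₁ ρ ⟨h.1, (hlt ρ h.2).1.2.1⟩).1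
    constructor <;> simp only [hβ₁] <;> linarith
  have hb₂ : ∀ ρ ∈ Set.Ioo 0 r, 7 * Real.pi / 6 < β₂ ρ ∧ β₂ ρ < 3 * Real.pi / 2 := fun ρ h => by
    have := abs_lt.1 (hρ₂ ρ ⟨h.1, (hlt ρ h.2).1.2.2⟩).1
    constructor <;> simp only [hβ₂] <;> linarith
  have harm₀ : ∀ ρ ∈ Set.Ioo 0 r, starPoint P d ρ (β₀ ρ) ∈ N.trace e.1 ∧
      ∀ k, starPoint P d ρ (β₀ ρ) ∈ N.trace k → k = e.1 := fun ρ h => by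
    obtain ⟨s, hs, heq⟩ := (hρ₀ ρ ⟨h.1, (hlt ρ h.2).1.1⟩).2
    rw [← heq]; exact (hs₀ s hs).2
  have harm₁ : ∀ ρ ∈ Set.Ioo 0 r, starPoint P d ρ (β₁ ρ) ∈ N.trace e₁.1 ∧
      ∀ k, starPoint P d ρ (β₁ ρ) ∈ N.trace k → k = e₁.1 := fun ρ h => by
    obtain ⟨s, hs, heq⟩ := (hρ₁ ρ ⟨h.1, (hlt ρ h.2).1.2.1⟩).2
    simp only [hβ₁]
    rw [← heq]; exact (hs₁ s hs).2
  have harm₂ : ∀ ρ ∈ Set.Ioo 0 r, starPoint P d ρ (β₂ ρ) ∈ N.trace e₂.1 ∧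
      ∀ k, starPoint P d ρ (β₂ ρ) ∈ N.trace k → k = e₂.1 := fun ρ h => by
    obtain ⟨s, hs, heq⟩ := (hρ₂ ρ ⟨h.1, (hlt ρ h.2).1.2.2⟩).2
    simp only [hβ₂]
    rw [← heq]; exact (hs₂ s hs).2
  have hnorm := fun ρ (h : 0 < ρ) θ => norm_starPoint_sub (P := P) hd h θ
  -- On a small circle about the junction the frontier has no points other than those of the three
  -- arms.
  have hfr : ∀ ρ ∈ Set.Ioo 0 r, ∀ θ, starPoint P d ρ θ ∈ frontier U →
      starPoint P d ρ θ = starPoint P d ρ (β₀ ρ) ∨ starPoint P d ρ θ = starPoint P d ρ (β₁ ρ) ∨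
      starPoint P d ρ θ = starPoint P d ρ (β₂ ρ) := by
    intro ρ hρ θ hz
    have hloc : starPoint P d ρ θ = P ∨ ∃ e' ∈ N.curveEnds, N.endPoint e' = P ∧
        ∃ s ∈ Set.Ioo 0 δ, starPoint P d ρ θ = N.arm e' s := by
      rw [hK] at hz
      rcases hz with hz | hz
      · rcases hbi _ hz (by rw [hnorm ρ hρ.1]; exact (hlt ρ hρ.2).2.1) with h | ⟨e', h1, -, h2, h3⟩
        · exact Or.inl h
        · exact Or.inr ⟨e', h1, h2, h3⟩
      · rcases hbj _ hz (by rw [hnorm ρ hρ.1]; exact (hlt ρ hρ.2).2.2) with h | ⟨e', h1, -, h2, h3⟩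
        · exact Or.inl h
        · exact Or.inr ⟨e', h1, h2, h3⟩
    rcases hloc with h | ⟨e', he', hPe', s, hs, heq⟩
    · have := hnorm ρ hρ.1 θ
      rw [h, sub_self, norm_zero] at this
      exact absurd this hρ.1.ne
    · have hsd : s < δ₀ ∧ s < δ₁ ∧ s < δ₂ := by simpa only [hδ, lt_min_iff] using hs.2
      have hconv : ∀ ρ' θ', 0 < ρ' → starPoint P d ρ θ = starPoint P d ρ' θ' → ρ = ρ' :=
        fun ρ' θ' h h' => by rw [← hnorm ρ hρ.1 θ, ← hnorm ρ' h θ', h']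
      rcases hall e' he' hPe' with rfl | rfl | rfl
      · obtain ⟨ρ', hρ', h'⟩ := (hs₀ s ⟨hs.1, hsd.1⟩).1
        rw [← heq] at h'
        rw [← hconv ρ' _ hρ'.1 h'] at h'
        exact Or.inl h'
      · obtain ⟨ρ', hρ', h'⟩ := (hs₁ s ⟨hs.1, hsd.2.1⟩).1
        rw [← heq] at h'
        rw [← hconv ρ' _ hρ'.1 h'] at h'
        exact Or.inr (Or.inl h')
      · obtain ⟨ρ', hρ', h'⟩ := (hs₂ s ⟨hs.1, hsd.2.2⟩).1
        rw [← heq] at h'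
        rw [← hconv ρ' _ hρ'.1 h'] at h'
        exact Or.inr (Or.inr h')
  have hinj : ∀ ρ, 0 < ρ → ∀ θ θ', |θ - θ'| < 2 * Real.pi → θ ≠ θ' →
      starPoint P d ρ θ ≠ starPoint P d ρ θ' := fun ρ hρ θ θ' h hne h' =>
    hne (starPoint_inj hd hρ h' h)
  have hsub : ∀ r' , r ≤ r' → Set.Ioo 0 r ⊆ Set.Ioo 0 r' := fun r' h =>
    Set.Ioo_subset_Ioo_right h
  have hβc₀ : ContinuousOn β₀ (Set.Ioo 0 r) := hc₀.mono (hsub _ ((min_le_left _ _).trans (min_le_left _ _)))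
  have hβc₁ : ContinuousOn β₁ (Set.Ioo 0 r) := (hc₁.mono (hsub _ ((min_le_left _ _).trans
    ((min_le_right _ _).trans (min_le_left _ _))))).add continuousOn_const
  have hβc₂ : ContinuousOn β₂ (Set.Ioo 0 r) := (hc₂.mono (hsub _ ((min_le_left _ _).trans
    ((min_le_right _ _).trans (min_le_right _ _))))).add continuousOn_const
  have D₀ := sector_dichotomy (a := β₀) (b := β₁) (P := P) (d := d) hU hβc₀ hβc₁
    (fun ρ h => by linarith [(hb₀ ρ h).2, (hb₁ ρ h).1]) (fun ρ h θ hθ hz => by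
      have h0 := hb₀ ρ h; have h1 := hb₁ ρ h; have h2 := hb₂ ρ h
      rcases hfr ρ h θ hz with h' | h' | h' <;> refine hinj ρ h.1 _ _ ?_ ?_ h'
      · rw [abs_lt]; constructor <;> linarith [hθ.1, hθ.2]
      · exact hθ.1.ne'
      · rw [abs_lt]; constructor <;> linarith [hθ.1, hθ.2]
      · exact hθ.2.ne
      · rw [abs_lt]; constructor <;> linarith [hθ.1, hθ.2]
      · intro h''; linarith [hθ.1, hθ.2])
  have D₁ := sector_dichotomy (a := β₁) (b := β₂) (P := P) (d := d) hU hβc₁ hβc₂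
    (fun ρ h => by linarith [(hb₁ ρ h).2, (hb₂ ρ h).1]) (fun ρ h θ hθ hz => by
      have h0 := hb₀ ρ h; have h1 := hb₁ ρ h; have h2 := hb₂ ρ h
      rcases hfr ρ h θ hz with h' | h' | h' <;> refine hinj ρ h.1 _ _ ?_ ?_ h'
      · rw [abs_lt]; constructor <;> linarith [hθ.1, hθ.2]
      · intro h''; linarith [hθ.1, hθ.2]
      · rw [abs_lt]; constructor <;> linarith [hθ.1, hθ.2]
      · exact hθ.1.ne'
      · rw [abs_lt]; constructor <;> linarith [hθ.1, hθ.2]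
      · exact hθ.2.ne)
  have D₂ := sector_dichotomy (a := β₂) (b := fun ρ => β₀ ρ + 2 * Real.pi) (P := P) (d := d) hU
    hβc₂ (hβc₀.add continuousOn_const)
    (fun ρ h => by linarith [(hb₀ ρ h).1, (hb₂ ρ h).2]) (fun ρ h θ hθ hz => by
      have h0 := hb₀ ρ h; have h1 := hb₁ ρ h; have h2 := hb₂ ρ h
      rcases hfr ρ h θ hz with h' | h' | h' <;> refine hinj ρ h.1 _ _ ?_ ?_ h'
      · rw [abs_lt]; constructor <;> linarith [hθ.1, hθ.2]
      · intro h''; linarith [hθ.1, hθ.2]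
      · rw [abs_lt]; constructor <;> linarith [hθ.1, hθ.2]
      · intro h''; linarith [hθ.1, hθ.2]
      · rw [abs_lt]; constructor <;> linarith [hθ.1, hθ.2]
      · exact hθ.1.ne')
  have hsupp : ∀ k z, z ∈ N.trace k → z ∉ U := fun k z hz hzU =>
    hS z hzU (Set.mem_iUnion.2 ⟨k, hz⟩)
  have hmemJ : ∀ k z, z ∈ N.trace k → (∀ l, z ∈ N.trace l → l = k) → z ∈ closure U →
      k = i ∨ k = j := by
    intro k z hz hl hcl
    have : z ∈ frontier U := ⟨hcl, by rw [hU.interior_eq]; exact hsupp k z hz⟩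
    rw [hK] at this
    rcases this with h | h
    · exact Or.inl (hl i h).symm
    · exact Or.inr (hl j h).symm
  have hhalf : r / 2 ∈ Set.Ioo 0 r := ⟨by linarith, by linarith⟩
  -- The propositions that the successive sectors lie in `U`; by `D₀`, `D₁`, `D₂` each sector
  -- otherwise misses `U`.
  set S₀ := ∀ ρ ∈ Set.Ioo 0 r, ∀ θ ∈ Set.Ioo (β₀ ρ) (β₁ ρ), starPoint P d ρ θ ∈ U
  set S₁ := ∀ ρ ∈ Set.Ioo 0 r, ∀ θ ∈ Set.Ioo (β₁ ρ) (β₂ ρ), starPoint P d ρ θ ∈ U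
  set S₂ := ∀ ρ ∈ Set.Ioo 0 r, ∀ θ ∈ Set.Ioo (β₂ ρ) (β₀ ρ + 2 * Real.pi), starPoint P d ρ θ ∈ U
  obtain ⟨δ', hδ', hδ'le, hnear⟩ := hsmall r hrpos
  have hrep : ∀ s ∈ Set.Ioo 0 δ', ∃ ρ ∈ Set.Ioo 0 r, N.arm e s = starPoint P d ρ (β₀ ρ) := by
    intro s hs
    obtain ⟨ρ, hρ, heq⟩ := (hs₀ s ⟨hs.1, hs.2.trans_le hδ'le⟩).1
    refine ⟨ρ, ⟨hρ.1, ?_⟩, heq⟩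
    have := hnear s hs
    rwa [heq, hnorm ρ hρ.1] at this
  have hrot : ∀ V : Set ℂ, (∀ ρ ∈ Set.Ioo 0 r, ∀ θ ∈ Set.Ioo (β₀ ρ) (β₁ ρ), starPoint P d ρ θ ∈ V) →
      N.RotIn V e 1 := by
    intro V hV
    refine ⟨δ', hδ', fun s hs => ?_⟩
    obtain ⟨ρ, hρ, heq⟩ := hrep s hs
    have hpos : 0 < β₁ ρ - β₀ ρ := by linarith [(hb₀ ρ hρ).2, (hb₁ ρ hρ).1]
    filter_upwards [Ioo_mem_nhdsGT hpos] with η hη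
    rw [Complex.ofReal_one, one_mul, heq, ← hP, starPoint_rotate]
    exact hV ρ hρ _ ⟨by linarith [hη.1], by linarith [hη.2]⟩
  have hrot' : ∀ V : Set ℂ, (∀ ρ ∈ Set.Ioo 0 r, ∀ θ ∈ Set.Ioo (β₂ ρ) (β₀ ρ + 2 * Real.pi),
      starPoint P d ρ θ ∈ V) → N.RotIn V e (-1) := by
    intro V hV
    refine ⟨δ', hδ', fun s hs => ?_⟩
    obtain ⟨ρ, hρ, heq⟩ := hrep s hs
    have hpos : 0 < β₀ ρ + 2 * Real.pi - β₂ ρ := by linarith [(hb₀ ρ hρ).1, (hb₂ ρ hρ).2]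
    filter_upwards [Ioo_mem_nhdsGT hpos] with η hη
    have e3 : (((-1 : ℝ) : ℂ) * η * Complex.I) = ((-η : ℝ) : ℂ) * Complex.I := by
      push_cast; ring
    rw [e3, heq, ← hP, starPoint_rotate, ← starPoint_add_two_pi]
    exact hV ρ hρ _ ⟨by linarith [hη.2], by linarith [hη.1]⟩
  refine ⟨S₀, S₁, S₂, ?_, fun h => ?_, fun h => ⟨?_, ?_⟩, fun h => ?_, fun h => hrot U h,
    fun h => hrot Uᶜ (D₀.resolve_left h), fun h => hrot' U h,
    fun h => hrot' Uᶜ (D₂.resolve_left h)⟩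
  -- If all sectors missed `U`, so would a disc about the junction, which is a frontier point.
  · by_contra! hcon
    have hPfr : P ∈ frontier U := by
      rw [hK]
      rcases heJ with h | h
      · exact Or.inl (h ▸ hPtr)
      · exact Or.inr (h ▸ hPtr)
    obtain ⟨z, hzU, hzP⟩ := Metric.mem_closure_iff.1 hPfr.1 r hrpos
    rw [dist_comm, dist_eq_norm] at hzP
    have hzne : z ≠ P := by
      rintro rfl
      exact hsupp _ _ hPtr hzU
    have hρ : ‖z - P‖ ∈ Set.Ioo 0 r := ⟨norm_pos_iff.2 (sub_ne_zero.2 hzne), hzP⟩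
    obtain ⟨θ, hθ, hz⟩ := exists_starPoint (P := P) hd z (β₀ ‖z - P‖)
    set ρ := ‖z - P‖
    rw [hz] at hzU
    rcases hθ.1.eq_or_lt with h | h0
    · rw [← h] at hzU; exact hsupp _ _ (harm₀ ρ hρ).1 hzU
    rcases lt_trichotomy θ (β₁ ρ) with h | h | h1
    · exact D₀.resolve_left hcon.1 ρ hρ θ ⟨h0, h⟩ hzU
    · rw [h] at hzU; exact hsupp _ _ (harm₁ ρ hρ).1 hzU
    rcases lt_trichotomy θ (β₂ ρ) with h | h | h2
    · exact D₁.resolve_left hcon.2.1 ρ hρ θ ⟨h1, h⟩ hzU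
    · rw [h] at hzU; exact hsupp _ _ (harm₂ ρ hρ).1 hzU
    · exact D₂.resolve_left hcon.2.2 ρ hρ θ ⟨h2, hθ.2⟩ hzU
  · exact hmemJ _ _ (harm₁ _ hhalf).1 (harm₁ _ hhalf).2 (starPoint_mem_closure
      (by linarith [(hb₀ _ hhalf).2, (hb₁ _ hhalf).1]) (h _ hhalf)).2
  · exact hmemJ _ _ (harm₁ _ hhalf).1 (harm₁ _ hhalf).2 (starPoint_mem_closure
      (by linarith [(hb₁ _ hhalf).2, (hb₂ _ hhalf).1]) (h _ hhalf)).1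
  · exact hmemJ _ _ (harm₂ _ hhalf).1 (harm₂ _ hhalf).2 (starPoint_mem_closure
      (by linarith [(hb₁ _ hhalf).2, (hb₂ _ hhalf).1]) (h _ hhalf)).2
  · exact hmemJ _ _ (harm₂ _ hhalf).1 (harm₂ _ hhalf).2 (starPoint_mem_closure
      (by linarith [(hb₀ _ hhalf).1, (hb₂ _ hhalf).2]) (h _ hhalf)).1

end PlaneNetwork

/-! ### Winding: spirals and nested loops -/

section Winding

theorem forall_neg_or_forall_pos {s : Set ℝ} (hs : IsPreconnected s) {f : ℝ → ℝ}
    (hf : ContinuousOn f s) (h0 : ∀ x ∈ s, f x ≠ 0) : (∀ x ∈ s, f x < 0) ∨ ∀ x ∈ s, 0 < f x := by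
  by_contra! hcon
  obtain ⟨⟨x, hx, hx0⟩, y, hy, hy0⟩ := hcon
  obtain ⟨z, hz, hz0⟩ := hs.intermediate_value hy hx hf ⟨hy0, hx0⟩
  exact h0 z hz hz0

theorem shift_sign {f : ℝ → ℝ} {A B p : ℝ} (hp : 0 ≤ p) (hf : ContinuousOn f (Set.Icc A B))
    (h : ∀ t, A ≤ t → t + p ≤ B → f (t + p) ≠ f t) :
    (∀ t, A ≤ t → t + p ≤ B → f (t + p) < f t) ∨ ∀ t, A ≤ t → t + p ≤ B → f t < f (t + p) := by
  have hc : ContinuousOn (fun t => f (t + p) - f t) (Set.Icc A (B - p)) :=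
    (hf.comp (by fun_prop) fun t ht => ⟨by linarith [ht.1], by linarith [ht.2]⟩).sub
      (hf.mono (Set.Icc_subset_Icc_right (by linarith)))
  rcases forall_neg_or_forall_pos isPreconnected_Icc hc
    (fun t ht => sub_ne_zero.2 (h t ht.1 (by linarith [ht.2]))) with H | H
  · exact Or.inl fun t h1 h2 => sub_neg.1 (H t ⟨h1, by linarith⟩)
  · exact Or.inr fun t h1 h2 => sub_pos.1 (H t ⟨h1, by linarith⟩)

theorem lt_shift_iterate {f : ℝ → ℝ} {A B p : ℝ} (hp : 0 ≤ p)
    (h : ∀ t, A ≤ t → t + p ≤ B → f t < f (t + p)) (n : ℕ) {t : ℝ} (h1 : A ≤ t)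
    (h2 : t + (n + 1) * p ≤ B) : f t < f (t + (n + 1) * p) := by
  induction n with
  | zero => simpa using h t h1 (by simpa using h2)
  | succ n ih =>
    push_cast at h2 ⊢
    have h3 := ih (by linarith)
    refine h3.trans ?_
    have h4 := h (t + (n + 1) * p) (by have : 0 ≤ (n + 1 : ℝ) * p := by positivity
                                       linarith) (by linarith)
    rwa [show t + ((n : ℝ) + 1 + 1) * p = t + (n + 1) * p + p by ring]

theorem shift_iterate_sign {f : ℝ → ℝ} {A B p : ℝ} (hp : 0 ≤ p) (hf : ContinuousOn f (Set.Icc A B))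
    (h : ∀ t, A ≤ t → t + p ≤ B → f (t + p) ≠ f t) (n : ℕ) :
    (∀ t, A ≤ t → t + (n + 1) * p ≤ B → f (t + (n + 1) * p) < f t) ∨
      ∀ t, A ≤ t → t + (n + 1) * p ≤ B → f t < f (t + (n + 1) * p) := by
  rcases shift_sign hp hf h with H | H
  · refine Or.inl fun t h1 h2 => ?_
    have := lt_shift_iterate (f := fun t => -f t) hp (fun t h1 h2 => neg_lt_neg (H t h1 h2)) n h1 h2
    exact neg_lt_neg_iff.1 this
  · exact Or.inr fun t h1 h2 => lt_shift_iterate hp H n h1 h2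

/-- A spiral cannot leave a graph on one side and come back to its other end, after extra turns,
on the same side. -/
theorem no_spiral {f g : ℝ → ℝ} {A B p : ℝ} (hp : 0 ≤ p) (n : ℕ) (hAB : A < B)
    (hf : ContinuousOn f (Set.Icc A (B + (n + 1) * p))) (hg : ContinuousOn g (Set.Icc A B))
    (hself : ∀ t, A ≤ t → t + p ≤ B + (n + 1) * p → f (t + p) ≠ f t)
    (hA : f A = g A) (hB : f (B + (n + 1) * p) = g B)
    (hne : ∀ t ∈ Set.Ioc A B, f t ≠ g t) (hne' : ∀ t ∈ Set.Ico A B, f (t + (n + 1) * p) ≠ g t)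
    (hnear : ∃ t ∈ Set.Ioc A B, f t < g t)
    (hnear' : ∃ t ∈ Set.Ico A B, f (t + (n + 1) * p) < g t) : False := by
  have hnp : 0 ≤ ((n : ℝ) + 1) * p := by positivity
  have h1 : f B < g B := by
    rcases forall_neg_or_forall_pos isPreconnected_Ioc
      ((hf.mono fun t ht => ⟨ht.1.le, by linarith [ht.2]⟩).sub (hg.mono Set.Ioc_subset_Icc_self))
      (fun t ht => sub_ne_zero.2 (hne t ht)) with H | H
    · exact sub_neg.1 (H B ⟨hAB, le_rfl⟩)
    · obtain ⟨t, ht, hlt⟩ := hnear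
      exact absurd (sub_pos.1 (H t ht)) hlt.not_gt
  have h2 : f (A + (n + 1) * p) < g A := by
    rcases forall_neg_or_forall_pos (s := Set.Ico A B) isPreconnected_Ico
      ((hf.comp (by fun_prop : ContinuousOn (fun t => t + (n + 1) * p) _)
        fun t ht => ⟨by linarith [ht.1], by linarith [ht.2]⟩).sub (hg.mono Set.Ico_subset_Icc_self))
      (fun t ht => sub_ne_zero.2 (hne' t ht)) with H | H
    · exact sub_neg.1 (H A ⟨le_rfl, hAB⟩)
    · obtain ⟨t, ht, hlt⟩ := hnear'
      exact absurd (sub_pos.1 (H t ht)) hlt.not_gt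
  -- By embeddedness the shift by `(n + 1) p` moves `f` in one direction throughout. But `f` at the
  -- shift of `B` is `g B > f B`, while at the shift of `A` it is below `g A = f A`.
  rcases shift_iterate_sign hp hf hself n with H | H
  · have := H B hAB.le le_rfl
    linarith
  · have := H A le_rfl (by linarith)
    linarith

end Winding

section Direction

/-- Every nonempty open set meets a ray from the origin outside of two given lines. -/
theorem exists_polar_mem_notMem_lines {U : Set ℂ} (hU : IsOpen U) (hne : U.Nonempty) (w₁ w₂ : ℂ) :
    ∃ x t : ℝ, polar x t ∈ U ∧ ∀ y c : ℝ, polar y t ≠ c * w₁ ∧ polar y t ≠ c * w₂ := by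
  have hnull : ∀ w : ℂ, MeasureTheory.volume ((Submodule.span ℝ {w} : Submodule ℝ ℂ) : Set ℂ) = 0 := by
    intro w
    refine MeasureTheory.Measure.addHaar_submodule _ _ fun htop => ?_
    have h1 := finrank_span_le_card (R := ℝ) ({w} : Set ℂ)
    rw [htop, finrank_top, Complex.finrank_real_complex] at h1
    simp at h1
  obtain ⟨z, hzU, hz⟩ : ∃ z ∈ U, z ∉ ((Submodule.span ℝ {w₁} : Submodule ℝ ℂ) : Set ℂ) ∪
      ((Submodule.span ℝ {w₂} : Submodule ℝ ℂ) : Set ℂ) := by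
    by_contra! hsub
    have h1 := MeasureTheory.measure_mono (μ := MeasureTheory.volume) hsub
    rw [MeasureTheory.measure_union_null (hnull w₁) (hnull w₂)] at h1
    exact (hU.measure_pos MeasureTheory.volume hne).not_ge h1
  have hz0 : z ≠ 0 := by
    rintro rfl
    exact hz (Or.inl (Submodule.zero_mem _))
  have hpz : ∀ y : ℝ, polar y z.arg = (Real.exp y / ‖z‖ : ℝ) * z := by
    intro y
    have hn : (‖z‖ : ℂ) ≠ 0 := by exact_mod_cast norm_ne_zero_iff.2 hz0
    rw [polar, Complex.exp_add]
    simp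
    field_simp
    rw [mul_comm]
    exact Complex.norm_mul_exp_arg_mul_I z
  refine ⟨Real.log ‖z‖, z.arg, ?_, fun y c => ?_⟩
  · rw [hpz, Real.exp_log (norm_pos_iff.2 hz0), div_self (norm_ne_zero_iff.2 hz0)]
    simpa using hzU
  · have hpos : 0 < Real.exp y / ‖z‖ := div_pos (Real.exp_pos y) (norm_pos_iff.2 hz0)
    have key : ∀ w : ℂ, polar y z.arg = c * w → z ∈ Submodule.span ℝ {w} := by
      intro w hw
      rw [Submodule.mem_span_singleton]
      refine ⟨(Real.exp y / ‖z‖)⁻¹ * c, ?_⟩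
      rw [hpz] at hw
      rw [Complex.real_smul, Complex.ofReal_mul, mul_assoc, ← hw, ← mul_assoc, ← Complex.ofReal_mul,
        inv_mul_cancel₀ hpos.ne', Complex.ofReal_one, one_mul]
    exact ⟨fun h => hz (Or.inl (key _ h)), fun h => hz (Or.inr (key _ h))⟩

end Direction

namespace IsPolarShrinker

variable {u ψ v χ : ℝ → ℝ} {A B C : ℝ}

/-- If one polar graph lies above another one, then its slope angle grows more slowly. -/
theorem slope_sub_le (h : IsPolarShrinker u ψ A B) (h' : IsPolarShrinker v χ A B) (hAB : A < B)
    (hlt : ∀ t ∈ Set.Ioo A B, v t < u t) : ψ B - ψ A < χ B - χ A := by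
  have := lt_of_hasDerivAt_pos (f := fun t => χ t - ψ t) hAB (h'.contψ.sub h.contψ)
    (fun t ht => (h'.derivψ t ht).sub (h.derivψ t ht)) (fun t ht => by
      have := Real.exp_lt_exp.2 (mul_lt_mul_of_pos_left (hlt t ht) two_pos)
      linarith)
  linarith

/-- Where `u` lies above `v`, `ψ` grows more slowly than `χ`. The second loop spans two successive
sheets of the first; summing the two comparisons gives a total change of `ψ` smaller than that of
`χ`, against the signs assumed. -/
theorem loops_false_aux (h : IsPolarShrinker u ψ A (A + 2 * Real.pi))
    (h' : IsPolarShrinker v χ C (C + 2 * Real.pi)) (hAC : A ≤ C) (hCA : C < A + 2 * Real.pi)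
    (hu : u A = u (A + 2 * Real.pi))
    (hψ : ψ A ≤ ψ (A + 2 * Real.pi)) (hχ : χ (C + 2 * Real.pi) ≤ χ C)
    (hd : ∀ t ∈ Set.Icc A (A + 2 * Real.pi), ∀ s ∈ Set.Icc C (C + 2 * Real.pi),
      polar (u t) t ≠ polar (v s) s) {t₀ s₀ : ℝ} (ht₀ : t₀ ∈ Set.Icc A (A + 2 * Real.pi))
    (hs₀ : s₀ ∈ Set.Icc C (C + 2 * Real.pi)) {n : ℤ} (hn : s₀ = t₀ + n * (2 * Real.pi))
    (hlt : v s₀ < u t₀) : False := by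
  have hpi := Real.pi_pos
  have hu₀ : ∀ t ∈ Set.Icc A (A + 2 * Real.pi), ∀ m : ℤ, t = t₀ + m * (2 * Real.pi) →
      u t = u t₀ := by
    intro t ht m hm
    have h1 : (m : ℝ) * (2 * Real.pi) ≤ 1 * (2 * Real.pi) := by linarith [ht.2, ht₀.1]
    have h2 : (-1 : ℝ) * (2 * Real.pi) ≤ m * (2 * Real.pi) := by linarith [ht.1, ht₀.2]
    have h3 := le_of_mul_le_mul_right h1 (by linarith)
    have h4 := le_of_mul_le_mul_right h2 (by linarith)
    have h5 : m ≤ 1 := by exact_mod_cast h3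
    have h6 : -1 ≤ m := by exact_mod_cast h4
    obtain rfl | rfl | rfl : m = -1 ∨ m = 0 ∨ m = 1 := by omega
    · push_cast at hm
      rw [show t = A by linarith [ht.1, ht₀.2], show t₀ = A + 2 * Real.pi by linarith [ht.1, ht₀.2], hu]
    · rw [hm]; simp
    · push_cast at hm
      rw [show t₀ = A by linarith [ht.2, ht₀.1], show t = A + 2 * Real.pi by linarith [ht.2, ht₀.1], hu]
  have ht := h.translate (-(2 * Real.pi))
  have hc1 : ContinuousOn (fun t => v t - u t) (Set.Icc C (A + 2 * Real.pi)) :=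
    (h'.contU.mono (Set.Icc_subset_Icc_right (by linarith))).sub
      (h.contU.mono (Set.Icc_subset_Icc_left hAC))
  have hc2 : ContinuousOn (fun t => v t - u (t + -(2 * Real.pi)))
      (Set.Icc (A + 2 * Real.pi) (C + 2 * Real.pi)) :=
    (h'.contU.mono (Set.Icc_subset_Icc_left (by linarith))).sub
      (ht.contU.mono (Set.Icc_subset_Icc (by linarith) (by linarith)))
  have hn1 : ∀ t ∈ Set.Icc C (A + 2 * Real.pi), v t - u t ≠ 0 := by
    intro t ht h0
    refine hd t ⟨by linarith [ht.1], ht.2⟩ t ⟨ht.1, by linarith [ht.2]⟩ ?_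
    rw [show u t = v t by linarith]
  have hn2 : ∀ t ∈ Set.Icc (A + 2 * Real.pi) (C + 2 * Real.pi),
      v t - u (t + -(2 * Real.pi)) ≠ 0 := by
    intro t ht h0
    refine hd (t + -(2 * Real.pi)) ⟨by linarith [ht.1], by linarith [ht.2]⟩ t
      ⟨by linarith [ht.1], ht.2⟩ (polar_eq_iff.2 ⟨by linarith, -1, by push_cast; ring⟩)
  have hmid : u (A + 2 * Real.pi + -(2 * Real.pi)) = u (A + 2 * Real.pi) := by
    rw [← hu]; congr 1; ring
  have hmem1 : A + 2 * Real.pi ∈ Set.Icc C (A + 2 * Real.pi) := ⟨hCA.le, le_rfl⟩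
  have hmem2 : A + 2 * Real.pi ∈ Set.Icc (A + 2 * Real.pi) (C + 2 * Real.pi) :=
    ⟨le_rfl, by linarith⟩
  have hneg : (∀ t ∈ Set.Icc C (A + 2 * Real.pi), v t - u t < 0) ∧
      ∀ t ∈ Set.Icc (A + 2 * Real.pi) (C + 2 * Real.pi), v t - u (t + -(2 * Real.pi)) < 0 := by
    rcases forall_neg_or_forall_pos isPreconnected_Icc hc1 hn1 with H1 | H1 <;>
      rcases forall_neg_or_forall_pos isPreconnected_Icc hc2 hn2 with H2 | H2
    · exact ⟨H1, H2⟩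
    · linarith [H1 _ hmem1, H2 _ hmem2]
    · linarith [H1 _ hmem1, H2 _ hmem2]
    · exfalso
      rcases le_total s₀ (A + 2 * Real.pi) with hle | hle
      · have := H1 s₀ ⟨hs₀.1, hle⟩
        rw [hu₀ s₀ ⟨by linarith [hs₀.1], hle⟩ n hn] at this
        linarith
      · have := H2 s₀ ⟨hle, hs₀.2⟩
        rw [hu₀ (s₀ + -(2 * Real.pi)) ⟨by linarith, by linarith [hs₀.2]⟩ (n - 1)
          (by rw [hn]; push_cast; ring)] at this
        linarith
  have h1 := (h.restrict hAC le_rfl).slope_sub_le (h'.restrict le_rfl (by linarith)) hCA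
    (fun t ht => by linarith [hneg.1 t (Set.Ioo_subset_Icc_self ht)])
  have h2 : ψ C - ψ A ≤ χ (C + 2 * Real.pi) - χ (A + 2 * Real.pi) := by
    rcases hAC.eq_or_lt with rfl | hAC
    · simp
    · have := (ht.restrict (a := A + 2 * Real.pi) (b := C + 2 * Real.pi) (by linarith)
        (by linarith)).slope_sub_le (h'.restrict (by linarith) le_rfl) (by linarith)
        (fun t ht => by linarith [hneg.2 t (Set.Ioo_subset_Icc_self ht)])
      rw [add_neg_cancel_right, add_neg_cancel_right] at this
      exact this.le
  linarith

/-- Of two disjoint closed polar graphs, the outer one cannot have the larger turning. -/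
theorem loops_false (h : IsPolarShrinker u ψ A (A + 2 * Real.pi))
    (h' : IsPolarShrinker v χ C (C + 2 * Real.pi)) (hu : u A = u (A + 2 * Real.pi))
    (hψ : ψ A ≤ ψ (A + 2 * Real.pi)) (hχ : χ (C + 2 * Real.pi) ≤ χ C)
    (hd : ∀ t ∈ Set.Icc A (A + 2 * Real.pi), ∀ s ∈ Set.Icc C (C + 2 * Real.pi),
      polar (u t) t ≠ polar (v s) s) {t₀ s₀ : ℝ} (ht₀ : t₀ ∈ Set.Icc A (A + 2 * Real.pi))
    (hs₀ : s₀ ∈ Set.Icc C (C + 2 * Real.pi)) {n : ℤ} (hn : s₀ = t₀ + n * (2 * Real.pi))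
    (hlt : v s₀ < u t₀) : False := by
  have hpi := Real.two_pi_pos
  obtain ⟨m, hm, -⟩ := existsUnique_sub_zsmul_mem_Ico hpi C A
  rw [zsmul_eq_mul] at hm
  have h2 := h'.translate (m * (2 * Real.pi))
  rw [show C + 2 * Real.pi - m * (2 * Real.pi) = C - m * (2 * Real.pi) + 2 * Real.pi by ring] at h2
  refine h.loops_false_aux h2 hm.1 hm.2 hu hψ ?_ (fun t ht s hs => ?_) ht₀
    (s₀ := s₀ - m * (2 * Real.pi)) ⟨by linarith [hs₀.1], by linarith [hs₀.2]⟩ (n := n - m)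
    (by rw [hn]; push_cast; ring) ?_
  · rw [show C - m * (2 * Real.pi) + 2 * Real.pi + m * (2 * Real.pi) = C + 2 * Real.pi by ring,
      sub_add_cancel]
    exact hχ
  · have := hd t ht (s + m * (2 * Real.pi)) ⟨by linarith [hs.1], by linarith [hs.2]⟩
    rwa [polar_add_two_pi] at this
  · simpa using hlt

end IsPolarShrinker

/-! ### Pockets and their corners -/

namespace PlaneNetwork

variable {ι : Type*} {N : PlaneNetwork ι} {i j : ι} {U : Set ℂ}

/-- A bounded open set in the complement of a regular network whose frontier consists of the two
bounded curves `i` and `j`. -/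
structure IsPocket (N : PlaneNetwork ι) (i j : ι) (U : Set ℂ) : Prop where
  reg : N.IsRegular
  ne : i ≠ j
  isOpen : IsOpen U
  nonempty : U.Nonempty
  bounded : Bornology.IsBounded U
  notMem_support : ∀ z ∈ U, z ∉ N.support
  frontier_eq : frontier U = N.trace i ∪ N.trace j
  kind_left : (∃ ℓ, N.kind i = CurveKind.arc ℓ) ∨ ∃ ℓ, N.kind i = CurveKind.closed ℓ
  kind_right : (∃ ℓ, N.kind j = CurveKind.arc ℓ) ∨ ∃ ℓ, N.kind j = CurveKind.closed ℓ
  isClosed_trace : ∀ k, IsClosed (N.trace k)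

/-- The ends `e`, `e'` bound a corner of `U`: the curve at `e'` is obtained from the one at `e` by a
counterclockwise turn through the corner. -/
structure IsCorner (N : PlaneNetwork ι) (U : Set ℂ) (e e' : ι × ℝ) : Prop where
  endPoint_eq : N.endPoint e' = N.endPoint e
  endTangent_eq : N.endTangent e' = rot120 * N.endTangent e
  left : N.RotIn U e 1
  right_compl : N.RotIn Uᶜ e (-1)
  right : N.RotIn U e' (-1)
  left_compl : N.RotIn Uᶜ e' 1

theorem rot120_mul_ne {z : ℂ} (hz : z ≠ 0) : rot120 * z ≠ z := by
  intro h
  have h1 : rot120 = 1 := mul_right_cancel₀ hz (by rw [h, one_mul])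
  have h2 := congrArg Complex.re h1
  rw [rot120, Complex.exp_ofReal_mul_I_re, Complex.one_re,
    show 2 * Real.pi / 3 = Real.pi - Real.pi / 3 by ring, Real.cos_pi_sub, Real.cos_pi_div_three] at h2
  norm_num at h2

theorem IsRegular.endTangent_ne_zero (hreg : N.IsRegular) {e : ι × ℝ} (he : e ∈ N.curveEnds) :
    N.endTangent e ≠ 0 := by
  obtain ⟨_, _, _, _, _, _, _, h, _⟩ := hreg.exists_arm he
  rw [← norm_ne_zero_iff, h]
  exact one_ne_zero

theorem IsRegular.not_four_ends (hreg : N.IsRegular) {a b c d : ι × ℝ} (ha : a ∈ N.curveEnds)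
    (hb : b ∈ N.curveEnds) (hc : c ∈ N.curveEnds) (hd : d ∈ N.curveEnds) (hab : a ≠ b) (hac : a ≠ c)
    (had : a ≠ d) (hbc : b ≠ c) (hbd : b ≠ d) (hcd : c ≠ d) (h1 : N.endPoint b = N.endPoint a)
    (h2 : N.endPoint c = N.endPoint a) (h3 : N.endPoint d = N.endPoint a) : False := by
  obtain ⟨e₁, _, e₂, _, _, _, _, _, _, hall, _⟩ := hreg.exists_junction ha
  have := hall b hb h1
  have := hall c hc h2
  have := hall d hd h3
  grind

namespace IsPocket

theorem symm (h : N.IsPocket i j U) : N.IsPocket j i U :=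
  ⟨h.reg, h.ne.symm, h.isOpen, h.nonempty, h.bounded, h.notMem_support,
    by rw [h.frontier_eq, Set.union_comm], h.kind_right, h.kind_left, h.isClosed_trace⟩

/-- `U` contains one of the three sectors at the junction, and each of these is bounded by at least
one arm other than `e`. -/
theorem exists_partner (h : N.IsPocket i j U) {e : ι × ℝ} (he : e ∈ N.curveEnds)
    (heJ : e.1 = i ∨ e.1 = j) : ∃ e' ∈ N.curveEnds, e' ≠ e ∧ (e'.1 = i ∨ e'.1 = j) ∧
      N.endPoint e' = N.endPoint e := by
  obtain ⟨e₁, he₁, e₂, he₂, h01, h02, h12, hP₁, hP₂, hall, hT₁, hT₂, p₀, p₁, p₂, hp, k0, k1, k2, -⟩ :=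
    h.reg.star_at_end h.isOpen h.notMem_support h.frontier_eq h.kind_left h.kind_right he heJ
  rcases hp with hp | hp | hp
  · exact ⟨e₁, he₁, h01.symm, k0 hp, hP₁⟩
  · exact ⟨e₁, he₁, h01.symm, (k1 hp).1, hP₁⟩
  · exact ⟨e₂, he₂, h02.symm, k2 hp, hP₂⟩

/-- The third arm does not belong to the frontier, which rules out both sectors adjacent to it. The
star is read at `e` and again at `e'` to describe both sides of both arms. -/
theorem isCorner (h : N.IsPocket i j U) {e e' : ι × ℝ} (he : e ∈ N.curveEnds)
    (he' : e' ∈ N.curveEnds) (heJ : e.1 = i ∨ e.1 = j) (heJ' : e'.1 = i ∨ e'.1 = j)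
    (hP : N.endPoint e' = N.endPoint e)
    (honly : ∀ c ∈ N.curveEnds, (c.1 = i ∨ c.1 = j) → N.endPoint c = N.endPoint e → c = e ∨ c = e')
    (hT : N.endTangent e' = rot120 * N.endTangent e) : N.IsCorner U e e' := by
  have n0 := h.reg.endTangent_ne_zero he
  have n1 := h.reg.endTangent_ne_zero he'
  have hcube := rot120_cube
  have hne : e' ≠ e := fun heq => rot120_mul_ne n0 (by rw [← hT, heq])
  obtain ⟨e₁, he₁, e₂, he₂, h01, h02, h12, hP₁, hP₂, hall, hT₁, hT₂, p₀, p₁, p₂, hp, k0, k1, k2,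
    r0, -, -, r2⟩ :=
    h.reg.star_at_end h.isOpen h.notMem_support h.frontier_eq h.kind_left h.kind_right he heJ
  obtain ⟨f₁, hf₁, f₂, hf₂, g01, g02, g12, hQ₁, hQ₂, gall, gT₁, gT₂, q₀, q₁, q₂, hq, l0, l1, l2,
    -, s0, s2, -⟩ :=
    h.reg.star_at_end h.isOpen h.notMem_support h.frontier_eq h.kind_left h.kind_right he' heJ'
  have ee1 : e' = e₁ := by
    rcases hall e' he' hP with h1 | h1 | h1
    · exact absurd h1 hne
    · exact h1
    · refine absurd ?_ (rot120_mul_ne n1)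
      calc rot120 * N.endTangent e' = rot120 * rot120 * N.endTangent e := by rw [hT, mul_assoc]
        _ = N.endTangent e' := by rw [← hT₂, ← h1]
  have ef2 : e = f₂ := by
    rcases gall e he hP.symm with h1 | h1 | h1
    · exact absurd h1.symm hne
    · exfalso
      apply rot120_mul_ne n0
      have h2 : N.endTangent e = rot120 * N.endTangent e' := by rw [← gT₁, ← h1]
      have h3 : N.endTangent e = rot120 * (rot120 * N.endTangent e) := by rw [← hT]; exact h2
      linear_combination rot120 * h3 + N.endTangent e * hcube
    · exact h1
  have hn2 : ¬(e₂.1 = i ∨ e₂.1 = j) := by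
    intro h1
    rcases honly e₂ he₂ h1 hP₂ with h2 | h2
    · exact h02 h2.symm
    · exact h12 (ee1 ▸ h2.symm)
  have hn1 : ¬(f₁.1 = i ∨ f₁.1 = j) := by
    intro h1
    rcases honly f₁ hf₁ h1 (hQ₁.trans hP) with h2 | h2
    · exact g12 (h2.trans ef2)
    · exact g01 h2.symm
  have hp2 : ¬p₂ := fun h1 => hn2 (k2 h1)
  have hp1 : ¬p₁ := fun h1 => hn2 (k1 h1).2
  have hq0 : ¬q₀ := fun h1 => hn1 (l0 h1)
  have hq1 : ¬q₁ := fun h1 => hn1 (l1 h1).1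
  exact ⟨hP, hT, r0 (hp.resolve_right fun h => h.elim hp1 hp2), r2 hp2,
    s2 ((hq.resolve_left hq0).resolve_left hq1), s0 hq0⟩

theorem isCorner_or (h : N.IsPocket i j U) {e e' : ι × ℝ} (he : e ∈ N.curveEnds)
    (he' : e' ∈ N.curveEnds) (heJ : e.1 = i ∨ e.1 = j) (heJ' : e'.1 = i ∨ e'.1 = j)
    (hne : e' ≠ e) (hP : N.endPoint e' = N.endPoint e)
    (honly : ∀ c ∈ N.curveEnds, (c.1 = i ∨ c.1 = j) → N.endPoint c = N.endPoint e →
      c = e ∨ c = e') : N.IsCorner U e e' ∨ N.IsCorner U e' e := by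
  have hcube := rot120_cube
  obtain ⟨e₁, he₁, e₂, he₂, h01, h02, h12, hP₁, hP₂, hall, hT₁, hT₂⟩ := h.reg.exists_junction he
  rcases hall e' he' hP with h1 | h1 | h1
  · exact absurd h1 hne
  · exact Or.inl (h.isCorner he he' heJ heJ' hP honly (h1 ▸ hT₁))
  · refine Or.inr (h.isCorner he' he heJ' heJ hP.symm
      (fun c hc hcJ hcP => (honly c hc hcJ (hcP.trans hP)).symm) ?_)
    rw [h1, hT₂]
    linear_combination -N.endTangent e * hcube

/-- Two ends form a corner, in one of the two orders. -/
theorem corner_of_two_ends (h : N.IsPocket i j U) {a b : ι × ℝ} (ha : a ∈ N.curveEnds)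
    (hb : b ∈ N.curveEnds) (haJ : a.1 = i ∨ a.1 = j) (hbJ : b.1 = i ∨ b.1 = j) (hab : a ≠ b)
    (hall : ∀ e ∈ N.curveEnds, (e.1 = i ∨ e.1 = j) → e = a ∨ e = b) :
    N.IsCorner U a b ∨ N.IsCorner U b a := by
  obtain ⟨e, he, hne, heJ, hP⟩ := h.exists_partner ha haJ
  have : e = b := (hall e he heJ).resolve_left hne
  subst this
  exact h.isCorner_or ha he haJ heJ hne hP fun c hc hcJ _ => hall c hc hcJ

/-- No end is without a partner and no junction carries four ends, so the four ends form two pairs.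
-/
theorem corners_of_four_ends (h : N.IsPocket i j U) {a b c d : ι × ℝ} (ha : a ∈ N.curveEnds)
    (hb : b ∈ N.curveEnds) (hc : c ∈ N.curveEnds) (hd : d ∈ N.curveEnds)
    (haJ : a.1 = i ∨ a.1 = j) (hbJ : b.1 = i ∨ b.1 = j) (hcJ : c.1 = i ∨ c.1 = j)
    (hdJ : d.1 = i ∨ d.1 = j) (hab : a ≠ b) (hac : a ≠ c) (had : a ≠ d) (hbc : b ≠ c) (hbd : b ≠ d)
    (hcd : c ≠ d)
    (hall : ∀ e ∈ N.curveEnds, (e.1 = i ∨ e.1 = j) → e = a ∨ e = b ∨ e = c ∨ e = d) :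
    ((N.IsCorner U a b ∨ N.IsCorner U b a) ∧ (N.IsCorner U c d ∨ N.IsCorner U d c) ∧
        N.endPoint a ≠ N.endPoint c) ∨
      ((N.IsCorner U a c ∨ N.IsCorner U c a) ∧ (N.IsCorner U b d ∨ N.IsCorner U d b) ∧
        N.endPoint a ≠ N.endPoint b) ∨
      ((N.IsCorner U a d ∨ N.IsCorner U d a) ∧ (N.IsCorner U b c ∨ N.IsCorner U c b)) := by
  have h4 := h.reg.not_four_ends ha hb hc hd hab hac had hbc hbd hcd
  have key : ∀ x ∈ N.curveEnds, (x.1 = i ∨ x.1 = j) → ∀ y ∈ N.curveEnds, (y.1 = i ∨ y.1 = j) →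
      y ≠ x → N.endPoint y = N.endPoint x → (∀ c ∈ N.curveEnds, (c.1 = i ∨ c.1 = j) →
        N.endPoint c = N.endPoint x → c = x ∨ c = y) →
      N.IsCorner U x y ∨ N.IsCorner U y x :=
    fun x hx hxJ y hy hyJ hne hP ho => h.isCorner_or hx hy hxJ hyJ hne hP ho
  have hcase : (N.endPoint b = N.endPoint a ∧ N.endPoint d = N.endPoint c ∧
        N.endPoint a ≠ N.endPoint c) ∨
      (N.endPoint c = N.endPoint a ∧ N.endPoint d = N.endPoint b ∧ N.endPoint a ≠ N.endPoint b) ∨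
      (N.endPoint d = N.endPoint a ∧ N.endPoint c = N.endPoint b ∧ N.endPoint a ≠ N.endPoint b) := by
    obtain ⟨a', h1, h2, h3, h5⟩ := h.exists_partner ha haJ
    obtain ⟨b', h1b, h2b, h3b, h5b⟩ := h.exists_partner hb hbJ
    obtain ⟨c', h1c, h2c, h3c, h5c⟩ := h.exists_partner hc hcJ
    obtain ⟨d', h1d, h2d, h3d, h5d⟩ := h.exists_partner hd hdJ
    have := hall a' h1 h3
    have := hall b' h1b h3b
    have := hall c' h1c h3c
    have := hall d' h1d h3d
    grind
  rcases hcase with ⟨h1, h2, h3⟩ | ⟨h1, h2, h3⟩ | ⟨h1, h2, h3⟩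
  · refine Or.inl ⟨key a ha haJ b hb hbJ hab.symm h1 fun e he heJ hP => ?_,
      key c hc hcJ d hd hdJ hcd.symm h2 fun e he heJ hP => ?_, h3⟩ <;>
    · have := hall e he heJ
      grind
  · refine Or.inr (Or.inl ⟨key a ha haJ c hc hcJ hac.symm h1 fun e he heJ hP => ?_,
      key b hb hbJ d hd hdJ hbd.symm h2 fun e he heJ hP => ?_, h3⟩) <;>
    · have := hall e he heJ
      grind
  · refine Or.inr (Or.inr ⟨key a ha haJ d hd hdJ had.symm h1 fun e he heJ hP => ?_,
      key b hb hbJ c hc hcJ hbc.symm h2 fun e he heJ hP => ?_⟩) <;>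
    · have := hall e he heJ
      grind

end IsPocket

/-- The end `e` is the start of the polar graph of `u` over `[A, B]`. -/
structure IsStart (N : PlaneNetwork ι) (e : ι × ℝ) (u ψ : ℝ → ℝ) (A B : ℝ) : Prop where
  endPoint_eq : N.endPoint e = polar (u A) A
  endTangent_eq : N.endTangent e = polarTangent (ψ A) A
  arm_eq : ∀ δ > 0, ∃ s ∈ Set.Ioo 0 δ, ∃ t ∈ Set.Ioo A B, t < A + δ ∧ N.arm e s = polar (u t) t

/-- The end `e` is the finish of the polar graph of `u` over `[A, B]`. -/
structure IsFinish (N : PlaneNetwork ι) (e : ι × ℝ) (u ψ : ℝ → ℝ) (A B : ℝ) : Prop where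
  endPoint_eq : N.endPoint e = polar (u B) B
  endTangent_eq : N.endTangent e = -polarTangent (ψ B) B
  arm_eq : ∀ δ > 0, ∃ s ∈ Set.Ioo 0 δ, ∃ t ∈ Set.Ioo A B, B - δ < t ∧ N.arm e s = polar (u t) t

section Sides

variable {u ψ : ℝ → ℝ} {A B t : ℝ} {e e' : ι × ℝ}

theorem IsPolar.ends' (h : N.IsPolar i u ψ A B) :
    (∃ eA eB : ι × ℝ, eA ≠ eB ∧ eA.1 = i ∧ eB.1 = i ∧ eA ∈ N.curveEnds ∧ eB ∈ N.curveEnds ∧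
      (∀ e ∈ N.curveEnds, e.1 = i → e = eA ∨ e = eB) ∧ N.IsStart eA u ψ A B ∧
      N.IsFinish eB u ψ A B) ∨
    ((∀ e ∈ N.curveEnds, e.1 ≠ i) ∧ polar (u A) A = polar (u B) B ∧ ψ A = ψ B ∧
      ∀ k, k ≠ i → polar (u A) A ∉ N.trace k) := by
  rcases h.ends with ⟨eA, eB, h1, h2, h3, h4, h5, h6, h7, h8, h9, h10, h11, h12⟩ | h1
  · exact Or.inl ⟨eA, eB, h1, h2, h3, h4, h5, h6, ⟨h7, h9, h11⟩, ⟨h8, h10, h12⟩⟩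
  · exact Or.inr h1

variable (hp : N.IsPocket i j U) (h : N.IsPolar i u ψ A B)
include hp h

theorem IsPocket.side_start_left (hs : N.IsStart e u ψ A B) (hc : N.IsCorner U e e')
    (ht : t ∈ Set.Ioo A B) : SideAt U u (-1) t ∧ ¬SideAt U u 1 t := by
  have h1 := h.sideAt_start hp.ne.symm (hp.isClosed_trace j) hp.isOpen hp.frontier_eq.subset (τ := 1)
    (by simp) hs.endPoint_eq hs.arm_eq ht
  have h2 := h.sideAt_start hp.ne.symm (hp.isClosed_trace j) hp.isOpen hp.frontier_eq.subset
    (τ := -1) (by simp) hs.endPoint_eq hs.arm_eq ht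
  rw [neg_neg] at h2
  exact ⟨h1.1 hc.left, h2.2 hc.right_compl⟩

theorem IsPocket.side_start_right (hs : N.IsStart e' u ψ A B) (hc : N.IsCorner U e e')
    (ht : t ∈ Set.Ioo A B) : SideAt U u 1 t ∧ ¬SideAt U u (-1) t := by
  have h1 := h.sideAt_start hp.ne.symm (hp.isClosed_trace j) hp.isOpen hp.frontier_eq.subset (τ := 1)
    (by simp) hs.endPoint_eq hs.arm_eq ht
  have h2 := h.sideAt_start hp.ne.symm (hp.isClosed_trace j) hp.isOpen hp.frontier_eq.subset
    (τ := -1) (by simp) hs.endPoint_eq hs.arm_eq ht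
  rw [neg_neg] at h2
  exact ⟨h2.1 hc.right, h1.2 hc.left_compl⟩

theorem IsPocket.side_finish_left (hs : N.IsFinish e u ψ A B) (hc : N.IsCorner U e e')
    (ht : t ∈ Set.Ioo A B) : SideAt U u 1 t ∧ ¬SideAt U u (-1) t := by
  have h1 := h.sideAt_end hp.ne.symm (hp.isClosed_trace j) hp.isOpen hp.frontier_eq.subset (τ := 1)
    (by simp) hs.endPoint_eq hs.arm_eq ht
  have h2 := h.sideAt_end hp.ne.symm (hp.isClosed_trace j) hp.isOpen hp.frontier_eq.subset
    (τ := -1) (by simp) hs.endPoint_eq hs.arm_eq ht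
  exact ⟨h1.1 hc.left, h2.2 hc.right_compl⟩

theorem IsPocket.side_finish_right (hs : N.IsFinish e' u ψ A B) (hc : N.IsCorner U e e')
    (ht : t ∈ Set.Ioo A B) : SideAt U u (-1) t ∧ ¬SideAt U u 1 t := by
  have h1 := h.sideAt_end hp.ne.symm (hp.isClosed_trace j) hp.isOpen hp.frontier_eq.subset (τ := 1)
    (by simp) hs.endPoint_eq hs.arm_eq ht
  have h2 := h.sideAt_end hp.ne.symm (hp.isClosed_trace j) hp.isOpen hp.frontier_eq.subset
    (τ := -1) (by simp) hs.endPoint_eq hs.arm_eq ht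
  exact ⟨h2.1 hc.right, h1.2 hc.left_compl⟩

end Sides

end PlaneNetwork

/-! ### Lenses with extra turns -/

namespace IsPolarShrinker

variable {u ψ v χ : ℝ → ℝ} {A B D : ℝ}

theorem exists_lt_of_slope_lt (h : IsPolarShrinker u ψ A B) (h' : IsPolarShrinker v χ A B)
    (hAB : A < B) (hA : u A = v A) (hs : χ A < ψ A) : ∃ t ∈ Set.Ioo A B, v t < u t := by
  have hmem : A ∈ Set.Ico A B := ⟨le_rfl, hAB⟩
  have hd := (hasDerivWithinAt_Ioi_iff_Ici.2 ((h.hasDerivWithinAt_Ici hmem).sub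
    (h'.hasDerivWithinAt_Ici hmem)))
  rw [hasDerivWithinAt_iff_tendsto_slope' (by simp)] at hd
  have hpos : 0 < Real.tan (ψ A) - Real.tan (χ A) :=
    sub_pos.2 (Real.tan_lt_tan_of_lt_of_lt_pi_div_two (h'.memψ A ⟨le_rfl, hAB.le⟩).1
      (h.memψ A ⟨le_rfl, hAB.le⟩).2 hs)
  obtain ⟨t, h1, h2⟩ := ((hd.eventually (lt_mem_nhds hpos)).and (Ioo_mem_nhdsGT hAB)).exists
  refine ⟨t, h2, ?_⟩
  rw [slope_def_field, Pi.sub_apply, Pi.sub_apply, hA, sub_self, sub_zero,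
    lt_div_iff₀ (by linarith [h2.1]), zero_mul] at h1
  linarith

theorem exists_lt_of_slope_gt (h : IsPolarShrinker u ψ A B) (h' : IsPolarShrinker v χ A B)
    (hAB : A < B) (hB : u B = v B) (hs : ψ B < χ B) : ∃ t ∈ Set.Ioo A B, v t < u t := by
  obtain ⟨t, ht, hlt⟩ := h.reflect.exists_lt_of_slope_lt h'.reflect (neg_lt_neg hAB) (by simpa using hB)
    (by simpa using hs)
  exact ⟨-t, ⟨by linarith [ht.2], by linarith [ht.1]⟩, hlt⟩

/-- Two embedded polar graphs cannot bound a region with two interior angles of 120 degrees, the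
first graph being the outer one. -/
theorem no_bigon (h : IsPolarShrinker u ψ A B) (h' : IsPolarShrinker v χ A D) (hAB : A < B)
    (hAD : A < D) (k : ℤ) (hD : D = B + k * (2 * Real.pi)) (hA : u A = v A) (hB : u B = v D)
    (hψA : ψ A = χ A + 2 * Real.pi / 3) (hψB : ψ B = χ D - 2 * Real.pi / 3)
    (hself : ∀ t, A ≤ t → t + 2 * Real.pi ≤ B → u (t + 2 * Real.pi) ≠ u t)
    (hself' : ∀ t, A ≤ t → t + 2 * Real.pi ≤ D → v (t + 2 * Real.pi) ≠ v t)
    (hd : ∀ t ∈ Set.Ioo A B, ∀ s ∈ Set.Icc A D, polar (u t) t ≠ polar (v s) s)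
    (hd' : ∀ s ∈ Set.Ioo A D, ∀ t ∈ Set.Icc A B, polar (u t) t ≠ polar (v s) s) : False := by
  have hpi := Real.two_pi_pos
  have hd0 : ∀ m : ℤ, ∀ t ∈ Set.Ioo A B, t + m * (2 * Real.pi) ∈ Set.Icc A D →
      u t ≠ v (t + m * (2 * Real.pi)) := by
    intro m t ht hs heq
    exact hd t ht _ hs (by rw [polar_add_two_pi, heq])
  have hd0' : ∀ m : ℤ, ∀ s ∈ Set.Ioo A D, s + m * (2 * Real.pi) ∈ Set.Icc A B →
      u (s + m * (2 * Real.pi)) ≠ v s := by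
    intro m s hs ht heq
    exact hd' s hs _ ht (by rw [polar_add_two_pi, heq])
  rcases lt_trichotomy k 0 with hk | rfl | hk
  -- The outer graph makes `n + 1` extra turns. It leaves and reaches the inner one from above, so
  -- `no_spiral` is applied to the negatives.
  · obtain ⟨n, hn⟩ : ∃ n : ℕ, k = -(n + 1) := ⟨(-k - 1).toNat, by omega⟩
    have hB' : B = D + (n + 1) * (2 * Real.pi) := by rw [hD, hn]; push_cast; ring
    have hnp : 0 < ((n : ℝ) + 1) * (2 * Real.pi) := by positivity
    have hc : ∀ x : ℝ, x + ((n + 1 : ℤ) : ℝ) * (2 * Real.pi) = x + (n + 1) * (2 * Real.pi) := by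
      intro x; push_cast; ring
    have ht := h.translate ((n + 1) * (2 * Real.pi))
    obtain ⟨t₁, ht₁, hlt₁⟩ := (h.restrict (le_refl A) (by linarith)).exists_lt_of_slope_lt h' hAD hA
      (by linarith)
    obtain ⟨t₂, ht₂, hlt₂⟩ := (ht.restrict (a := A) (b := D) (by linarith)
      (by linarith)).exists_lt_of_slope_gt h' hAD (by rw [← hB']; exact hB) (by rw [← hB']; linarith)
    refine no_spiral (f := fun t => -u t) (g := fun t => -v t) hpi.le n hAD (hB' ▸ h.contU.neg)
      h'.contU.neg (fun t h1 h2 => ?_) (by rw [hA]) (by rw [← hB', hB]) (fun t ht => ?_)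
      (fun t ht => ?_) ⟨t₁, ⟨ht₁.1, ht₁.2.le⟩, neg_lt_neg hlt₁⟩ ⟨t₂, ⟨ht₂.1.le, ht₂.2⟩, neg_lt_neg hlt₂⟩
    · exact fun h3 => hself t h1 (by rw [hB']; exact h2) (neg_inj.1 h3)
    · intro h3
      refine hd0 0 t ⟨ht.1, by linarith [ht.2]⟩ ?_ ?_
      · simpa using ⟨ht.1.le, ht.2⟩
      · simpa using neg_inj.1 h3
    · intro h3
      refine hd0 (-(n + 1)) (t + (n + 1) * (2 * Real.pi))
        ⟨by linarith [ht.1], by linarith [ht.2]⟩ ?_ ?_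
      · push_cast
        rw [show t + ((n : ℝ) + 1) * (2 * Real.pi) + -((n : ℝ) + 1) * (2 * Real.pi) = t by ring]
        exact ⟨ht.1, ht.2.le⟩
      · push_cast
        rw [show t + ((n : ℝ) + 1) * (2 * Real.pi) + -((n : ℝ) + 1) * (2 * Real.pi) = t by ring]
        exact neg_inj.1 h3
  · obtain rfl : D = B := by simpa using hD
    refine no_lens h h' hAB hA hB ?_ hψA hψB
    obtain ⟨t₁, ht₁, hlt₁⟩ := h.exists_lt_of_slope_lt h' hAB hA (by linarith)
    rcases forall_neg_or_forall_pos isPreconnected_Ioo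
      ((h.contU.sub h'.contU).mono Set.Ioo_subset_Icc_self) (fun t ht => sub_ne_zero.2 (by
        simpa using hd0 0 t ht (by simpa using ⟨ht.1.le, ht.2.le⟩))) with H | H
    · linarith [sub_neg.1 (H t₁ ht₁)]
    · exact fun t ht => sub_pos.1 (H t ht)
  -- The inner graph makes the extra turns, leaving and returning from below.
  · obtain ⟨n, hn⟩ : ∃ n : ℕ, k = n + 1 := ⟨(k - 1).toNat, by omega⟩
    have hD' : D = B + (n + 1) * (2 * Real.pi) := by rw [hD, hn]; push_cast; ring
    have hnp : 0 < ((n : ℝ) + 1) * (2 * Real.pi) := by positivity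
    have ht := h'.translate ((n + 1) * (2 * Real.pi))
    obtain ⟨t₁, ht₁, hlt₁⟩ := h.exists_lt_of_slope_lt (h'.restrict (le_refl A) (by linarith)) hAB hA
      (by linarith)
    obtain ⟨t₂, ht₂, hlt₂⟩ := h.exists_lt_of_slope_gt (ht.restrict (a := A) (b := B) (by linarith)
      (by linarith)) hAB (by rw [← hD']; exact hB) (by rw [← hD']; linarith)
    refine no_spiral (f := v) (g := u) hpi.le n hAB (hD' ▸ h'.contU)
      h.contU (fun t h1 h2 => hself' t h1 (hD' ▸ h2)) hA.symm (by rw [← hD', hB]) (fun t ht => ?_)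
      (fun t ht => ?_) ⟨t₁, ⟨ht₁.1, ht₁.2.le⟩, hlt₁⟩ ⟨t₂, ⟨ht₂.1.le, ht₂.2⟩, hlt₂⟩
    · intro h3
      refine hd0' 0 t ⟨ht.1, by linarith [ht.2]⟩ ?_ ?_
      · simpa using ⟨ht.1.le, ht.2⟩
      · simpa using h3.symm
    · intro h3
      refine hd0' (-(n + 1)) (t + (n + 1) * (2 * Real.pi))
        ⟨by linarith [ht.1], by linarith [ht.2]⟩ ?_ ?_
      · push_cast
        rw [show t + ((n : ℝ) + 1) * (2 * Real.pi) + -((n : ℝ) + 1) * (2 * Real.pi) = t by ring]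
        exact ⟨ht.1, ht.2.le⟩
      · push_cast
        rw [show t + ((n : ℝ) + 1) * (2 * Real.pi) + -((n : ℝ) + 1) * (2 * Real.pi) = t by ring]
        exact h3.symm

end IsPolarShrinker

/-- `polarTangent y t` has direction angle `t + π/2 - y`, so a rotation by `a` at the same polar
direction lowers the slope angle by `a`. -/
theorem polarTangent_angle {y y' t t' a : ℝ}
    (ht : Complex.exp (t * Complex.I) = Complex.exp (t' * Complex.I))
    (h : polarTangent y' t' = Complex.exp (a * Complex.I) * polarTangent y t)
    (hlt : |y - y' - a| < 2 * Real.pi) : y' = y - a := by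
  have h1 : Complex.exp ((-y' : ℝ) * Complex.I) = Complex.exp ((a - y : ℝ) * Complex.I) := by
    rw [polarTangent, polarTangent, ht] at h
    have h2 := mul_right_cancel₀ (Complex.exp_ne_zero _)
      (h.trans (by ring : _ = Complex.I * (Complex.exp (a * Complex.I) * Complex.exp (-y * Complex.I)) *
        Complex.exp (t' * Complex.I)))
    have h3 := mul_left_cancel₀ Complex.I_ne_zero h2
    rw [← Complex.exp_add] at h3
    push_cast
    rw [h3]
    congr 1
    ring
  have := eq_of_exp_mul_I_eq h1 (by rwa [show -y' - (a - y) = y - y' - a by ring])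
  linarith

theorem neg_rot120 : -rot120 = Complex.exp ((-(Real.pi / 3) : ℝ) * Complex.I) := by
  rw [rot120, show (2 * Real.pi / 3 : ℝ) = Real.pi + -(Real.pi / 3) by ring, Complex.ofReal_add,
    add_mul, Complex.exp_add, Complex.exp_pi_mul_I]
  ring

theorem polarTangent_pi_div_two (t : ℝ) :
    polarTangent (Real.pi / 2) t = Complex.exp (t * Complex.I) := by
  rw [polarTangent]
  push_cast
  rw [neg_mul, Complex.exp_neg, Complex.exp_pi_div_two_mul_I, Complex.inv_I]
  linear_combination -Complex.exp (t * Complex.I) * Complex.I_sq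

theorem polarTangent_neg_pi_div_two (t : ℝ) :
    polarTangent (-(Real.pi / 2)) t = -Complex.exp (t * Complex.I) := by
  rw [polarTangent]
  push_cast
  rw [neg_neg, Complex.exp_pi_div_two_mul_I]
  linear_combination Complex.exp (t * Complex.I) * Complex.I_sq

theorem exp_mul_I_eq_of_polar_eq {x t x' t' : ℝ} (h : polar x t = polar x' t') :
    Complex.exp (t * Complex.I) = Complex.exp (t' * Complex.I) := by
  obtain ⟨rfl, -⟩ := polar_eq_iff.1 h
  rw [polar, polar, Complex.exp_add, Complex.exp_add] at h
  exact mul_left_cancel₀ (Complex.exp_ne_zero _) h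

namespace PlaneNetwork

variable {ι : Type*} {N : PlaneNetwork ι} {i j : ι} {U : Set ℂ}

namespace IsPolar

variable {u ψ : ℝ → ℝ} {A B : ℝ}

theorem mem_trace (h : N.IsPolar i u ψ A B) {t : ℝ} (ht : t ∈ Set.Icc A B) :
    polar (u t) t ∈ N.trace i := by
  rw [h.trace_eq]; exact ⟨t, ht, rfl⟩

theorem exists_of_mem_trace (h : N.IsPolar i u ψ A B) {x θ : ℝ} (hm : polar x θ ∈ N.trace i)
    (hA : polar x θ ≠ polar (u A) A) (hB : polar x θ ≠ polar (u B) B) :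
    ∃ t ∈ Set.Ioo A B, u t = x ∧ ∃ n : ℤ, t = θ + n * (2 * Real.pi) := by
  rw [h.trace_eq] at hm
  obtain ⟨t, ht, heq⟩ := hm
  simp only at heq
  refine ⟨t, ⟨lt_of_le_of_ne ht.1 ?_, lt_of_le_of_ne ht.2 ?_⟩, polar_eq_iff.1 heq⟩
  · rintro rfl; exact hA heq.symm
  · rintro rfl; exact hB heq.symm

theorem shift_ne (h : N.IsPolar i u ψ A B) (hd : polar (u A) A ≠ polar (u B) B ∨ B ≠ A + 2 * Real.pi)
    (t : ℝ) (h1 : A ≤ t) (h2 : t + 2 * Real.pi ≤ B) : u (t + 2 * Real.pi) ≠ u t := by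
  have hpi := Real.two_pi_pos
  intro heq
  have hp : polar (u (t + 2 * Real.pi)) (t + 2 * Real.pi) = polar (u t) t :=
    polar_eq_iff.2 ⟨heq, 1, by push_cast; ring⟩
  rcases h1.eq_or_lt with rfl | h1
  · rcases h2.eq_or_lt with h2 | h2
    · rw [h2] at hp
      rcases hd with hd | hd
      · exact hd hp.symm
      · exact hd h2.symm
    · have := h.simple (A + 2 * Real.pi) ⟨by linarith, h2⟩ A ⟨le_rfl, by linarith⟩ hp
      linarith
  · have := h.simple t ⟨h1, by linarith⟩ (t + 2 * Real.pi) ⟨by linarith, h2⟩ hp.symm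
    linarith

/-- A closed polar graph winds exactly once around the origin. -/
theorem loop (h : N.IsPolar i u ψ A B) (hAB : polar (u A) A = polar (u B) B) :
    B = A + 2 * Real.pi ∧ u A = u B := by
  have hpi := Real.two_pi_pos
  obtain ⟨hu, n, hn⟩ := polar_eq_iff.1 hAB.symm
  refine ⟨?_, hu.symm⟩
  by_contra hne
  have hlt := h.lt
  have hn0 : 0 < n := by
    have : (0 : ℝ) * (2 * Real.pi) < n * (2 * Real.pi) := by linarith
    have := lt_of_mul_lt_mul_right this hpi.le
    exact_mod_cast this
  obtain ⟨m, hm⟩ : ∃ m : ℕ, n = m + 1 := ⟨(n - 1).toNat, by omega⟩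
  have hB : A + (m + 1) * (2 * Real.pi) = B := by rw [hn, hm]; push_cast; ring
  -- With more than one turn, shifting by `2π` would move the radius strictly in one direction, so
  -- the graph could not close up.
  rcases shift_iterate_sign hpi.le h.sol.contU (h.shift_ne (Or.inr hne)) m with H | H
  · have := H A le_rfl hB.le
    rw [hB] at this
    linarith
  · have := H A le_rfl hB.le
    rw [hB] at this
    linarith

end IsPolar

end PlaneNetwork

/-! ### Exclusion of the possible pairs of curves -/

namespace PlaneNetwork

variable {ι : Type*} {N : PlaneNetwork ι} {i j : ι} {U : Set ℂ}

namespace IsPocket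

/-- A ray from the origin outside the two lines would have to leave the bounded set `U` without
meeting its frontier. -/
theorem not_radial_radial (hp : N.IsPocket i j U) {d d' : ℂ} {a b a' b' : ℝ}
    (hi : N.IsRadial i d a b) (hj : N.IsRadial j d' a' b') : False := by
  obtain ⟨x, t, hx, hgen⟩ := exists_polar_mem_notMem_lines hp.isOpen hp.nonempty d d'
  obtain ⟨z, -, hz, -⟩ := exists_exit_outward hp.isOpen hp.bounded hx
  rw [hp.frontier_eq, hi.trace_eq, hj.trace_eq] at hz
  rcases hz with ⟨c, -, hc⟩ | ⟨c, -, hc⟩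
  · exact (hgen z c).1 hc.symm
  · exact (hgen z c).2 hc.symm

end IsPocket

section Exit

variable {u ψ : ℝ → ℝ} {A B : ℝ}

theorem IsPolar.side_of_exit_outward (h : N.IsPolar i u ψ A B) {x z θ : ℝ} (hxz : x < z)
    (hm : polar z θ ∈ N.trace i) (hA : polar z θ ≠ polar (u A) A) (hB : polar z θ ≠ polar (u B) B)
    (hin : ∀ w ∈ Set.Ico x z, polar w θ ∈ U) :
    ∃ t ∈ Set.Ioo A B, (∃ n : ℤ, t = θ + n * (2 * Real.pi)) ∧ x < u t ∧ SideAt U u (-1) t := by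
  obtain ⟨t, ht, rfl, n, hn⟩ := h.exists_of_mem_trace hm hA hB
  refine ⟨t, ht, ⟨n, hn⟩, hxz, sideAt_neg_of_exit hxz fun w hw => ?_⟩
  have h1 := hin w hw
  rwa [← polar_add_two_pi w θ n, ← hn] at h1

theorem IsPolar.side_of_exit_inward (h : N.IsPolar i u ψ A B) {x z θ : ℝ} (hxz : z < x)
    (hm : polar z θ ∈ N.trace i) (hA : polar z θ ≠ polar (u A) A) (hB : polar z θ ≠ polar (u B) B)
    (hin : ∀ w ∈ Set.Ioc z x, polar w θ ∈ U) :
    ∃ t ∈ Set.Ioo A B, (∃ n : ℤ, t = θ + n * (2 * Real.pi)) ∧ u t < x ∧ SideAt U u 1 t := by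
  obtain ⟨t, ht, rfl, n, hn⟩ := h.exists_of_mem_trace hm hA hB
  refine ⟨t, ht, ⟨n, hn⟩, hxz, sideAt_one_of_exit hxz fun w hw => ?_⟩
  have h1 := hin w hw
  rwa [← polar_add_two_pi w θ n, ← hn] at h1

theorem IsPolar.zero_notMem_trace (h : N.IsPolar i u ψ A B) : (0 : ℂ) ∉ N.trace i := by
  rw [h.trace_eq]
  rintro ⟨t, -, ht⟩
  exact polar_ne_zero _ _ ht

end Exit

section TwoPolar

variable {u ψ v χ : ℝ → ℝ} {A B C D : ℝ} {a b c d : ι × ℝ}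

/-- In a suitable direction, leaving a pocket bounded by two polar graphs away from the origin and
towards the origin meets the lower side of one of them and the upper side of one of them. -/
theorem IsPocket.exists_exits (hp : N.IsPocket i j U) (h0 : (0 : ℂ) ∉ U) (hi : N.IsPolar i u ψ A B)
    (hj : N.IsPolar j v χ C D) {w₁ w₂ : ℂ} (hA : polar (u A) A = w₁) (hB : polar (u B) B = w₁ ∨
      polar (u B) B = w₂) (hC : polar (v C) C = w₂) (hD : polar (v D) D = w₁ ∨ polar (v D) D = w₂) :
    ∃ x θ : ℝ, ((∃ t ∈ Set.Ioo A B, (∃ n : ℤ, t = θ + n * (2 * Real.pi)) ∧ x < u t ∧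
          SideAt U u (-1) t) ∨
        ∃ t ∈ Set.Ioo C D, (∃ n : ℤ, t = θ + n * (2 * Real.pi)) ∧ x < v t ∧ SideAt U v (-1) t) ∧
      ((∃ t ∈ Set.Ioo A B, (∃ n : ℤ, t = θ + n * (2 * Real.pi)) ∧ u t < x ∧ SideAt U u 1 t) ∨
        ∃ t ∈ Set.Ioo C D, (∃ n : ℤ, t = θ + n * (2 * Real.pi)) ∧ v t < x ∧ SideAt U v 1 t) := by
  obtain ⟨x, θ, hx, hgen⟩ := exists_polar_mem_notMem_lines hp.isOpen hp.nonempty w₁ w₂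
  have h0' : (0 : ℂ) ∉ closure U := by
    rw [closure_eq_self_union_frontier, hp.frontier_eq]
    rintro (h | h | h)
    · exact h0 h
    · exact hi.zero_notMem_trace h
    · exact hj.zero_notMem_trace h
  have hw : ∀ z : ℝ, polar z θ ≠ w₁ ∧ polar z θ ≠ w₂ := fun z => by simpa using hgen z 1
  have gA : ∀ z : ℝ, polar z θ ≠ polar (u A) A := fun z => by rw [hA]; exact (hw z).1
  have gB : ∀ z : ℝ, polar z θ ≠ polar (u B) B := fun z => by
    rcases hB with h | h <;> rw [h]
    exacts [(hw z).1, (hw z).2]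
  have gC : ∀ z : ℝ, polar z θ ≠ polar (v C) C := fun z => by rw [hC]; exact (hw z).2
  have gD : ∀ z : ℝ, polar z θ ≠ polar (v D) D := fun z => by
    rcases hD with h | h <;> rw [h]
    exacts [(hw z).1, (hw z).2]
  refine ⟨x, θ, ?_, ?_⟩
  · obtain ⟨z, hxz, hz, hin⟩ := exists_exit_outward hp.isOpen hp.bounded hx
    rw [hp.frontier_eq] at hz
    exact hz.imp (fun hz => hi.side_of_exit_outward hxz hz (gA z) (gB z) hin)
      (fun hz => hj.side_of_exit_outward hxz hz (gC z) (gD z) hin)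
  · obtain ⟨z, hxz, hz, hin⟩ := exists_exit_inward hp.isOpen h0' hx
    rw [hp.frontier_eq] at hz
    exact hz.imp (fun hz => hi.side_of_exit_inward hxz hz (gA z) (gB z) hin)
      (fun hz => hj.side_of_exit_inward hxz hz (gC z) (gD z) hin)

/-- Two polar graphs, each starting where the other one finishes. -/
theorem IsPocket.not_opposite (hp : N.IsPocket i j U) (h0 : (0 : ℂ) ∉ U) (hi : N.IsPolar i u ψ A B)
    (hj : N.IsPolar j v χ C D) (ha : N.IsStart a u ψ A B) (hb : N.IsFinish b u ψ A B)
    (hc : N.IsStart c v χ C D) (hd : N.IsFinish d v χ C D)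
    (had : N.IsCorner U a d ∨ N.IsCorner U d a) (hbc : N.IsCorner U b c ∨ N.IsCorner U c b) :
    False := by
  have e1 : polar (v D) D = polar (u A) A := by
    rw [← ha.endPoint_eq, ← hd.endPoint_eq]
    exact had.elim (fun h => h.endPoint_eq) fun h => h.endPoint_eq.symm
  have e2 : polar (u B) B = polar (v C) C := by
    rw [← hb.endPoint_eq, ← hc.endPoint_eq]
    exact hbc.elim (fun h => h.endPoint_eq.symm) fun h => h.endPoint_eq
  -- The corner at `a` and `d` puts `U` on the same side, below or above, of both graphs, so one of
  -- the two exits is impossible.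
  obtain ⟨x, θ, hout, hin⟩ := hp.exists_exits h0 hi hj rfl (Or.inr e2) rfl (Or.inl e1)
  rcases had with had | had
  · rcases hin with ⟨t, ht, -, -, hs⟩ | ⟨t, ht, -, -, hs⟩
    · exact (hp.side_start_left hi ha had ht).2 hs
    · exact (hp.symm.side_finish_right hj hd had ht).2 hs
  · rcases hout with ⟨t, ht, -, -, hs⟩ | ⟨t, ht, -, -, hs⟩
    · exact (hp.side_start_right hi ha had ht).2 hs
    · exact (hp.symm.side_finish_left hj hd had ht).2 hs

/-- The turning of a closed polar graph, as far as it is determined by the side of `U`. -/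
structure IsLoop (U : Set ℂ) (u ψ : ℝ → ℝ) (A B : ℝ) : Prop where
  polar_eq : polar (u A) A = polar (u B) B
  below : ∀ t ∈ Set.Ioo A B, SideAt U u (-1) t → ψ A ≤ ψ B
  above : ∀ t ∈ Set.Ioo A B, SideAt U u 1 t → ψ B ≤ ψ A

/-- An interior angle of 120 degrees is an exterior angle of `π/3`; it makes `ψ` jump by `π/3`, in
the sense determined by the side of `U`. -/
theorem IsPocket.isLoop (hp : N.IsPocket i j U) (hi : N.IsPolar i u ψ A B)
    (ha : N.IsStart a u ψ A B) (hb : N.IsFinish b u ψ A B)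
    (hab : N.IsCorner U a b ∨ N.IsCorner U b a) : IsLoop U u ψ A B := by
  have hpi := Real.pi_pos
  have heq : polar (u A) A = polar (u B) B := by
    rw [← ha.endPoint_eq, ← hb.endPoint_eq]
    exact hab.elim (fun h => h.endPoint_eq.symm) fun h => h.endPoint_eq
  have hexp := exp_mul_I_eq_of_polar_eq heq
  have mA := hi.sol.memψ A ⟨le_rfl, hi.lt.le⟩
  have mB := hi.sol.memψ B ⟨hi.lt.le, le_rfl⟩
  have habs : ∀ y y' : ℝ, y ∈ Set.Ioo (-(Real.pi / 2)) (Real.pi / 2) →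
      y' ∈ Set.Ioo (-(Real.pi / 2)) (Real.pi / 2) → |y - y' - -(Real.pi / 3)| < 2 * Real.pi := by
    intro y y' h h'
    rw [abs_lt]
    constructor <;> linarith [h.1, h.2, h'.1, h'.2]
  rcases hab with hab | hab
  · have h1 : ψ B = ψ A - -(Real.pi / 3) := by
      refine polarTangent_angle hexp ?_ (habs _ _ mA mB)
      rw [← neg_rot120, neg_mul, ← ha.endTangent_eq, ← hab.endTangent_eq, hb.endTangent_eq, neg_neg]
    exact ⟨heq, fun _ _ _ => by linarith,
      fun t ht hs => absurd hs (hp.side_start_left hi ha hab ht).2⟩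
  · have h1 : ψ A = ψ B - -(Real.pi / 3) := by
      refine polarTangent_angle hexp.symm ?_ (habs _ _ mB mA)
      rw [← neg_rot120, neg_mul_comm, ← hb.endTangent_eq, ← hab.endTangent_eq, ha.endTangent_eq]
    exact ⟨heq, fun t ht hs => absurd hs (hp.side_start_right hi ha hab ht).2,
      fun _ _ _ => by linarith⟩

theorem IsPocket.loops_false_aux (hp : N.IsPocket i j U) (hi : N.IsPolar i u ψ A B)
    (hj : N.IsPolar j v χ C D) (li : IsLoop U u ψ A B) (lj : IsLoop U v χ C D)
    (hne : polar (u A) A ≠ polar (v C) C) {t s θ x : ℝ} (ht : t ∈ Set.Ioo A B)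
    (hs : s ∈ Set.Ioo C D) (htθ : ∃ n : ℤ, t = θ + n * (2 * Real.pi))
    (hsθ : ∃ n : ℤ, s = θ + n * (2 * Real.pi)) (hxt : x < u t) (hsx : v s < x)
    (hbelow : SideAt U u (-1) t) (habove : SideAt U v 1 s) : False := by
  obtain ⟨rfl, huA⟩ := hi.loop li.polar_eq
  obtain ⟨rfl, -⟩ := hj.loop lj.polar_eq
  obtain ⟨n, hn⟩ := htθ
  obtain ⟨m, hm⟩ := hsθ
  have hpi := Real.two_pi_pos
  refine hi.sol.loops_false hj.sol huA (li.below t ht hbelow) (lj.above s hs habove)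
    (fun t ht s hs heq => ?_) (Set.Ioo_subset_Icc_self ht) (Set.Ioo_subset_Icc_self hs) (n := m - n)
    (by rw [hm, hn]; push_cast; ring) (hsx.trans hxt)
  have hti : t ∉ Set.Ioo A (A + 2 * Real.pi) := fun h =>
    hi.disjoint t h j hp.ne.symm (heq ▸ hj.mem_trace hs)
  have hsi : s ∉ Set.Ioo C (C + 2 * Real.pi) := fun h =>
    hj.disjoint s h i hp.ne (heq ▸ hi.mem_trace ht)
  have h1 : polar (u t) t = polar (u A) A := by
    rcases ht.1.eq_or_lt with rfl | h1
    · rfl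
    · rcases ht.2.eq_or_lt with rfl | h2
      · exact li.polar_eq.symm
      · exact absurd ⟨h1, h2⟩ hti
  have h2 : polar (v s) s = polar (v C) C := by
    rcases hs.1.eq_or_lt with rfl | h1
    · rfl
    · rcases hs.2.eq_or_lt with rfl | h2
      · exact lj.polar_eq.symm
      · exact absurd ⟨h1, h2⟩ hsi
  exact hne (by rw [← h1, heq, h2])

theorem eq_of_angle_eq {t s θ : ℝ} (ht : t ∈ Set.Ioo A (A + 2 * Real.pi))
    (hs : s ∈ Set.Ioo A (A + 2 * Real.pi)) (htθ : ∃ n : ℤ, t = θ + n * (2 * Real.pi))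
    (hsθ : ∃ n : ℤ, s = θ + n * (2 * Real.pi)) : t = s := by
  obtain ⟨n, hn⟩ := htθ
  obtain ⟨m, hm⟩ := hsθ
  refine eq_of_exp_mul_I_eq ?_ (abs_lt.2 ⟨by linarith [ht.1, hs.2], by linarith [ht.2, hs.1]⟩)
  refine exp_mul_I_eq_of_polar_eq (x := 0) (x' := 0) (polar_eq_iff.2 ⟨rfl, n - m, ?_⟩)
  rw [hn, hm]; push_cast; ring

theorem IsPocket.not_loops (hp : N.IsPocket i j U) (h0 : (0 : ℂ) ∉ U) (hi : N.IsPolar i u ψ A B)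
    (hj : N.IsPolar j v χ C D) (li : IsLoop U u ψ A B) (lj : IsLoop U v χ C D)
    (hne : polar (u A) A ≠ polar (v C) C) : False := by
  obtain ⟨x, θ, hout, hin⟩ := hp.exists_exits h0 hi hj rfl (Or.inl li.polar_eq.symm) rfl
    (Or.inr lj.polar_eq.symm)
  rcases hout with ⟨t, ht, htθ, hxt, hts⟩ | ⟨t, ht, htθ, hxt, hts⟩ <;>
    rcases hin with ⟨s, hs, hsθ, hsx, hss⟩ | ⟨s, hs, hsθ, hsx, hss⟩
  -- A loop meets each direction once, so the two exits cannot be on the same loop.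
  · rw [(hi.loop li.polar_eq).1] at ht hs
    rw [eq_of_angle_eq ht hs htθ hsθ] at hxt
    exact hxt.not_gt hsx
  · exact hp.loops_false_aux hi hj li lj hne ht hs htθ hsθ hxt hsx hts hss
  · exact hp.symm.loops_false_aux hj hi lj li hne.symm ht hs htθ hsθ hxt hsx hts hss
  · rw [(hj.loop lj.polar_eq).1] at ht hs
    rw [eq_of_angle_eq ht hs htθ hsθ] at hxt
    exact hxt.not_gt hsx

theorem IsPocket.not_parallel_aux (hp : N.IsPocket i j U) (hi : N.IsPolar i u ψ A B)
    (hj : N.IsPolar j v χ C D) (ha : N.IsStart a u ψ A B) (hb : N.IsFinish b u ψ A B)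
    (hc : N.IsStart c v χ C D) (hd : N.IsFinish d v χ C D)
    (hac : N.IsCorner U a c) (hbd : N.IsCorner U b d ∨ N.IsCorner U d b)
    (hne : N.endPoint a ≠ N.endPoint b) : False := by
  have hpi := Real.pi_pos
  -- The other order at the finish would put `U` on the opposite side of the first graph from the
  -- one found at its start.
  have hdb : N.IsCorner U d b := by
    refine hbd.resolve_left fun hbd => ?_
    have hm : (A + B) / 2 ∈ Set.Ioo A B := ⟨by linarith [hi.lt], by linarith [hi.lt]⟩
    exact (hp.side_start_left hi ha hac hm).2 (hp.side_finish_left hi hb hbd hm).1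
  have eA : polar (v C) C = polar (u A) A := by
    rw [← ha.endPoint_eq, ← hc.endPoint_eq, hac.endPoint_eq]
  have eB : polar (u B) B = polar (v D) D := by
    rw [← hb.endPoint_eq, ← hd.endPoint_eq, hdb.endPoint_eq]
  have hne1 : polar (u A) A ≠ polar (u B) B := by rwa [← ha.endPoint_eq, ← hb.endPoint_eq]
  have hne2 : polar (v C) C ≠ polar (v D) D := by rwa [eA, ← eB]
  have mA := hi.sol.memψ A ⟨le_rfl, hi.lt.le⟩
  have mB := hi.sol.memψ B ⟨hi.lt.le, le_rfl⟩
  have mC := hj.sol.memψ C ⟨le_rfl, hj.lt.le⟩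
  have mD := hj.sol.memψ D ⟨hj.lt.le, le_rfl⟩
  have tA : χ C = ψ A - 2 * Real.pi / 3 := by
    refine polarTangent_angle (exp_mul_I_eq_of_polar_eq eA.symm) ?_ ?_
    · rw [← rot120, ← ha.endTangent_eq, ← hac.endTangent_eq, hc.endTangent_eq]
    · rw [abs_lt]; constructor <;> linarith [mA.1, mA.2, mC.1, mC.2]
  have tB : ψ B = χ D - 2 * Real.pi / 3 := by
    refine polarTangent_angle (exp_mul_I_eq_of_polar_eq eB.symm) ?_ ?_
    · rw [← rot120, ← neg_inj, ← mul_neg, ← hd.endTangent_eq, ← hdb.endTangent_eq, hb.endTangent_eq]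
    · rw [abs_lt]; constructor <;> linarith [mB.1, mB.2, mD.1, mD.2]
  obtain ⟨hvC, n, hn⟩ := polar_eq_iff.1 eA
  obtain ⟨huB, m, hm⟩ := polar_eq_iff.1 eB
  have hj' := hj.sol.translate (n * (2 * Real.pi))
  have hCA : C - n * (2 * Real.pi) = A := by rw [hn]; ring
  rw [hCA] at hj'
  have hAn : A + n * (2 * Real.pi) = C := hn.symm
  refine hi.sol.no_bigon hj' hi.lt (by linarith [hj.lt]) (-m - n) ?_ ?_ ?_ ?_ ?_
    (hi.shift_ne (Or.inl hne1)) (fun t h1 h2 => ?_) (fun t ht s hs heq => ?_)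
    (fun s hs t ht heq => ?_)
  · rw [hm]; push_cast; ring
  · rw [hAn, hvC]
  · rw [sub_add_cancel, huB]
  · rw [hAn, tA]; ring
  · rw [sub_add_cancel, tB]
  · have := hj.shift_ne (Or.inl hne2) (t + n * (2 * Real.pi)) (by linarith) (by linarith)
    rwa [show t + n * (2 * Real.pi) + 2 * Real.pi = t + 2 * Real.pi + n * (2 * Real.pi) by ring] at this
  · refine hi.disjoint t ht j hp.ne.symm ?_
    rw [heq, ← polar_add_two_pi _ s n]
    exact hj.mem_trace ⟨by linarith [hs.1], by linarith [hs.2]⟩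
  · refine hj.disjoint (s + n * (2 * Real.pi)) ⟨by linarith [hs.1], by linarith [hs.2]⟩ i hp.ne ?_
    rw [polar_add_two_pi, ← heq]
    exact hi.mem_trace ht

/-- Two polar graphs with common start and common finish. -/
theorem IsPocket.not_parallel (hp : N.IsPocket i j U) (hi : N.IsPolar i u ψ A B)
    (hj : N.IsPolar j v χ C D) (ha : N.IsStart a u ψ A B) (hb : N.IsFinish b u ψ A B)
    (hc : N.IsStart c v χ C D) (hd : N.IsFinish d v χ C D)
    (hac : N.IsCorner U a c ∨ N.IsCorner U c a) (hbd : N.IsCorner U b d ∨ N.IsCorner U d b)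
    (hne : N.endPoint a ≠ N.endPoint b) : False := by
  rcases hac with hac | hac
  · exact hp.not_parallel_aux hi hj ha hb hc hd hac hbd hne
  · have h1 := hac.endPoint_eq
    have h2 : N.endPoint b = N.endPoint d :=
      hbd.elim (fun h => h.endPoint_eq.symm) fun h => h.endPoint_eq
    exact hp.symm.not_parallel_aux hj hi hc hd ha hb hac hbd.symm (by rwa [← h1, ← h2])

theorem IsPocket.not_polar_polar (hp : N.IsPocket i j U) (h0 : (0 : ℂ) ∉ U)
    (hi : N.IsPolar i u ψ A B) (hj : N.IsPolar j v χ C D) : False := by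
  have hne := hp.ne
  rcases hi.ends' with ⟨a, b, hab, rfl, hbi, haE, hbE, hall, ha, hb⟩ | ⟨hi0, hi1, hi2, hi3⟩ <;>
    rcases hj.ends' with ⟨c, d, hcd, rfl, hdj, hcE, hdE, hall', hc, hd⟩ | ⟨hj0, hj1, hj2, hj3⟩
  · have hac : a ≠ c := by rintro rfl; exact hne rfl
    have had : a ≠ d := by rintro rfl; exact hne hdj
    have hbc : b ≠ c := by rintro rfl; exact hne hbi.symm
    have hbd : b ≠ d := by rintro rfl; exact hne (hbi.symm.trans hdj)
    rcases hp.corners_of_four_ends haE hbE hcE hdE (Or.inl rfl) (Or.inl hbi) (Or.inr rfl)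
      (Or.inr hdj) hab hac had hbc hbd hcd (by
        rintro e he (h | h)
        · exact (hall e he h).imp id Or.inl
        · exact Or.inr (Or.inr (hall' e he h))) with ⟨h1, h2, h3⟩ | ⟨h1, h2, h3⟩ | ⟨h1, h2⟩
    · refine hp.not_loops h0 hi hj (hp.isLoop hi ha hb h1) (hp.symm.isLoop hj hc hd h2) ?_
      rwa [← ha.endPoint_eq, ← hc.endPoint_eq]
    · exact hp.not_parallel hi hj ha hb hc hd h1 h2 h3
    · exact hp.not_opposite h0 hi hj ha hb hc hd h1 h2
  · refine hp.not_loops h0 hi hj (hp.isLoop hi ha hb (hp.corner_of_two_ends haE hbE (Or.inl rfl)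
      (Or.inl hbi) hab ?_)) ⟨hj1, fun _ _ _ => hj2.le, fun _ _ _ => hj2.ge⟩ ?_
    · rintro e he (h | h)
      · exact hall e he h
      · exact absurd h (hj0 e he)
    · intro heq
      exact hj3 a.1 hne (heq ▸ hi.mem_trace ⟨le_rfl, hi.lt.le⟩)
  · refine hp.not_loops h0 hi hj ⟨hi1, fun _ _ _ => hi2.le, fun _ _ _ => hi2.ge⟩
      (hp.symm.isLoop hj hc hd (hp.symm.corner_of_two_ends hcE hdE (Or.inl rfl)
        (Or.inl hdj) hcd ?_)) ?_
    · rintro e he (h | h)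
      · exact hall' e he h
      · exact absurd h (hi0 e he)
    · intro heq
      exact hi3 c.1 hne.symm (heq ▸ hj.mem_trace ⟨le_rfl, hj.lt.le⟩)
  · refine hp.not_loops h0 hi hj ⟨hi1, fun _ _ _ => hi2.le, fun _ _ _ => hi2.ge⟩
      ⟨hj1, fun _ _ _ => hj2.le, fun _ _ _ => hj2.ge⟩ fun heq => ?_
    exact hi3 j hne.symm (heq ▸ hj.mem_trace ⟨le_rfl, hj.lt.le⟩)

end TwoPolar

end PlaneNetwork

/-! ### A polar graph with a radial segment, and the conclusion -/

namespace PlaneNetwork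

variable {ι : Type*} {N : PlaneNetwork ι} {i j : ι} {U : Set ℂ} {u ψ : ℝ → ℝ} {A B : ℝ}
  {a b f g : ι × ℝ} {d : ℂ} {x y : ℝ}

theorem eq_exp_or_of_mul_eq_polar (hd : ‖d‖ = 1) {r t : ℝ} (h : (x : ℂ) * d = polar r t) :
    (0 < x ∧ x = Real.exp r ∧ d = Complex.exp (t * Complex.I)) ∨
      (x < 0 ∧ x = -Real.exp r ∧ d = -Complex.exp (t * Complex.I)) := by
  have h1 := congrArg norm h
  rw [norm_mul, hd, mul_one, norm_polar, Complex.norm_real, Real.norm_eq_abs] at h1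
  have hpos := Real.exp_pos r
  have hne : Complex.exp (r : ℂ) ≠ 0 := Complex.exp_ne_zero _
  rw [polar, Complex.exp_add] at h
  rcases le_total 0 x with h0 | h0
  · rw [abs_of_nonneg h0] at h1
    refine Or.inl ⟨h1 ▸ hpos, h1, mul_left_cancel₀ hne ?_⟩
    rw [← h, h1, Complex.ofReal_exp]
  · rw [abs_of_nonpos h0] at h1
    have h2 : x = -Real.exp r := by linarith
    refine Or.inr ⟨by linarith, h2, mul_left_cancel₀ hne ?_⟩
    rw [mul_neg, ← h, h2]
    push_cast
    ring

/-- A radial tangent has slope angle `±π/2` in `polarTangent`. Of the four combinations of ray and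
order at the corner, two would force `ψ A` out of `(-π/2, π/2)`. -/
theorem IsPocket.start_radial (hp : N.IsPocket i j U) (hi : N.IsPolar i u ψ A B)
    (ha : N.IsStart a u ψ A B) (hd : ‖d‖ = 1) (hfP : N.endPoint f = x * d) (hfT : N.endTangent f = d)
    (hc : N.IsCorner U a f ∨ N.IsCorner U f a) :
    (0 < x ∧ ∀ t ∈ Set.Ioo A B, ¬SideAt U u (-1) t) ∨
      (x < 0 ∧ x = -Real.exp (u A) ∧ d = -Complex.exp (A * Complex.I) ∧ ψ A = Real.pi / 6 ∧
        ∀ t ∈ Set.Ioo A B, ¬SideAt U u 1 t) := by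
  have hpi := Real.pi_pos
  have hP : (x : ℂ) * d = polar (u A) A := by
    rw [← ha.endPoint_eq, ← hfP]
    exact hc.elim (fun h => h.endPoint_eq) fun h => h.endPoint_eq.symm
  have mA := hi.sol.memψ A ⟨le_rfl, hi.lt.le⟩
  rcases eq_exp_or_of_mul_eq_polar hd hP with ⟨h1, h2, h3⟩ | ⟨h1, h2, h3⟩
  · rcases hc with hc | hc
    · exfalso
      have : Real.pi / 2 = ψ A - 2 * Real.pi / 3 := by
        refine polarTangent_angle (t := A) (t' := A) rfl ?_ ?_
        · rw [← rot120, ← ha.endTangent_eq, ← hc.endTangent_eq, hfT, h3, polarTangent_pi_div_two]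
        · rw [abs_lt]; constructor <;> linarith [mA.1, mA.2]
      linarith [mA.2]
    · exact Or.inl ⟨h1, fun t ht => (hp.side_start_right hi ha hc ht).2⟩
  · rcases hc with hc | hc
    · have : -(Real.pi / 2) = ψ A - 2 * Real.pi / 3 := by
        refine polarTangent_angle (t := A) (t' := A) rfl ?_ ?_
        · rw [← rot120, ← ha.endTangent_eq, ← hc.endTangent_eq, hfT, h3,
            polarTangent_neg_pi_div_two]
        · rw [abs_lt]; constructor <;> linarith [mA.1, mA.2]
      exact Or.inr ⟨h1, h2, h3, by linarith, fun t ht => (hp.side_start_left hi ha hc ht).2⟩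
    · exfalso
      have : ψ A = -(Real.pi / 2) - 2 * Real.pi / 3 := by
        refine polarTangent_angle (t := A) (t' := A) rfl ?_ ?_
        · rw [← rot120, ← ha.endTangent_eq, hc.endTangent_eq, hfT, h3, polarTangent_neg_pi_div_two]
        · rw [abs_lt]; constructor <;> linarith [mA.1, mA.2]
      linarith [mA.1]

theorem IsPocket.finish_radial (hp : N.IsPocket i j U) (hi : N.IsPolar i u ψ A B)
    (hb : N.IsFinish b u ψ A B) (hd : ‖d‖ = 1) (hgP : N.endPoint g = y * d)
    (hgT : N.endTangent g = -d) (hc : N.IsCorner U b g ∨ N.IsCorner U g b) :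
    (y < 0 ∧ ∀ t ∈ Set.Ioo A B, ¬SideAt U u (-1) t ∧ SideAt U u 1 t) ∨
      (0 < y ∧ y = Real.exp (u B) ∧ d = Complex.exp (B * Complex.I) ∧ ψ B = -(Real.pi / 6) ∧
        ∀ t ∈ Set.Ioo A B, SideAt U u (-1) t) := by
  have hpi := Real.pi_pos
  have hP : (y : ℂ) * d = polar (u B) B := by
    rw [← hb.endPoint_eq, ← hgP]
    exact hc.elim (fun h => h.endPoint_eq) fun h => h.endPoint_eq.symm
  have mB := hi.sol.memψ B ⟨hi.lt.le, le_rfl⟩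
  have hT : ∀ y' : ℝ, N.endTangent g = polarTangent y' B → N.IsCorner U b g →
      |ψ B - y' - -(Real.pi / 3)| < 2 * Real.pi →
      y' = ψ B - -(Real.pi / 3) := by
    intro y' hy' hc hlt
    refine polarTangent_angle (t := B) (t' := B) rfl ?_ hlt
    rw [← neg_rot120, neg_mul_comm, ← hb.endTangent_eq, ← hc.endTangent_eq, hy']
  have hT' : ∀ y' : ℝ, N.endTangent g = polarTangent y' B → N.IsCorner U g b →
      |y' - ψ B - -(Real.pi / 3)| < 2 * Real.pi →
      ψ B = y' - -(Real.pi / 3) := by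
    intro y' hy' hc hlt
    refine polarTangent_angle (t := B) (t' := B) rfl ?_ hlt
    rw [← neg_rot120, neg_mul, ← hy', ← hc.endTangent_eq, hb.endTangent_eq, neg_neg]
  rcases eq_exp_or_of_mul_eq_polar hd hP with ⟨h1, h2, h3⟩ | ⟨h1, h2, h3⟩
  · have h4 : N.endTangent g = polarTangent (-(Real.pi / 2)) B := by
      rw [hgT, h3, polarTangent_neg_pi_div_two]
    rcases hc with hc | hc
    · have := hT _ h4 hc (by rw [abs_lt]; constructor <;> linarith [mB.1, mB.2])
      linarith [mB.1]
    · have := hT' _ h4 hc (by rw [abs_lt]; constructor <;> linarith [mB.1, mB.2])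
      exact Or.inr ⟨h1, h2, h3, by linarith, fun t ht => (hp.side_finish_right hi hb hc ht).1⟩
  · have h4 : N.endTangent g = polarTangent (Real.pi / 2) B := by
      rw [hgT, h3, polarTangent_pi_div_two, neg_neg]
    rcases hc with hc | hc
    · exact Or.inl ⟨h1, fun t ht => (hp.side_finish_left hi hb hc ht).symm⟩
    · have := hT' _ h4 hc (by rw [abs_lt]; constructor <;> linarith [mB.1, mB.2])
      linarith [mB.2]

/-- A polar graph and a radial segment with common ends. -/
theorem IsPocket.not_polar_radial_aux (hp : N.IsPocket i j U) (hi : N.IsPolar i u ψ A B)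
    (ha : N.IsStart a u ψ A B) (hb : N.IsFinish b u ψ A B) (hd : ‖d‖ = 1) (hxy : x < y)
    (htr : ∀ r ∈ Set.Icc x y, (r : ℂ) * d ∈ N.trace j)
    (hfP : N.endPoint f = x * d) (hfT : N.endTangent f = d) (hgP : N.endPoint g = y * d)
    (hgT : N.endTangent g = -d) (haf : N.IsCorner U a f ∨ N.IsCorner U f a)
    (hbg : N.IsCorner U b g ∨ N.IsCorner U g b) : False := by
  have hpi := Real.two_pi_pos
  have hm : (A + B) / 2 ∈ Set.Ioo A B := ⟨by linarith [hi.lt], by linarith [hi.lt]⟩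
  rcases hp.start_radial hi ha hd hfP hfT haf with ⟨h1, h2⟩ | ⟨h1, h2, h3, h4, h5⟩ <;>
    rcases hp.finish_radial hi hb hd hgP hgT hbg with ⟨k1, k2⟩ | ⟨k1, k2, k3, k4, k5⟩
  · linarith
  · exact h2 _ hm (k5 _ hm)
  · exact h5 _ hm (k2 _ hm).2
  -- Only a segment through the origin is left; its ends lie on opposite rays, so the graph covers
  -- an odd number of half turns.
  · have hexp : polar 0 B = polar 0 (A + Real.pi) := by
      rw [polar, polar]
      simp only [Complex.ofReal_zero, zero_add, Complex.ofReal_add, add_mul, Complex.exp_add,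
        Complex.exp_pi_mul_I]
      rw [← k3, h3]
      ring
    obtain ⟨-, n, hn⟩ := polar_eq_iff.1 hexp
    have hlt := hi.lt
    have hn0 : 0 ≤ n := by
      by_contra! hneg
      have h6 : (n : ℝ) ≤ -1 := by exact_mod_cast Int.le_sub_one_of_lt hneg
      nlinarith
    rcases hn0.eq_or_lt with rfl | hn0
    · exact hi.sol.no_half_lens h4 k4 (by rw [hn]; simp)
    · have h6 : (1 : ℝ) ≤ n := by exact_mod_cast hn0
      have h7 : A + 2 * Real.pi < B := by nlinarith [Real.pi_pos]
      have hpA : ∀ r, polar r (A + 2 * Real.pi) = ((-Real.exp r : ℝ) : ℂ) * d := by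
        intro r
        have := polar_add_two_pi r A 1
        rw [Int.cast_one, one_mul] at this
        rw [this, polar, Complex.exp_add, h3]
        push_cast
        ring
      have hpB : ∀ r, polar r (B - 2 * Real.pi) = ((Real.exp r : ℝ) : ℂ) * d := by
        intro r
        have := polar_add_two_pi r B (-1)
        rw [Int.cast_neg, Int.cast_one, neg_one_mul, ← sub_eq_add_neg] at this
        rw [this, polar, Complex.exp_add, k3]
        push_cast
        ring
      -- With extra turns, the graph crosses both rays again and must do so beyond the ends of the
      -- segment. Then the radius increases under one turn from `A` and decreases under one turn up
      -- to `B`.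
      have hA : u A < u (A + 2 * Real.pi) := by
        by_contra! hle
        refine hi.disjoint (A + 2 * Real.pi) ⟨by linarith, h7⟩ j hp.ne.symm ?_
        rw [hpA]
        have := Real.exp_le_exp.2 hle
        exact htr _ ⟨by linarith, by linarith [Real.exp_pos (u (A + 2 * Real.pi))]⟩
      have hB : u B < u (B - 2 * Real.pi) := by
        by_contra! hle
        refine hi.disjoint (B - 2 * Real.pi) ⟨by linarith, by linarith⟩ j hp.ne.symm ?_
        rw [hpB]
        have := Real.exp_le_exp.2 hle
        exact htr _ ⟨by linarith [Real.exp_pos (u (B - 2 * Real.pi))], by linarith⟩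
      rcases shift_sign hpi.le hi.sol.contU (hi.shift_ne (Or.inr h7.ne')) with H | H
      · linarith [H A le_rfl h7.le]
      · have := H (B - 2 * Real.pi) (by linarith) (by linarith)
        rw [sub_add_cancel] at this
        linarith

theorem IsPocket.not_polar_radial (hp : N.IsPocket i j U) (hi : N.IsPolar i u ψ A B)
    (hj : N.IsRadial j d x y) : False := by
  have hne := hp.ne
  obtain ⟨f, g, hfg, rfl, hgj, hfE, hgE, hall', hfP, hgP, hfT, hgT⟩ := hj.ends
  have hd0 : d ≠ 0 := by
    rw [← norm_ne_zero_iff, hj.norm_eq]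
    exact one_ne_zero
  have hPfg : N.endPoint f ≠ N.endPoint g := by
    rw [hfP, hgP]
    intro h
    exact hj.lt.ne (by exact_mod_cast mul_right_cancel₀ hd0 h)
  have hPfg' : ¬(N.IsCorner U f g ∨ N.IsCorner U g f) := by
    rintro (h | h)
    · exact hPfg h.endPoint_eq.symm
    · exact hPfg h.endPoint_eq
  rcases hi.ends' with ⟨a, b, hab, rfl, hbi, haE, hbE, hall, ha, hb⟩ | ⟨hi0, -⟩
  · have haf : a ≠ f := by rintro rfl; exact hne rfl
    have hag : a ≠ g := by rintro rfl; exact hne hgj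
    have hbf : b ≠ f := by rintro rfl; exact hne hbi.symm
    have hbg : b ≠ g := by rintro rfl; exact hne (hbi.symm.trans hgj)
    rcases hp.corners_of_four_ends haE hbE hfE hgE (Or.inl rfl) (Or.inl hbi) (Or.inr rfl)
      (Or.inr hgj) hab haf hag hbf hbg hfg (by
        rintro e he (h | h)
        · exact (hall e he h).imp id Or.inl
        · exact Or.inr (Or.inr (hall' e he h))) with ⟨-, h2, -⟩ | ⟨h1, h2, -⟩ | ⟨h1, h2⟩
    · exact hPfg' h2
    · exact hp.not_polar_radial_aux hi ha hb hj.norm_eq hj.lt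
        (fun r hr => by rw [hj.trace_eq]; exact ⟨r, hr, rfl⟩) hfP hfT hgP hgT h1 h2
    -- The segment is run through backwards, by changing the sign of its direction.
    · refine hp.not_polar_radial_aux (x := -y) (y := -x) (d := -d) hi ha hb
        (by rw [norm_neg, hj.norm_eq]) (neg_lt_neg hj.lt) (fun r hr => ?_)
        (by rw [hgP]; push_cast; ring) hgT (by rw [hfP]; push_cast; ring) (by rw [hfT, neg_neg]) h1 h2
      rw [hj.trace_eq]
      exact ⟨-r, ⟨by linarith [hr.2], by linarith [hr.1]⟩, by push_cast; ring⟩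
  · refine hPfg' (hp.corner_of_two_ends hfE hgE (Or.inr rfl) (Or.inr hgj) hfg ?_)
    rintro e he (h | h)
    · exact absurd h (hi0 e he)
    · exact hall' e he h

theorem IsPocket.zero_mem (hp : N.IsPocket i j U) (hshr : N.IsShrinking) : (0 : ℂ) ∈ U := by
  by_contra h0
  have hb : ∀ k, N.trace k ⊆ frontier U → Bornology.IsBounded (N.trace k) := fun k hk =>
    hp.bounded.closure.subset (hk.trans frontier_subset_closure)
  rcases isPolar_or_isRadial hp.reg hshr
    (hb i (hp.frontier_eq ▸ Set.subset_union_left)) with ⟨u, ψ, A, B, hi⟩ | ⟨d, x, y, hi⟩ <;>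
    rcases isPolar_or_isRadial hp.reg hshr
      (hb j (hp.frontier_eq ▸ Set.subset_union_right)) with ⟨v, χ, C, D, hj⟩ | ⟨d', x', y', hj⟩
  · exact hp.not_polar_polar h0 hi hj
  · exact hp.not_polar_radial hi hj
  · exact hp.symm.not_polar_radial hj hi
  · exact hp.not_radial_radial hi hj

/-- A two-curve region of a shrinking network contains the origin. -/
theorem IsTwoCurveRegion.zero_mem (hreg : N.IsRegular) (hshr : N.IsShrinking)
    (hU : N.IsTwoCurveRegion U) : IsOpen U ∧ (0 : ℂ) ∈ U := by
  obtain ⟨⟨z, hz, rfl⟩, hb, i, j, hij, hfr⟩ := hU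
  have hopen : IsOpen (connectedComponentIn N.supportᶜ z) :=
    (isClosed_support hreg hshr).isOpen_compl.connectedComponentIn
  have hk : ∀ k, N.trace k ⊆ frontier (connectedComponentIn N.supportᶜ z) →
      (∃ ℓ, N.kind k = CurveKind.arc ℓ) ∨ ∃ ℓ, N.kind k = CurveKind.closed ℓ := fun k hk =>
    kind_of_isBounded hreg hshr (hb.closure.subset (hk.trans frontier_subset_closure))
  have hp : N.IsPocket i j (connectedComponentIn N.supportᶜ z) :=
    ⟨hreg, hij, hopen, ⟨z, mem_connectedComponentIn hz⟩, hb,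
      fun w hw => connectedComponentIn_subset _ _ hw, hfr,
      hk i (hfr ▸ Set.subset_union_left), hk j (hfr ▸ Set.subset_union_right),
      isClosed_trace hreg hshr⟩
  exact ⟨hopen, hp.zero_mem hshr⟩

end PlaneNetwork

theorem mainTheorem2 {ι : Type*} (N : PlaneNetwork ι) (hreg : N.IsRegular)
    (hshr : N.IsShrinking) :
    (∀ U : Set ℂ, N.IsTwoCurveRegion U → (0 : ℂ) ∈ interior U) ∧
      (∀ U V : Set ℂ, N.IsTwoCurveRegion U → N.IsTwoCurveRegion V → U = V) := by
  refine ⟨fun U hU => ?_, fun U V hU hV => ?_⟩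
  · obtain ⟨hopen, h0⟩ := hU.zero_mem hreg hshr
    rwa [hopen.interior_eq]
  · have hU0 := (hU.zero_mem hreg hshr).2
    have hV0 := (hV.zero_mem hreg hshr).2
    obtain ⟨⟨z, -, rfl⟩, -⟩ := hU
    obtain ⟨⟨w, -, rfl⟩, -⟩ := hV
    -- Both regions are the connected component of the origin in the complement of the network.
    rw [connectedComponentIn_eq hU0, connectedComponentIn_eq hV0]
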